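/- **Setting.** Let $\mu\le_{cx}\nu$ be probability measures on $\mathbb R$ with finite first moments, in convex order, with densities $\rho,\eta\ge 0$ that are symmetric about $0$. Suppose that for some $\alpha,\beta\in(0,\infty]$ we have $\rho>0$ on $(-\alpha,\alpha)$, $\mu((-\alpha,\alpha))=1$, $\eta>0$ on $(-\beta,\beta)$, $\nu((-\beta,\beta))=1$, and that for some $e\in(0,\alpha)$ we have $\rho>\eta$ on $(-e,e)$ and $\eta>\rho$ on $(-\beta,-e)\cup(e,\beta)$. Let $a\ge b\ge 0$ be convex functions on $\mathbb R$, symmetric about $0$, with $a\ne b$ and $\lim_{x\to\beta}b(x)>a(0)$. A *model* is a filtered probability space $(\Omega,\mathcal F,(\mathcal F_0,\mathcal F_1,\mathcal F_2),\mathbb P)$ with a martingale $(Z_0,Z_1,Z_2)$ such that $Z_1\sim\mu$, $Z_2\sim\nu$. The primal value $\mathcal P$ is the supremum, over all models and all stopping times $\tau$ with values in $\{1,2\}$, of $\mathbb E[a(Z_1)I_{\{\tau=1\}}+b(Z_2)I_{\{\tau=2\}}]\in[0,\infty]$. A *superhedge* is a quadruple $(\phi,\psi,\theta_1,\theta_2)$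 of real functions on $\mathbb R$ ($\phi,\psi$ Borel) with $a(x)\le\phi(x)+\psi(y)+\theta_1(x)(y-x)$ and $b(y)\le\phi(x)+\psi(y)+\theta_2(x)(y-x)$ for all $x,y\in\mathbb R$; its cost is $\int\phi\,d\mu+\int\psi\,d\nu$ (with $(-\infty)+\infty=\infty$), and the dual value $\mathcal D$ is the infimum of the costs. A convex $\psi\ge b$ *generates* the superhedge $((a-\psi)^+,\psi,-\psi',0)$, where $\psi'$ is the right derivative. For $x\in(-\alpha,e)$ let $f^R(x)<x<g^R(x)$ in $(-\beta,\beta)$ solve $\int_x^{g^R(x)}z^i\rho(z)\,dz=\int_{f^R(x)}^{g^R(x)}z^i\eta(z)\,dz$, $i=0,1$; for $x\in(-e,\alpha)$ let $f^L(x)<x<g^L(x)$ in $(-\beta,\beta)$ solve $\int_{f^L(x)}^{x}z^i\rho(z)\,dz=\int_{f^L(x)}^{g^L(x)}z^i\eta(z)\,dz$, $i=0,1$. Let $x_0$ be the point of $(0,e)$ with $f^R(x_0)=0$. For $x\in[x_0,e)$ let $\tilde l_x$ be the line through $(x,a(x))$ and $(g^R(x),b(g^R(x)))$, and put $l=\tilde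 l_{x_0}$. For $f<x<g$ let $\delta^x_{f,g}=\frac{g-x}{g-f}\delta_f+\frac{x-f}{g-f}\delta_g$. Let $\pi^R_x=\delta_x$ for $x\ge e$ and $\pi^R_x=\delta^x_{f^R(x),g^R(x)}$ for $-\alpha<x<e$; let $\pi^L_x=\delta_x$ for $x\le -e$ and $\pi^L_x=\delta^x_{f^L(x),g^L(x)}$ for $-e<x<\alpha$. If $\chi$ is a measure carried by $(-\gamma,\gamma)$ and $\xi$ a measure carried by its complement, with the same mass and mean, let $\pi^{HK,\chi,\xi}_x=\delta^x_{p(x),q(x)}$ for $x \in(-\gamma,\gamma)$, where $p(x)<-\gamma$, $q(x)>\gamma$ solve $\int_{-\gamma}^xz^i\chi(dz)=\int_{q(x)}^\infty z^i\xi(dz)+\int_{p(x)}^{-\gamma}z^i\xi(dz)$, $i=0,1$. **Theorem.** Assume $l(0)<a(0)$. (i) Suppose $a(e)>b(e)$. Then there exists $x_3\in(x_0,e)$ with $\tilde l_{x_3}(f^R(x_3))=a(f^R(x_3))$. For any such $x_3$ let $\psi^{*,3}(x)$ be $b(x)$ for $|x|>g^R(x_3)$, $a(x)$ for $|x|<f^R(x_3)$,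 $\tilde l_{x_3}(x)$ for $x\in[f^R(x_3),g^R(x_3)]$ and $\tilde l_{x_3}(-x)$ for $x\in[-g^R(x_3),-f^R(x_3)]$. Let $x_4\in(g^R(x_3),\beta)$ satisfy $(\mu-\nu)((0,f^R(x_3)))=(\nu-\mu)((x_4,\infty))$. Let $\mathbb P^*$ be the law of $(U,X,Y)$ where $U$ is uniform on $[0,1]$, $X\sim\mu$ is independent of $U$, and the conditional law of $Y$ given $U=u$, $X=x$ is: $\pi^L_x$ if $x\le -x_3$; $\pi^R_x$ if $x\ge x_3$; $\pi^{HK,\chi_3,\xi_3}_x$ if $x\in(-x_3,g^L(-x_3))\cup(f^R(x_3),x_3)$, with $\chi_3=\mu|_{(-x_3,g^L(-x_3))\cup(f^R(x_3),x_3)}$ and $\xi_3=(\nu-\mu)|_{(-x_4,f^L(-x_3))\cup(g^R(x_3),x_4)}$; and, if $x\in(g^L(-x_3),f^R(x_3))$, $\delta_x$ when $u\le\eta(x)/\rho(x)$ and $\pi^{HK,\chi_4,\xi_4}_x$ when $u>\eta(x)/\rho(x)$, with $\chi_4=(\mu-\nu)|_{(g^L(-x_3),f^R(x_3))}$ and $\xi_4=(\nu-\mu)|_{(-\beta,-x_4)\cup(x_4,\beta)}$.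 Let $\mathcal M^*$ be the space of triples $(u,x,y)$ with $\mathbb P^*$, $\mathcal F_0$ trivial, $\mathcal F_1=\sigma(U,X)$, $\mathcal F_2$ the Borel $\sigma$-algebra, $Z_0=0$, $Z_1=X$, $Z_2=Y$; let $\tau^*=1$ if $X\notin(-x_3,x_3)$ or if $X\in(g^L(-x_3),f^R(x_3))$ and $U<\eta(X)/\rho(X)$, and $\tau^*=2$ otherwise. Then $\mathcal M^*$ is a model, $\tau^*$ is a stopping time in it, $\psi^{*,3}$ is convex and $\ge b$, and $$\mathbb E^{\mathcal M^*}[a(Z_1)I_{\{\tau^*=1\}}+b(Z_2)I_{\{\tau^*=2\}}]=\int(a-\psi^{*,3})^+d\mu+\int\psi^{*,3}d\nu .$$ Consequently $(\mathcal M^*,\tau^*)$ gives the highest model-based price $\mathcal P$, $\psi^{*,3}$ generates the cheapest superhedge (of cost $\mathcal D$), and there is no duality gap: $\mathcal P=\mathcal D$. (ii) Suppose $a(e)=b(e)$. Then the same conclusions hold with $\psi^{*,3}$ replaced by $\tilde\psi^{*,3}$, equal to $a$ on $[-e,e]$ and to $b$ elsewhere; with the conditional law of $Y$ given $U=u$,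 $X=x$ replaced by $\pi^{HK,\tilde\chi,\tilde\xi}_x$ if $|x|<e$ and $u>\eta(x)/\rho(x)$, and $\delta_x$ otherwise, where $\tilde\chi=(\mu-\nu)|_{(-e,e)}$ and $\tilde\xi=(\nu-\mu)|_{(-\beta,-e)\cup(e,\beta)}$; and with $\tau^*$ replaced by $\tilde\tau^*$, equal to $1$ if $|X|>e$, or if $|X|<e$ and $U\le\eta(X)/\rho(X)$, and to $2$ otherwise. -/

import Mathlib

open MeasureTheory ProbabilityTheory Set

universe u

namespace Bermudan

/-! ### Extended integrals, convex order, superhedges and the dual problem -/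

/-- The integral of a real function with values in `[-∞, ∞]`, with the convention that it equals
`+∞` as soon as the positive part has infinite integral. -/
noncomputable def extIntegral (m : Measure ℝ) (f : ℝ → ℝ) : EReal :=
  if ∫⁻ x, ENNReal.ofReal (f x) ∂m = ⊤ then ⊤
  else ((∫⁻ x, ENNReal.ofReal (f x) ∂m : ENNReal) : EReal)
    - ((∫⁻ x, ENNReal.ofReal (-f x) ∂m : ENNReal) : EReal)

/-- Convex order of two integrable probability measures on the line. -/
def ConvexOrder (μ ν : Measure ℝ) : Prop :=
  Integrable id μ ∧ Integrable id ν ∧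
    ∀ f : ℝ → ℝ, ConvexOn ℝ univ f → extIntegral μ f ≤ extIntegral ν f

/-- `(φ, ψ, θ₁, θ₂)` is a superhedge of the Bermudan claim `(a, b)`. The functions `φ`, `ψ`, which
are integrated against the marginals, are Borel; no regularity is asked of `θ₁`, `θ₂`. -/
structure IsSuperhedge (a b φ ψ θ₁ θ₂ : ℝ → ℝ) : Prop where
  measurable_phi : Measurable φ
  measurable_psi : Measurable ψ
  ineq_one : ∀ x y, a x ≤ φ x + ψ y + θ₁ x * (y - x)
  ineq_two : ∀ x y, b y ≤ φ x + ψ y + θ₂ x * (y - x)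

open Classical in
/-- The hedging cost `∫ φ dμ + ∫ ψ dν`, with the convention `(-∞) + ∞ = ∞`. -/
noncomputable def hedgingCost (μ ν : Measure ℝ) (φ ψ : ℝ → ℝ) : EReal :=
  if extIntegral μ φ = ⊤ ∨ extIntegral ν ψ = ⊤ then ⊤
  else extIntegral μ φ + extIntegral ν ψ

/-- The value of the dual (superhedging) problem. -/
noncomputable def dualValue (μ ν : Measure ℝ) (a b : ℝ → ℝ) : EReal :=
  sInf {c | ∃ φ ψ θ₁ θ₂ : ℝ → ℝ, IsSuperhedge a b φ ψ θ₁ θ₂ ∧ c = hedgingCost μ ν φ ψ}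

/-- The time-1 static position `(a - ψ)⁺` of the superhedge generated by `ψ`. -/
def generatedPhi (a ψ : ℝ → ℝ) (x : ℝ) : ℝ := max (a x - ψ x) 0

/-- Minus the right derivative of `ψ`: the dynamic position after exercise at time 1 in the
superhedge generated by `ψ`; the other dynamic position is `0`. -/
noncomputable def generatedTheta (ψ : ℝ → ℝ) (x : ℝ) : ℝ := -derivWithin ψ (Ioi x) x

/-! ### Models, exercise rules and the primal problem -/

/-- A filtered probability space carrying a martingale `(Z₀, Z₁, Z₂)` with `Z₁ ∼ μ`, `Z₂ ∼ ν`. -/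
structure IsModel (μ ν : Measure ℝ) {Ω : Type u} {mΩ : MeasurableSpace Ω} (P : Measure Ω)
    (ℱ : Filtration (Fin 3) mΩ) (Z : Fin 3 → Ω → ℝ) : Prop where
  isProbabilityMeasure : IsProbabilityMeasure P
  martingale : Martingale Z ℱ P
  law_one : P.map (Z 1) = μ
  law_two : P.map (Z 2) = ν

/-- Stopping times with values in `{1, 2}`. -/
structure IsExerciseRule {Ω : Type u} {mΩ : MeasurableSpace Ω}
    (ℱ : Filtration (Fin 3) mΩ) (τ : Ω → WithTop (Fin 3)) : Prop where
  isStoppingTime : IsStoppingTime ℱ τ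
  mem : ∀ ω, τ ω = ((1 : Fin 3) : WithTop (Fin 3)) ∨ τ ω = ((2 : Fin 3) : WithTop (Fin 3))

open Classical in
/-- The expected payoff `E[a(Z₁) 1_{τ=1} + b(Z₂) 1_{τ=2}]` in `[0, ∞]`, for non-negative payoffs
`a`, `b` and an exercise rule `τ`. -/
noncomputable def price (a b : ℝ → ℝ) {Ω : Type u} {mΩ : MeasurableSpace Ω} (P : Measure Ω)
    (Z : Fin 3 → Ω → ℝ) (τ : Ω → WithTop (Fin 3)) : ENNReal :=
  ∫⁻ ω, (if τ ω = ((1 : Fin 3) : WithTop (Fin 3)) then ENNReal.ofReal (a (Z 1 ω))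
    else ENNReal.ofReal (b (Z 2 ω))) ∂P

/-- The value of the primal problem: the highest model-based price. -/
noncomputable def primalValue (μ ν : Measure ℝ) (a b : ℝ → ℝ) : ENNReal :=
  sSup {v | ∃ (Ω : Type) (mΩ : MeasurableSpace Ω) (P : Measure Ω) (ℱ : Filtration (Fin 3) mΩ)
    (Z : Fin 3 → Ω → ℝ) (τ : Ω → WithTop (Fin 3)),
    IsModel μ ν P ℱ Z ∧ IsExerciseRule ℱ τ ∧ v = price a b P Z τ}

/-! ### The symmetric setting -/

/-- Symmetric marginals in convex order with densities satisfying the dispersion assumption. -/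
structure SymmetricDispersion (μ ν : Measure ℝ) (ρ η : ℝ → ℝ) (α β : EReal) (e : ℝ) : Prop where
  convexOrder : ConvexOrder μ ν
  measurable_rho : Measurable ρ
  measurable_eta : Measurable η
  rho_nonneg : ∀ x, 0 ≤ ρ x
  eta_nonneg : ∀ x, 0 ≤ η x
  density_mu : μ = volume.withDensity fun x => ENNReal.ofReal (ρ x)
  density_nu : ν = volume.withDensity fun x => ENNReal.ofReal (η x)
  rho_even : ∀ x, ρ (-x) = ρ x
  eta_even : ∀ x, η (-x) = η x
  alpha_pos : 0 < α
  beta_pos : 0 < β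
  rho_pos : ∀ x : ℝ, ((|x| : ℝ) : EReal) < α → 0 < ρ x
  eta_pos : ∀ x : ℝ, ((|x| : ℝ) : EReal) < β → 0 < η x
  mu_support : μ {x : ℝ | ((|x| : ℝ) : EReal) < α} = 1
  nu_support : ν {x : ℝ | ((|x| : ℝ) : EReal) < β} = 1
  e_pos : 0 < e
  e_lt : (e : EReal) < α
  inside : ∀ x : ℝ, |x| < e → η x < ρ x
  outside : ∀ x : ℝ, e < |x| → ((|x| : ℝ) : EReal) < β → ρ x < η x

/-- Symmetric convex payoffs `a ≥ b ≥ 0`, `a ≠ b`, with `lim_{x → β} b(x) > a(0)`. As `b` is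
continuous and non-decreasing on `[0, ∞)`, the last condition says that `b` exceeds `a 0` somewhere
on `[0, β)`. -/
structure SymmetricPayoffs (a b : ℝ → ℝ) (β : EReal) : Prop where
  nonneg : ∀ x, 0 ≤ b x
  le : ∀ x, b x ≤ a x
  ne : a ≠ b
  convex_a : ConvexOn ℝ univ a
  convex_b : ConvexOn ℝ univ b
  even_a : ∀ x, a (-x) = a x
  even_b : ∀ x, b (-x) = b x
  limit : ∃ x : ℝ, 0 ≤ x ∧ (x : EReal) < β ∧ a 0 < b x

/-! ### Curtain couplings -/

/-- `(f, g)` solves the equations of the right-curtain coupling at `x`. -/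
def IsRightCurtainPair (ρ η : ℝ → ℝ) (β : EReal) (x : ℝ) (p : ℝ × ℝ) : Prop :=
  ((|p.1| : ℝ) : EReal) < β ∧ ((|p.2| : ℝ) : EReal) < β ∧ p.1 < x ∧ x < p.2 ∧
    ∀ i : ℕ, i ≤ 1 → ∫ z in x..p.2, z ^ i * ρ z = ∫ z in p.1..p.2, z ^ i * η z

/-- `(f, g)` solves the equations of the left-curtain coupling at `x`. -/
def IsLeftCurtainPair (ρ η : ℝ → ℝ) (β : EReal) (x : ℝ) (p : ℝ × ℝ) : Prop :=
  ((|p.1| : ℝ) : EReal) < β ∧ ((|p.2| : ℝ) : EReal) < β ∧ p.1 < x ∧ x < p.2 ∧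
    ∀ i : ℕ, i ≤ 1 → ∫ z in p.1..x, z ^ i * ρ z = ∫ z in p.1..p.2, z ^ i * η z

/-- `f^R` (used on `(-α, e)`, where the equations have exactly one solution). -/
noncomputable def fR (ρ η : ℝ → ℝ) (β : EReal) (x : ℝ) : ℝ :=
  (Classical.epsilon (IsRightCurtainPair ρ η β x)).1

/-- `g^R` (used on `(-α, e)`). -/
noncomputable def gR (ρ η : ℝ → ℝ) (β : EReal) (x : ℝ) : ℝ :=
  (Classical.epsilon (IsRightCurtainPair ρ η β x)).2

/-- `f^L` (used on `(-e, α)`). -/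
noncomputable def fL (ρ η : ℝ → ℝ) (β : EReal) (x : ℝ) : ℝ :=
  (Classical.epsilon (IsLeftCurtainPair ρ η β x)).1

/-- `g^L` (used on `(-e, α)`). -/
noncomputable def gL (ρ η : ℝ → ℝ) (β : EReal) (x : ℝ) : ℝ :=
  (Classical.epsilon (IsLeftCurtainPair ρ η β x)).2

/-- The probability measure on `{f, g}` with mean `x`, for `f < x < g`. -/
noncomputable def twoPoint (x f g : ℝ) : Measure ℝ :=
  ENNReal.ofReal ((g - x) / (g - f)) • Measure.dirac f
    + ENNReal.ofReal ((x - f) / (g - f)) • Measure.dirac g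

open Classical in
/-- The kernel of the right-curtain coupling. -/
noncomputable def rightKernel (ρ η : ℝ → ℝ) (β : EReal) (e x : ℝ) : Measure ℝ :=
  if e ≤ x then Measure.dirac x else twoPoint x (fR ρ η β x) (gR ρ η β x)

open Classical in
/-- The kernel of the left-curtain coupling. -/
noncomputable def leftKernel (ρ η : ℝ → ℝ) (β : EReal) (e x : ℝ) : Measure ℝ :=
  if x ≤ -e then Measure.dirac x else twoPoint x (fL ρ η β x) (gL ρ η β x)

/-! ### The Hobson-Klimmek coupling -/

/-- `(p, q)` solves the equations at `x ∈ (-γ, γ)` of the Hobson-Klimmek coupling of the measure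
with density `χ` carried by `(-γ, γ)` and the measure with density `ξ` carried by the complement:
mass to the left of `x` is sent to `(p, -γ) ∪ (q, ∞)`. -/
def IsHKPair (χ ξ : ℝ → ℝ) (γ x : ℝ) (p : ℝ × ℝ) : Prop :=
  p.1 < -γ ∧ γ < p.2 ∧
    ∀ i : ℕ, i ≤ 1 → ∫ z in (-γ)..x, z ^ i * χ z
      = (∫ z in Ioi p.2, z ^ i * ξ z) + ∫ z in p.1..(-γ), z ^ i * ξ z

/-- The kernel of the Hobson-Klimmek coupling (used for `x ∈ (-γ, γ)`). -/
noncomputable def hkKernel (χ ξ : ℝ → ℝ) (γ x : ℝ) : Measure ℝ :=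
  twoPoint x (Classical.epsilon (IsHKPair χ ξ γ x)).1 (Classical.epsilon (IsHKPair χ ξ γ x)).2

/-! ### Special points and candidate functions -/

/-- The point `x₀ ∈ (0, e)` with `f^R(x₀) = 0`. -/
noncomputable def x₀ (ρ η : ℝ → ℝ) (β : EReal) (e : ℝ) : ℝ :=
  Classical.epsilon fun x => 0 < x ∧ x < e ∧ fR ρ η β x = 0

/-- `t ↦ chord … x t` is the line through `(x, a(x))` and `(g^R(x), b(g^R(x)))`. -/
noncomputable def chord (ρ η a b : ℝ → ℝ) (β : EReal) (x t : ℝ) : ℝ :=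
  a x + (b (gR ρ η β x) - a x) / (gR ρ η β x - x) * (t - x)

/-- `x₃ ∈ (x₀, e)` is such that the line through `(x₃, a(x₃))` and `(g^R(x₃), b(g^R(x₃)))` meets
the graph of `a` at `f^R(x₃)`. -/
def IsCutoff (ρ η a b : ℝ → ℝ) (β : EReal) (e x₃ : ℝ) : Prop :=
  x₀ ρ η β e < x₃ ∧ x₃ < e ∧ a (fR ρ η β x₃) = chord ρ η a b β x₃ (fR ρ η β x₃)

open Classical in
/-- The candidate `ψ` built from `x₃`: `b` in the tails, `a` in the centre, chords in between. -/
noncomputable def psi3 (ρ η a b : ℝ → ℝ) (β : EReal) (x₃ x : ℝ) : ℝ :=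
  if gR ρ η β x₃ < |x| then b x
  else if |x| < fR ρ η β x₃ then a x
  else if x < 0 then chord ρ η a b β x₃ (-x)
  else chord ρ η a b β x₃ x

open Classical in
/-- The candidate `ψ` when `a(e) = b(e)`. -/
noncomputable def psi3' (a b : ℝ → ℝ) (e x : ℝ) : ℝ :=
  if e < |x| then b x else a x

/-- The point `x₄ ∈ (g^R(x₃), β)` with `(μ - ν)((0, f^R(x₃))) = (ν - μ)((x₄, ∞))`. -/
noncomputable def x₄ (ρ η : ℝ → ℝ) (β : EReal) (x₃ : ℝ) : ℝ :=
  Classical.epsilon fun x => gR ρ η β x₃ < x ∧ (x : EReal) < β ∧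
    ∫ z in (0 : ℝ)..(fR ρ η β x₃), (ρ z - η z) = ∫ z in Ioi x, (η z - ρ z)

/-! ### Candidate models -/

/-- Density of `μ` restricted to `(-x₃, g^L(-x₃)) ∪ (f^R(x₃), x₃)`. -/
noncomputable def chi3 (ρ η : ℝ → ℝ) (β : EReal) (x₃ : ℝ) : ℝ → ℝ :=
  (Ioo (-x₃) (gL ρ η β (-x₃)) ∪ Ioo (fR ρ η β x₃) x₃).indicator ρ

/-- Density of `ν - μ` restricted to `(-x₄, f^L(-x₃)) ∪ (g^R(x₃), x₄)`. -/
noncomputable def xi3 (ρ η : ℝ → ℝ) (β : EReal) (x₃ : ℝ) : ℝ → ℝ :=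
  (Ioo (-x₄ ρ η β x₃) (fL ρ η β (-x₃)) ∪ Ioo (gR ρ η β x₃) (x₄ ρ η β x₃)).indicator
    fun z => η z - ρ z

/-- Density of `μ - ν` restricted to `(g^L(-x₃), f^R(x₃))`. -/
noncomputable def chi4 (ρ η : ℝ → ℝ) (β : EReal) (x₃ : ℝ) : ℝ → ℝ :=
  (Ioo (gL ρ η β (-x₃)) (fR ρ η β x₃)).indicator fun z => ρ z - η z

/-- Density of `ν - μ` restricted to `(-β, -y) ∪ (y, β)`. -/
noncomputable def tailDensity (ρ η : ℝ → ℝ) (β : EReal) (y : ℝ) : ℝ → ℝ :=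
  {z : ℝ | y < |z| ∧ ((|z| : ℝ) : EReal) < β}.indicator fun z => η z - ρ z

open Classical in
/-- Conditional law of `Y` given `U = u`, `X = x` in the candidate model built from `x₃`. (The two
points `g^L(-x₃)` and `f^R(x₃)`, which carry no mass, are put into the last case.) -/
noncomputable def kernel3 (ρ η : ℝ → ℝ) (β : EReal) (e x₃ u x : ℝ) : Measure ℝ :=
  if x ≤ -x₃ then leftKernel ρ η β e x
  else if x₃ ≤ x then rightKernel ρ η β e x
  else if x ∈ Ioo (gL ρ η β (-x₃)) (fR ρ η β x₃) then
    if u ≤ η x / ρ x then Measure.dirac x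
    else hkKernel (chi4 ρ η β x₃) (tailDensity ρ η β (x₄ ρ η β x₃)) (fR ρ η β x₃) x
  else hkKernel (chi3 ρ η β x₃) (xi3 ρ η β x₃) x₃ x

open Classical in
/-- Conditional law of `Y` given `U = u`, `X = x` in the candidate model when `a(e) = b(e)`. -/
noncomputable def kernel3' (ρ η : ℝ → ℝ) (β : EReal) (e u x : ℝ) : Measure ℝ :=
  if |x| < e ∧ η x / ρ x < u then
    hkKernel ((Ioo (-e) e).indicator fun z => ρ z - η z) (tailDensity ρ η β e) e x
  else Measure.dirac x

/-- The law of `(U, X, Y)` when `U` is uniform on `[0, 1]`, `X ∼ μ` is independent of `U`, and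
`Y` has conditional law `κ u x` given `U = u`, `X = x`. -/
noncomputable def jointLaw (μ : Measure ℝ) (κ : ℝ → ℝ → Measure ℝ) : Measure (ℝ × ℝ × ℝ) :=
  (((volume : Measure ℝ).restrict (Icc 0 1)).prod μ).bind fun w =>
    (κ w.1 w.2).map fun y => (w.1, w.2, y)

/-- The filtration on the space of triples `(u, x, y)`: trivial at time 0, generated by `(u, x)` at
time 1, and everything at time 2. -/
def tripleFiltration : Filtration (Fin 3) (inferInstance : MeasurableSpace (ℝ × ℝ × ℝ)) where
  seq i := if i = 0 then ⊥ else if i = 1 then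
    MeasurableSpace.comap (fun w : ℝ × ℝ × ℝ => (w.1, w.2.1)) inferInstance else inferInstance
  mono' := by
    have h : MeasurableSpace.comap (fun w : ℝ × ℝ × ℝ => (w.1, w.2.1)) inferInstance
        ≤ (inferInstance : MeasurableSpace (ℝ × ℝ × ℝ)) :=
      Measurable.comap_le (by fun_prop)
    intro i j hij
    fin_cases i <;> fin_cases j <;> simp_all
  le' := by
    have h : MeasurableSpace.comap (fun w : ℝ × ℝ × ℝ => (w.1, w.2.1)) inferInstance
        ≤ (inferInstance : MeasurableSpace (ℝ × ℝ × ℝ)) :=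
      Measurable.comap_le (by fun_prop)
    intro i
    fin_cases i <;> simp_all

/-- The price process on the space of triples `(u, x, y)`: `Z₀ = 0` (the common mean),
`Z₁ = x`, `Z₂ = y`. -/
def tripleProcess (i : Fin 3) (w : ℝ × ℝ × ℝ) : ℝ :=
  if i = 0 then 0 else if i = 1 then w.2.1 else w.2.2

open Classical in
/-- The exercise rule: stop at time 1 iff `X ∉ (-x₃, x₃)`, or `X ∈ (g^L(-x₃), f^R(x₃))` and
`U < η(X) / ρ(X)`. -/
noncomputable def tau3 (ρ η : ℝ → ℝ) (β : EReal) (x₃ : ℝ) (w : ℝ × ℝ × ℝ) : WithTop (Fin 3) :=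
  if w.2.1 ∉ Ioo (-x₃) x₃ ∨
      (w.2.1 ∈ Ioo (gL ρ η β (-x₃)) (fR ρ η β x₃) ∧ w.1 < η w.2.1 / ρ w.2.1) then
    ((1 : Fin 3) : WithTop (Fin 3))
  else ((2 : Fin 3) : WithTop (Fin 3))

open Classical in
/-- The exercise rule when `a(e) = b(e)`: stop at time 1 iff `|X| > e`, or `|X| < e` and
`U ≤ η(X) / ρ(X)`. -/
noncomputable def tau3' (ρ η : ℝ → ℝ) (e : ℝ) (w : ℝ × ℝ × ℝ) : WithTop (Fin 3) :=
  if e < |w.2.1| ∨ (|w.2.1| < e ∧ w.1 ≤ η w.2.1 / ρ w.2.1) then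
    ((1 : Fin 3) : WithTop (Fin 3))
  else ((2 : Fin 3) : WithTop (Fin 3))

/-- The measure `P` on triples is a model consistent with `μ`, `ν`, `τ` is an exercise rule in it,
`ψ` generates a superhedge, and: the price of `(P, τ)` equals the cost of that superhedge; `(P, τ)`
gives the highest model-based price; `ψ` generates the cheapest superhedge; there is no duality
gap. -/
structure OptimalWithoutGap (μ ν : Measure ℝ) (a b ψ : ℝ → ℝ) (P : Measure (ℝ × ℝ × ℝ))
    (τ : ℝ × ℝ × ℝ → WithTop (Fin 3)) : Prop where
  isModel : IsModel μ ν P tripleFiltration tripleProcess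
  isExerciseRule : IsExerciseRule tripleFiltration τ
  convex : ConvexOn ℝ univ ψ
  dominates : ∀ x, b x ≤ ψ x
  isSuperhedge : IsSuperhedge a b (generatedPhi a ψ) ψ (generatedTheta ψ) 0
  price_eq_cost : (price a b P tripleProcess τ : EReal) = hedgingCost μ ν (generatedPhi a ψ) ψ
  highest_price : ∀ (Ω : Type u) (mΩ : MeasurableSpace Ω) (P' : Measure Ω)
    (ℱ : Filtration (Fin 3) mΩ) (Z : Fin 3 → Ω → ℝ) (τ' : Ω → WithTop (Fin 3)),
    IsModel μ ν P' ℱ Z → IsExerciseRule ℱ τ' → price a b P' Z τ' ≤ price a b P tripleProcess τ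
  price_eq_primal : price a b P tripleProcess τ = primalValue μ ν a b
  cheapest : ∀ φ ψ' θ₁ θ₂ : ℝ → ℝ, IsSuperhedge a b φ ψ' θ₁ θ₂ →
    hedgingCost μ ν (generatedPhi a ψ) ψ ≤ hedgingCost μ ν φ ψ'
  cost_eq_dual : hedgingCost μ ν (generatedPhi a ψ) ψ = dualValue μ ν a b
  no_gap : (primalValue μ ν a b : EReal) = dualValue μ ν a b

end Bermudan

namespace Bermudan

/-! ### Convex functions on the line and their right derivatives -/

/-! The proof rests on weak duality. In any model, use the first hedging inequality where `τ = 1`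
and the second where `τ = 2`. The trading gain is a time-1 measurable position times `Z₂ - Z₁`, so
it has mean zero once integrability is dealt with, and the price is at most the cost
(`price_le_hedgingCost`). A single model whose price equals the cost of a single superhedge
therefore settles all the optimality claims and the absence of a gap. For the superhedge generated
by `ψ`, equality follows from complementary slackness (`optimalWithoutGap_of_slackness`): where the
rule stops, `ψ ≤ a` and the kernel started at `x` integrates `ψ` to `ψ x`; where it continues, `a ≤
ψ` and the kernel charges only points at which `ψ = b`.

Write `f`, `g` for the values of `fR`, `gR` at the cutoff `x₃`. As a function of `|x|`, `ψ` is `a`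
below `f`, a line from `f` to `g`, and `b` beyond `g`. The line meets `a` at `f` and `x₃` and meets
`b` at `g`, so convexity decides every sign: `a` is below the line on `[f, x₃]` and above it
elsewhere. The model is built around this picture. For `x₃ < |x| < e` the curtain kernel moves
within one linear piece of `ψ`, because `fR` increases and `gR` decreases. For `f < |x| < x₃` a
Hobson-Klimmek kernel sends the mass to `g < |y| < x₄`, where `ψ = b`. For `|x| < f` the proportion
`η / ρ` stays and is exercised where `ψ = a`, and the remainder is sent beyond `x₄`. For `|x| ≥ e`
nothing moves. The images of these pieces add up to `ν` (`lintegral_kernel3`).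

The endpoints of the kernels are defined only by equations of mass and first moment. These are
studied by one principle: two non-zero positive measures with equal mass and first moment cannot lie
on opposite sides of a point. It gives the signs needed for existence by the intermediate value
theorem, and it gives uniqueness and monotonicity. That a kernel then has the right image is
`lintegral_twoPoint_of_inverse`: pull the target back along the two branches. The equations, read on
initial segments, say that the two pullbacks add up to the source in mass and in barycentre. Their
densities are thus two weights with sum one and the right mean, and these can only be the martingale
weights.

A cutoff exists because the chord at `x`, evaluated at `fR x`, is below `a` at `x₀` by hypothesis
and above it near `e`, where `a(e) > b(e)` makes the chord decrease steeply (`exists_isCutoff`). If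
`a(e) = b(e)`, the curtain and the ring disappear, and the central mixture on `(-e, e)` does the
whole work. -/

theorem rightDeriv_support {f : ℝ → ℝ} (hf : ConvexOn ℝ univ f) (x y : ℝ) :
    f x + derivWithin f (Ioi x) x * (y - x) ≤ f y := by
  have hx : x ∈ interior (univ : Set ℝ) := by simp
  rcases lt_trichotomy x y with h | h | h
  · have := hf.rightDeriv_le_slope_of_mem_interior hx (mem_univ y) h
    rw [slope_def_field, le_div_iff₀ (sub_pos.2 h)] at this
    linarith
  · simp [h]
  · have h1 := hf.leftDeriv_le_rightDeriv_of_mem_interior hx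
    have h2 := hf.slope_le_leftDeriv_of_mem_interior (mem_univ y) hx h
    have h3 := h2.trans h1
    rw [slope_def_field, div_le_iff₀ (sub_pos.2 h)] at h3
    linarith

theorem measurable_rightDeriv {f : ℝ → ℝ} (hf : ConvexOn ℝ univ f) :
    Measurable fun x => derivWithin f (Ioi x) x := by
  have h := hf.monotoneOn_rightDeriv
  rw [interior_univ, monotoneOn_univ] at h
  exact h.measurable

theorem convexOn_univ_continuous {f : ℝ → ℝ} (hf : ConvexOn ℝ univ f) : Continuous f :=
  continuousOn_univ.1 (hf.continuousOn isOpen_univ)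

theorem convexOn_iSup_affine {u v : ℝ → ℝ}
    (h : ∀ y, BddAbove (range fun x => u x + v x * y)) :
    ConvexOn ℝ univ fun y => ⨆ x, (u x + v x * y) := by
  refine ⟨convex_univ, fun y _ z _ s t hs ht hst => ciSup_le fun x => ?_⟩
  have h1 := le_ciSup (h y) x
  have h2 := le_ciSup (h z) x
  simp only [smul_eq_mul]
  calc u x + v x * (s * y + t * z) = s * (u x + v x * y) + t * (u x + v x * z) := by
        linear_combination (-u x) * hst
    _ ≤ _ := by gcongr

/-- A pointwise family of affine minorants, chosen without any regularity, may be replaced by a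
measurable one. -/
theorem exists_measurable_slope {c ψ θ : ℝ → ℝ} (h : ∀ x y, c x ≤ ψ y + θ x * (y - x)) :
    ∃ θ' : ℝ → ℝ, Measurable θ' ∧ ∀ x y, c x ≤ ψ y + θ' x * (y - x) := by
  have hb : ∀ y, BddAbove (range fun x => (c x + θ x * x) + (-θ x) * y) := by
    intro y
    refine ⟨ψ y, ?_⟩
    rintro _ ⟨x, rfl⟩
    have := h x y
    simp only
    linarith
  -- The upper envelope of all the lines `y ↦ c x - θ x * (y - x)` is convex, lies below `ψ`, and is
  -- at least `c x` at `x`. Its tangents can replace the given lines, and their slopes are monotone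
  -- in `x`, hence measurable.
  have hc := convexOn_iSup_affine hb
  refine ⟨fun x => -derivWithin _ (Ioi x) x, (measurable_rightDeriv hc).neg, fun x y => ?_⟩
  have h1 := rightDeriv_support hc x y
  have h2 := le_ciSup (hb x) x
  have h3 : ⨆ x, ((c x + θ x * x) + (-θ x) * y) ≤ ψ y := ciSup_le fun x => by
    have := h x y
    linarith
  simp only at h1 h2 ⊢
  linarith

theorem IsSuperhedge.exists_measurable {a b φ ψ θ₁ θ₂ : ℝ → ℝ}
    (h : IsSuperhedge a b φ ψ θ₁ θ₂) :
    ∃ θ₁' θ₂' : ℝ → ℝ, Measurable θ₁' ∧ Measurable θ₂' ∧ IsSuperhedge a b φ ψ θ₁' θ₂' := by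
  obtain ⟨t₁, hm₁, h₁⟩ := exists_measurable_slope (c := fun x => a x - φ x) (ψ := ψ) (θ := θ₁)
    fun x y => by have := h.ineq_one x y; linarith
  obtain ⟨t₂, hm₂, h₂⟩ := exists_measurable_slope (c := fun x => -φ x) (ψ := fun y => ψ y - b y)
    (θ := θ₂) fun x y => by have := h.ineq_two x y; linarith
  exact ⟨t₁, t₂, hm₁, hm₂, h.measurable_phi, h.measurable_psi,
    fun x y => by linarith [h₁ x y], fun x y => by linarith [h₂ x y]⟩

/-! ### Weak duality -/

theorem extIntegral_of_nonneg (m : Measure ℝ) {f : ℝ → ℝ} (hf : ∀ x, 0 ≤ f x) :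
    extIntegral m f = ((∫⁻ x, ENNReal.ofReal (f x) ∂m : ENNReal) : EReal) := by
  have h : ∀ x, ENNReal.ofReal (-f x) = 0 := fun x =>
    ENNReal.ofReal_of_nonpos (neg_nonpos.2 (hf x))
  unfold extIntegral
  split_ifs with ht
  · rw [ht]; rfl
  · simp [h]

theorem hedgingCost_of_nonneg (μ ν : Measure ℝ) {φ ψ : ℝ → ℝ} (hφ : ∀ x, 0 ≤ φ x)
    (hψ : ∀ x, 0 ≤ ψ x) :
    hedgingCost μ ν φ ψ = ((∫⁻ x, ENNReal.ofReal (φ x) ∂μ + ∫⁻ x, ENNReal.ofReal (ψ x) ∂ν :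
      ENNReal) : EReal) := by
  unfold hedgingCost
  rw [extIntegral_of_nonneg μ hφ, extIntegral_of_nonneg ν hψ]
  split_ifs with h
  · rcases h with h | h
    · rw [EReal.coe_ennreal_eq_top_iff] at h; simp [h]
    · rw [EReal.coe_ennreal_eq_top_iff] at h; simp [h]
  · rw [EReal.coe_ennreal_add]

theorem IsExerciseRule.measurableSet_one {Ω : Type u} {mΩ : MeasurableSpace Ω}
    {ℱ : Filtration (Fin 3) mΩ} {τ : Ω → WithTop (Fin 3)} (h : IsExerciseRule ℱ τ) :
    MeasurableSet[ℱ 1] {ω | τ ω = ((1 : Fin 3) : WithTop (Fin 3))} := by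
  convert h.isStoppingTime 1 using 1
  ext ω
  rcases h.mem ω with h | h <;> simp [h]

/-- Negative parts stand on the left so that nothing is subtracted in `ENNReal` and no integrability
of `φ` or `ψ` is needed. The trading gain may fail to be integrable, so the estimate is made on the
time-1 events where the position is at most `n` in absolute value, and these events exhaust the
space. -/
theorem price_add_le {a b φ ψ θ₁ θ₂ : ℝ → ℝ} {μ ν : Measure ℝ} {Ω : Type u}
    {mΩ : MeasurableSpace Ω} {P : Measure Ω} {ℱ : Filtration (Fin 3) mΩ} {Z : Fin 3 → Ω → ℝ}
    {τ : Ω → WithTop (Fin 3)} (hM : IsModel μ ν P ℱ Z) (hτ : IsExerciseRule ℱ τ)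
    (ha : ∀ x, 0 ≤ a x) (hb : ∀ x, 0 ≤ b x)
    (hs : IsSuperhedge a b φ ψ θ₁ θ₂) (hθ₁ : Measurable θ₁) (hθ₂ : Measurable θ₂) :
    price a b P Z τ + (∫⁻ x, ENNReal.ofReal (-φ x) ∂μ + ∫⁻ y, ENNReal.ofReal (-ψ y) ∂ν) ≤
      ∫⁻ x, ENNReal.ofReal (φ x) ∂μ + ∫⁻ y, ENNReal.ofReal (ψ y) ∂ν := by
  classical
  have := hM.isProbabilityMeasure
  have hφ := hs.measurable_phi
  have hψ := hs.measurable_psi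
  have hZ1 : StronglyMeasurable[ℱ 1] (Z 1) := hM.martingale.1 1
  have m1 : Measurable (Z 1) := (hZ1.mono (ℱ.le 1)).measurable
  have m2 : Measurable (Z 2) := ((hM.martingale.1 2).mono (ℱ.le 2)).measurable
  have hτ1 := hτ.measurableSet_one
  rw [← hM.law_one, ← hM.law_two, lintegral_map (by fun_prop) m1, lintegral_map (by fun_prop) m2,
    lintegral_map (by fun_prop) m1, lintegral_map (by fun_prop) m2,
    ← lintegral_add_left (by fun_prop), ← lintegral_add_left (by fun_prop)]
  unfold price
  rw [← lintegral_add_right _ (by fun_prop)]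
  set Θ : Ω → ℝ := fun ω => if τ ω = ((1 : Fin 3) : WithTop (Fin 3)) then θ₁ (Z 1 ω)
    else θ₂ (Z 1 ω) with hΘ
  have hΘm : Measurable[ℱ 1] Θ :=
    Measurable.ite hτ1 (hθ₁.comp hZ1.measurable) (hθ₂.comp hZ1.measurable)
  set A : ℕ → Set Ω := fun n => {ω | |Θ ω| ≤ n} with hA
  have hAm : ∀ n, MeasurableSet[ℱ 1] (A n) := fun n =>
    (continuous_abs.measurable.comp hΘm) measurableSet_Iic
  have hAU : ⋃ n, A n = univ := by
    refine eq_univ_of_forall fun ω => mem_iUnion.2 ?_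
    obtain ⟨n, hn⟩ := exists_nat_ge |Θ ω|
    exact ⟨n, hn⟩
  have hAmono : Monotone A := by
    intro i j hij ω hω
    have : (i : ℝ) ≤ j := by exact_mod_cast hij
    exact le_trans (show |Θ ω| ≤ i from hω) this
  conv_lhs => rw [← Measure.restrict_univ (μ := P), ← hAU]
  rw [setLIntegral_iUnion_of_directed _ (hAmono.directed_le)]
  refine iSup_le fun n => ?_
  set T : Ω → ℝ := fun ω => (A n).indicator Θ ω * (Z 2 ω - Z 1 ω) with hT
  have hgm : StronglyMeasurable[ℱ 1] ((A n).indicator Θ) :=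
    (hΘm.indicator (hAm n)).stronglyMeasurable
  have hint : Integrable (fun ω => Z 2 ω - Z 1 ω) P :=
    (hM.martingale.integrable 2).sub (hM.martingale.integrable 1)
  have hTint : Integrable T P := by
    refine hint.bdd_mul (c := n) (hgm.mono (ℱ.le 1)).aestronglyMeasurable ?_
    refine Filter.Eventually.of_forall fun ω => ?_
    by_cases hω : ω ∈ A n
    · rw [indicator_of_mem hω]; exact hω
    · simp [indicator_of_notMem hω]
  have hT0 : ∫ ω, T ω ∂P = 0 := by
    rw [← integral_condExp (ℱ.le 1)]
    have h1 : P[T|ℱ 1] =ᵐ[P] (A n).indicator Θ * P[fun ω => Z 2 ω - Z 1 ω|ℱ 1] :=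
      condExp_mul_of_stronglyMeasurable_left hgm hTint hint
    have h2 : P[fun ω => Z 2 ω - Z 1 ω|ℱ 1] =ᵐ[P] P[Z 2|ℱ 1] - P[Z 1|ℱ 1] :=
      condExp_sub (hM.martingale.integrable 2) (hM.martingale.integrable 1) _
    have h3 := hM.martingale.2 1 2 (by decide)
    have h4 := hM.martingale.2 1 1 le_rfl
    rw [integral_congr_ae (g := fun _ => (0 : ℝ)), integral_zero]
    filter_upwards [h1, h2, h3, h4] with ω e1 e2 e3 e4
    simp [e1, e2, e3, e4]
  have hTpn : ∫⁻ ω, ENNReal.ofReal (T ω) ∂P = ∫⁻ ω, ENNReal.ofReal (-T ω) ∂P := by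
    have h1 := integral_eq_lintegral_pos_part_sub_lintegral_neg_part hTint
    rw [hT0] at h1
    have f1 : ∫⁻ ω, ENNReal.ofReal (T ω) ∂P ≠ ⊤ := hTint.lintegral_lt_top.ne
    have f2 : ∫⁻ ω, ENNReal.ofReal (-T ω) ∂P ≠ ⊤ := hTint.neg.lintegral_lt_top.ne
    exact (ENNReal.toReal_eq_toReal_iff' f1 f2).1 (by linarith)
  have hTtop : ∫⁻ ω, ENNReal.ofReal (-T ω) ∂P ≠ ⊤ := hTint.neg.lintegral_lt_top.ne
  have hTm : Measurable T := (hgm.mono (ℱ.le 1)).measurable.mul (m2.sub m1)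
  have hAm' : MeasurableSet (A n) := ℱ.le 1 _ (hAm n)
  rw [← lintegral_indicator hAm']
  -- The positive and negative parts of the truncated gain `T` have the same finite integral. Adding
  -- one to each side reduces the claim to a pointwise inequality.
  refine (ENNReal.add_le_add_iff_right hTtop).1 ?_
  conv_rhs => rw [← hTpn]
  rw [← lintegral_add_right _ (by fun_prop), ← lintegral_add_right _ (by fun_prop)]
  refine lintegral_mono fun ω => ?_
  by_cases hω : ω ∈ A n
  · have hTω : T ω = Θ ω * (Z 2 ω - Z 1 ω) := by simp only [hT, indicator_of_mem hω]
    have key : ∀ g : ℝ, 0 ≤ g → g ≤ φ (Z 1 ω) + ψ (Z 2 ω) + T ω →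
        ENNReal.ofReal g + (ENNReal.ofReal (-φ (Z 1 ω)) + ENNReal.ofReal (-ψ (Z 2 ω)))
          + ENNReal.ofReal (-T ω) ≤
        ENNReal.ofReal (φ (Z 1 ω)) + ENNReal.ofReal (ψ (Z 2 ω)) + ENNReal.ofReal (T ω) := by
      intro g hg hle
      have e0 : ∀ r : ℝ, ENNReal.ofReal r = ENNReal.ofReal (max r 0) := fun r => by
        rcases le_total r 0 with h | h
        · rw [max_eq_right h, ENNReal.ofReal_of_nonpos h, ENNReal.ofReal_zero]
        · rw [max_eq_left h]
      rw [e0 (-φ _), e0 (-ψ _), e0 (-T ω), e0 (φ _), e0 (ψ _), e0 (T ω)]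
      rw [← ENNReal.ofReal_add (by positivity) (by positivity),
        ← ENNReal.ofReal_add (by positivity) (by positivity),
        ← ENNReal.ofReal_add (by positivity) (by positivity),
        ← ENNReal.ofReal_add (by positivity) (by positivity),
        ← ENNReal.ofReal_add (by positivity) (by positivity)]
      refine ENNReal.ofReal_le_ofReal ?_
      have e : ∀ r : ℝ, max r 0 = r + max (-r) 0 := fun r => by
        rcases le_total r 0 with h | h
        · rw [max_eq_right h, max_eq_left (by linarith)]; ring
        · rw [max_eq_left h, max_eq_right (by linarith)]; ring
      rw [e (φ _), e (ψ _), e (T _)]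
      linarith
    rw [indicator_of_mem hω]
    by_cases h1 : τ ω = ((1 : Fin 3) : WithTop (Fin 3))
    · rw [if_pos h1]
      refine key _ (ha _) ?_
      rw [hTω, hΘ]
      simp only [if_pos h1]
      exact hs.ineq_one _ _
    · rw [if_neg h1]
      refine key _ (hb _) ?_
      rw [hTω, hΘ]
      simp only [if_neg h1]
      exact hs.ineq_two _ _
  · have hTω : T ω = 0 := by simp [hT, indicator_of_notMem hω]
    rw [indicator_of_notMem hω, hTω]
    simp

/-- If a positive part has infinite integral, the cost is `⊤` by convention. Otherwise the preceding
estimate forces every term to be finite and can be read in `ℝ`. -/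
theorem price_le_hedgingCost {a b φ ψ θ₁ θ₂ : ℝ → ℝ} {μ ν : Measure ℝ} {Ω : Type u}
    {mΩ : MeasurableSpace Ω} {P : Measure Ω} {ℱ : Filtration (Fin 3) mΩ} {Z : Fin 3 → Ω → ℝ}
    {τ : Ω → WithTop (Fin 3)} (hM : IsModel μ ν P ℱ Z) (hτ : IsExerciseRule ℱ τ)
    (ha : ∀ x, 0 ≤ a x) (hb : ∀ x, 0 ≤ b x)
    (hs : IsSuperhedge a b φ ψ θ₁ θ₂) :
    (price a b P Z τ : EReal) ≤ hedgingCost μ ν φ ψ := by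
  obtain ⟨t₁, t₂, h1, h2, hs'⟩ := hs.exists_measurable
  have key := price_add_le hM hτ ha hb hs' h1 h2
  unfold hedgingCost
  split_ifs with h
  · exact le_top
  · unfold extIntegral at h ⊢
    by_cases p1 : ∫⁻ x, ENNReal.ofReal (φ x) ∂μ = ⊤
    · simp [p1] at h
    by_cases p2 : ∫⁻ x, ENNReal.ofReal (ψ x) ∂ν = ⊤
    · simp [p2] at h
    rw [if_neg p1, if_neg p2]
    generalize price a b P Z τ = p at *
    generalize ∫⁻ x, ENNReal.ofReal (φ x) ∂μ = A at *
    generalize ∫⁻ x, ENNReal.ofReal (ψ x) ∂ν = B at *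
    generalize ∫⁻ x, ENNReal.ofReal (-φ x) ∂μ = C at *
    generalize ∫⁻ x, ENNReal.ofReal (-ψ x) ∂ν = D at *
    have ht : p + (C + D) ≠ ⊤ := ne_top_of_le_ne_top (ENNReal.add_ne_top.2 ⟨p1, p2⟩) key
    simp only [ENNReal.add_ne_top] at ht
    obtain ⟨hp, hC, hD⟩ := ht
    lift p to NNReal using hp
    lift A to NNReal using p1
    lift B to NNReal using p2
    lift C to NNReal using hC
    lift D to NNReal using hD
    have key' : (p : ℝ) + (C + D) ≤ A + B := by exact_mod_cast key
    have e : ∀ r : NNReal, (((r : ENNReal) : EReal)) = ((r : ℝ) : EReal) := fun r => rfl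
    simp only [e]
    norm_cast
    linarith

theorem generated_isSuperhedge {a b ψ : ℝ → ℝ} (ha : ConvexOn ℝ univ a)
    (hψ : ConvexOn ℝ univ ψ) (hb : ∀ x, b x ≤ ψ x) :
    IsSuperhedge a b (generatedPhi a ψ) ψ (generatedTheta ψ) 0 where
  measurable_phi := by
    have h1 := (convexOn_univ_continuous ha).measurable
    have h2 := (convexOn_univ_continuous hψ).measurable
    unfold generatedPhi
    fun_prop
  measurable_psi := (convexOn_univ_continuous hψ).measurable
  ineq_one x y := by
    have h1 := rightDeriv_support hψ x y
    have h2 : a x - ψ x ≤ generatedPhi a ψ x := le_max_left _ _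
    unfold generatedTheta
    linarith
  ineq_two x y := by
    have h2 : 0 ≤ generatedPhi a ψ x := le_max_right _ _
    have := hb y
    simp only [Pi.zero_apply, zero_mul, add_zero]
    linarith

/-- A model, an exercise rule and a convex `ψ ≥ b` whose price and cost agree are all optimal. -/
theorem optimalWithoutGap_of_price_eq {μ ν : Measure ℝ} {a b ψ : ℝ → ℝ}
    {P : Measure (ℝ × ℝ × ℝ)} {τ : ℝ × ℝ × ℝ → WithTop (Fin 3)}
    (hb0 : ∀ x, 0 ≤ b x) (hba : ∀ x, b x ≤ a x) (ha : ConvexOn ℝ univ a)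
    (hM : IsModel μ ν P tripleFiltration tripleProcess)
    (hτ : IsExerciseRule tripleFiltration τ) (hψ : ConvexOn ℝ univ ψ) (hb : ∀ x, b x ≤ ψ x)
    (hprice : price a b P tripleProcess τ =
      ∫⁻ x, ENNReal.ofReal (generatedPhi a ψ x) ∂μ + ∫⁻ x, ENNReal.ofReal (ψ x) ∂ν) :
    OptimalWithoutGap.{u} μ ν a b ψ P τ := by
  have ha0 : ∀ x, 0 ≤ a x := fun x => (hb0 x).trans (hba x)
  have hs := generated_isSuperhedge ha hψ hb
  have hcost : (price a b P tripleProcess τ : EReal) =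
      hedgingCost μ ν (generatedPhi a ψ) ψ := by
    rw [hedgingCost_of_nonneg μ ν (φ := generatedPhi a ψ) (fun x => le_max_right _ _) (fun x => (hb0 x).trans (hb x)),
      hprice]
  have hprimal : price a b P tripleProcess τ = primalValue μ ν a b := by
    refine le_antisymm (le_sSup ⟨_, _, P, _, _, τ, hM, hτ, rfl⟩) (sSup_le ?_)
    rintro v ⟨Ω, mΩ, P', ℱ, Z, τ', hM', hτ', rfl⟩
    have := price_le_hedgingCost hM' hτ' ha0 hb0 hs
    rw [← hcost] at this
    exact_mod_cast this
  have hcheap : ∀ φ ψ' θ₁ θ₂ : ℝ → ℝ, IsSuperhedge a b φ ψ' θ₁ θ₂ →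
      hedgingCost μ ν (generatedPhi a ψ) ψ ≤ hedgingCost μ ν φ ψ' := by
    intro φ ψ' θ₁ θ₂ h
    rw [← hcost]
    exact price_le_hedgingCost hM hτ ha0 hb0 h
  have hdual : hedgingCost μ ν (generatedPhi a ψ) ψ = dualValue μ ν a b := by
    refine le_antisymm (le_sInf ?_) (sInf_le ⟨_, _, _, _, hs, rfl⟩)
    rintro c ⟨φ, ψ', θ₁, θ₂, h, rfl⟩
    exact hcheap _ _ _ _ h
  refine ⟨hM, hτ, hψ, hb, hs, hcost, ?_, hprimal, hcheap, hdual, ?_⟩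
  · intro Ω mΩ P' ℱ Z τ' hM' hτ'
    have := price_le_hedgingCost hM' hτ' ha0 hb0 hs
    rw [← hcost] at this
    exact_mod_cast this
  · rw [← hprimal, hcost, hdual]

/-! ### Gluing convex functions -/

theorem convexOn_three_points {h : ℝ → ℝ} (hh : ConvexOn ℝ univ h) {p q t : ℝ} (hpq : p < q)
    (hqt : q < t) : h q * (t - p) ≤ h p * (t - q) + h t * (q - p) := by
  have h1 := hh.slope_mono_adjacent (mem_univ p) (mem_univ t) hpq hqt
  rw [div_le_div_iff₀ (by linarith) (by linarith)] at h1
  nlinarith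

/-- Lines are written `A + s * (· - c)`, the form in which `chord` is given. This lemma and the next
two compare a convex function with such a line inside and outside a segment, from comparisons at its
two endpoints. -/
theorem convexOn_le_line {h : ℝ → ℝ} (hh : ConvexOn ℝ univ h) {A s c p q t : ℝ}
    (hp : h p ≤ A + s * (p - c)) (hq : h q ≤ A + s * (q - c)) (hpt : p ≤ t) (htq : t ≤ q) :
    h t ≤ A + s * (t - c) := by
  rcases hpt.eq_or_lt with rfl | hpt
  · exact hp
  rcases htq.eq_or_lt with rfl | htq
  · exact hq
  have h1 := convexOn_three_points hh hpt htq
  have h2 : h t * (q - p) ≤ (A + s * (t - c)) * (q - p) := by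
    have e1 := mul_le_mul_of_nonneg_right hp (sub_nonneg.2 htq.le)
    have e2 := mul_le_mul_of_nonneg_right hq (sub_nonneg.2 hpt.le)
    linarith
  exact le_of_mul_le_mul_right h2 (by linarith)

theorem line_le_convexOn_right {h : ℝ → ℝ} (hh : ConvexOn ℝ univ h) {A s c p q t : ℝ}
    (hp : h p ≤ A + s * (p - c)) (hq : A + s * (q - c) ≤ h q) (hpq : p < q) (hqt : q ≤ t) :
    A + s * (t - c) ≤ h t := by
  rcases hqt.eq_or_lt with rfl | hqt
  · exact hq
  have h1 := convexOn_three_points hh hpq hqt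
  have h2 : (A + s * (t - c)) * (q - p) ≤ h t * (q - p) := by
    have e1 := mul_le_mul_of_nonneg_right hp (sub_nonneg.2 hqt.le)
    have e2 := mul_le_mul_of_nonneg_right hq (sub_nonneg.2 (hpq.trans hqt).le)
    linarith
  exact le_of_mul_le_mul_right h2 (by linarith)

theorem line_le_convexOn_left {h : ℝ → ℝ} (hh : ConvexOn ℝ univ h) {A s c p q t : ℝ}
    (hp : A + s * (p - c) ≤ h p) (hq : h q ≤ A + s * (q - c)) (hpq : p < q) (htp : t ≤ p) :
    A + s * (t - c) ≤ h t := by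
  rcases htp.eq_or_lt with rfl | htp
  · exact hp
  have h1 := convexOn_three_points hh htp hpq
  have h2 : (A + s * (t - c)) * (q - p) ≤ h t * (q - p) := by
    have e1 := mul_le_mul_of_nonneg_right hq (sub_nonneg.2 htp.le)
    have e2 := mul_le_mul_of_nonneg_right hp (sub_nonneg.2 (htp.trans hpq).le)
    linarith
  exact le_of_mul_le_mul_right h2 (by linarith)

theorem convexOn_of_support {f : ℝ → ℝ} (h : ∀ x, ∃ s : ℝ, ∀ y, f x + s * (y - x) ≤ f y) :
    ConvexOn ℝ univ f := by
  refine ⟨convex_univ, fun x _ y _ p q hp hq hpq => ?_⟩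
  obtain ⟨s, hs⟩ := h (p • x + q • y)
  have h1 := mul_le_mul_of_nonneg_left (hs x) hp
  have h2 := mul_le_mul_of_nonneg_left (hs y) hq
  simp only [smul_eq_mul] at *
  have e : f (p * x + q * y) = (p + q) * f (p * x + q * y) := by rw [hpq, one_mul]
  have e2 : p * (s * (x - (p * x + q * y))) + q * (s * (y - (p * x + q * y))) = 0 := by
    have : q = 1 - p := by linarith
    subst this; ring
  rw [e]
  linarith

/-- Two convex functions that agree at `c` and are supported there by a common line may be
concatenated. -/
theorem convexOn_glue {f h : ℝ → ℝ} (hf : ConvexOn ℝ univ f) (hh : ConvexOn ℝ univ h) {c s : ℝ}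
    (hc : f c = h c) (hfs : ∀ y ≤ c, f c + s * (y - c) ≤ f y)
    (hhs : ∀ y, c ≤ y → h c + s * (y - c) ≤ h y) :
    ConvexOn ℝ univ fun x => if x ≤ c then f x else h x := by
  refine convexOn_of_support fun x => ?_
  rcases lt_trichotomy x c with hx | rfl | hx
  · refine ⟨derivWithin f (Ioi x) x, fun y => ?_⟩
    have h1 := rightDeriv_support hf x
    rw [if_pos hx.le]
    split_ifs with hy
    · exact h1 y
    · push Not at hy
      have h2 := h1 c
      have h3 := hfs x hx.le
      have h4 := hhs y hy.le
      -- Slopes increase across the junction: a support line of `f` at `x < c` is no steeper than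
      -- the common line, so to the right of `c` it stays below that line, and hence below `h`.
      have h5 : derivWithin f (Ioi x) x ≤ s := by
        have : derivWithin f (Ioi x) x * (c - x) ≤ s * (c - x) := by linarith
        exact le_of_mul_le_mul_right this (by linarith)
      have h6 := mul_le_mul_of_nonneg_right h5 (sub_nonneg.2 hy.le)
      linarith
  · refine ⟨s, fun y => ?_⟩
    rw [if_pos le_rfl]
    split_ifs with hy
    · exact hfs y hy
    · rw [hc]; exact hhs y (not_le.1 hy).le
  · refine ⟨derivWithin h (Ioi x) x, fun y => ?_⟩
    have h1 := rightDeriv_support hh x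
    rw [if_neg (not_le.2 hx)]
    split_ifs with hy
    · have h2 := h1 c
      have h3 := hhs x hx.le
      have h4 := hfs y hy
      have h5 : s ≤ derivWithin h (Ioi x) x := by
        have : s * (x - c) ≤ derivWithin h (Ioi x) x * (x - c) := by linarith
        exact le_of_mul_le_mul_right this (by linarith)
      have h6 := mul_le_mul_of_nonneg_right h5 (sub_nonneg.2 hy)
      linarith
    · exact h1 y

/-- A local minimum of a convex function is global, so `F` increases on `[0, ∞)`, and an increasing
convex function of `|x|` is convex. Only a local comparison is asked for because the glued functions
are controlled near `0`, where they equal `a`. -/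
theorem convexOn_comp_abs {F : ℝ → ℝ} (hF : ConvexOn ℝ univ F) {r : ℝ} (hr : 0 < r)
    (h0 : ∀ y, |y| < r → F 0 ≤ F y) : ConvexOn ℝ univ fun x => F |x| := by
  have hmin : ∀ y, F 0 ≤ F y := by
    have hloc : IsLocalMin F 0 := by
      filter_upwards [Metric.ball_mem_nhds (0 : ℝ) hr] with y hy
      exact h0 y (by simpa using hy)
    have := IsMinOn.of_isLocalMin_of_convex_univ hloc hF
    exact fun y => this y
  have hmono : MonotoneOn F (Ici 0) := by
    intro x hx y hy hxy
    have := convexOn_le_line hF (A := F y) (s := 0) (c := 0) (p := 0) (q := y) (t := x)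
      (by simpa using hmin y) (by simp) hx hxy
    simpa using this
  have habs : ConvexOn ℝ univ fun x : ℝ => |x| := by
    exact convexOn_univ_norm (E := ℝ)
  have himg : (fun x : ℝ => |x|) '' univ ⊆ Ici 0 := by
    rintro _ ⟨x, _, rfl⟩; exact abs_nonneg x
  have hconv : Convex ℝ ((fun x : ℝ => |x|) '' univ) := by
    have : (fun x : ℝ => |x|) '' univ = Ici 0 := by
      refine himg.antisymm fun x hx => ⟨x, mem_univ _, abs_of_nonneg hx⟩
    rw [this]; exact convex_Ici 0
  exact ConvexOn.comp (hF.subset (subset_univ _) hconv) habs (hmono.mono himg)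

theorem even_convexOn_zero_le {f : ℝ → ℝ} (hf : ConvexOn ℝ univ f) (he : ∀ x, f (-x) = f x)
    (y : ℝ) : f 0 ≤ f y := by
  have h := hf.2 (mem_univ y) (mem_univ (-y)) (by norm_num : (0 : ℝ) ≤ 1 / 2)
    (by norm_num : (0 : ℝ) ≤ 1 / 2) (by norm_num)
  rw [he] at h
  simp only [smul_eq_mul] at h
  rw [show (1 / 2 * y + 1 / 2 * -y : ℝ) = 0 by ring] at h
  linarith

theorem even_abs {f : ℝ → ℝ} (he : ∀ x, f (-x) = f x) (x : ℝ) : f |x| = f x := by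
  rcases abs_choice x with h | h <;> rw [h]
  exact he x

theorem even_convexOn_monotoneOn {f : ℝ → ℝ} (hf : ConvexOn ℝ univ f)
    (he : ∀ x, f (-x) = f x) : MonotoneOn f (Ici 0) := by
  intro x hx y _ hxy
  have := convexOn_le_line hf (A := f y) (s := 0) (c := 0) (p := 0) (q := y) (t := x)
    (by simpa using even_convexOn_zero_le hf he y) (by simp) hx hxy
  simpa using this

/-- The tangent of `b` at `e` supports both pieces: it passes through the common value there, and `a
≥ b`. -/
theorem convexOn_psi3' {a b : ℝ → ℝ} {e : ℝ} (ha : ConvexOn ℝ univ a) (hb : ConvexOn ℝ univ b)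
    (hba : ∀ x, b x ≤ a x) (hae : ∀ x, a (-x) = a x) (hbe : ∀ x, b (-x) = b x) (he : 0 < e)
    (hab : a e = b e) : ConvexOn ℝ univ (psi3' a b e) := by
  have hs := rightDeriv_support hb e
  have hF := convexOn_glue ha hb (c := e) hab (s := derivWithin b (Ioi e) e)
    (fun y _ => by rw [hab]; exact (hs y).trans (hba y)) fun y _ => hs y
  have := convexOn_comp_abs hF he fun y hy => by
    rw [if_pos he.le, if_pos ((le_abs_self y).trans hy.le)]
    exact even_convexOn_zero_le ha hae y
  convert this using 2 with x
  unfold psi3'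
  by_cases h : e < |x|
  · rw [if_pos h, if_neg (not_le.2 h), even_abs hbe]
  · rw [if_neg h, if_pos (not_lt.1 h), even_abs hae]

/-- The function equal to `a` near the centre, to a line (in `|x|`) in between, and to `b` in the
tails. -/
noncomputable def lineBridge (a b : ℝ → ℝ) (A s c f g x : ℝ) : ℝ :=
  if g < |x| then b x else if |x| < f then a x else A + s * (|x| - c)

/-- Two gluings, then symmetrisation. The line lies above `b` at `f` and meets it at `g`, so `b` is
above the line beyond `g`. The line meets `a` at `f` and `x₃`, so `a` is above it before `f`. In
both junctions the line itself is the common support. -/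
theorem convexOn_lineBridge {a b : ℝ → ℝ} {A s c f x₃ g : ℝ} (ha : ConvexOn ℝ univ a)
    (hb : ConvexOn ℝ univ b)
    (hba : ∀ x, b x ≤ a x) (hae : ∀ x, a (-x) = a x) (hbe : ∀ x, b (-x) = b x)
    (hf : 0 < f) (hfx : f < x₃) (hxg : x₃ < g) (haf : a f = A + s * (f - c))
    (hax : a x₃ = A + s * (x₃ - c)) (hbg : b g = A + s * (g - c)) :
    ConvexOn ℝ univ (lineBridge a b A s c f g) := by
  have hL : ConvexOn ℝ univ fun x => A + s * (x - c) := by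
    refine convexOn_of_support fun x => ⟨s, fun y => le_of_eq (by ring)⟩
  have hfb : b f ≤ A + s * (f - c) := (hba f).trans haf.le
  have hG := convexOn_glue hL hb (c := g) (s := s) hbg.symm
    (fun y _ => le_of_eq (by ring)) fun y hy => by
      have := line_le_convexOn_right hb (A := A) (s := s) (c := c) hfb hbg.ge (hfx.trans hxg) hy
      rw [hbg]; linarith
  have hF := convexOn_glue ha hG (c := f) (s := s) (by rw [if_pos (hfx.trans hxg).le, haf])
    (fun y hy => by
      have := line_le_convexOn_left ha (A := A) (s := s) (c := c) haf.ge hax.le hfx hy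
      rw [haf]; linarith) fun y hy => by
      rw [if_pos (hfx.trans hxg).le]
      split_ifs with h
      · linarith
      · have := line_le_convexOn_right hb (A := A) (s := s) (c := c) hfb hbg.ge (hfx.trans hxg)
          (not_le.1 h).le
        linarith
  have := convexOn_comp_abs hF hf fun y hy => by
    rw [if_pos hf.le, if_pos ((le_abs_self y).trans hy.le)]
    exact even_convexOn_zero_le ha hae y
  convert this using 2 with x
  unfold lineBridge
  by_cases h : g < |x|
  · rw [if_pos h, if_neg (not_le.2 (by linarith)), if_neg (not_le.2 h), even_abs hbe]
  · rw [if_neg h]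
    rcases lt_trichotomy |x| f with h1 | h1 | h1
    · rw [if_pos h1, if_pos h1.le, even_abs hae]
    · rw [if_neg h1.not_lt, if_pos h1.le, h1, haf]
    · rw [if_neg (not_lt.2 h1.le), if_neg (not_le.2 h1), if_pos (not_lt.1 h)]

theorem le_lineBridge {a b : ℝ → ℝ} {A s c f g : ℝ} (hb : ConvexOn ℝ univ b)
    (hba : ∀ x, b x ≤ a x) (hbe : ∀ x, b (-x) = b x) (haf : a f = A + s * (f - c))
    (hbg : b g = A + s * (g - c)) (x : ℝ) : b x ≤ lineBridge a b A s c f g x := by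
  unfold lineBridge
  split_ifs with h1 h2
  · exact le_rfl
  · exact hba x
  · rw [← even_abs hbe]
    exact convexOn_le_line hb ((hba f).trans haf.le) hbg.le (not_lt.1 h2) (not_lt.1 h1)

/-- This lemma and the next give the sign conditions of slackness. They hold because the convex
function `a` is above the line outside the two points where it meets it and below the line between
them. On `|x| ≤ f` both apply, and there `ψ = a`, so stopping and continuing are both admissible. -/
theorem lineBridge_le {a b : ℝ → ℝ} {A s c f x₃ g : ℝ} (ha : ConvexOn ℝ univ a)
    (hba : ∀ x, b x ≤ a x) (hae : ∀ x, a (-x) = a x)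
    (hfx : f < x₃) (haf : a f = A + s * (f - c))
    (hax : a x₃ = A + s * (x₃ - c)) {x : ℝ} (hx : |x| ≤ f ∨ x₃ ≤ |x|) :
    lineBridge a b A s c f g x ≤ a x := by
  unfold lineBridge
  split_ifs with h1 h2
  · exact hba x
  · exact le_rfl
  · rw [← even_abs hae x]
    rcases hx with hx | hx
    · exact line_le_convexOn_left ha haf.ge hax.le hfx hx
    · exact line_le_convexOn_right ha haf.le hax.ge hfx hx

theorem le_lineBridge_of_abs_le {a b : ℝ → ℝ} {A s c f x₃ g : ℝ} (ha : ConvexOn ℝ univ a)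
    (hae : ∀ x, a (-x) = a x)
    (hxg : x₃ < g) (haf : a f = A + s * (f - c))
    (hax : a x₃ = A + s * (x₃ - c)) {x : ℝ} (hx : |x| ≤ x₃) :
    a x ≤ lineBridge a b A s c f g x := by
  unfold lineBridge
  split_ifs with h1 h2
  · linarith
  · exact le_rfl
  · rw [← even_abs hae x]
    exact convexOn_le_line ha haf.le hax.le (not_lt.1 h2) hx

theorem psi3_eq_lineBridge {ρ η a b : ℝ → ℝ} {β : EReal} {x₃ : ℝ} :
    psi3 ρ η a b β x₃ = lineBridge a b (a x₃)
      ((b (gR ρ η β x₃) - a x₃) / (gR ρ η β x₃ - x₃)) x₃ (fR ρ η β x₃) (gR ρ η β x₃) := by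
  ext x
  unfold psi3 lineBridge chord
  split_ifs with h1 h2 h3
  · rfl
  · rfl
  · rw [abs_of_neg h3]
  · rw [abs_of_nonneg (not_lt.1 h3)]

/-! ### Couplings carried by two branches -/

theorem ae_eq_zero_of_setIntegral_Iic {m : Measure ℝ} [IsFiniteMeasure m] {f : ℝ → ℝ}
    (hf : Integrable f m) (h0 : ∫ t, f t ∂m = 0) (h : ∀ x, ∫ t in Iic x, f t ∂m = 0) :
    f =ᵐ[m] 0 := by
  refine hf.ae_eq_zero_of_forall_setIntegral_eq_zero fun s hs _ => ?_
  induction s, hs using MeasurableSpace.induction_on_inter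
    (h_eq := (BorelSpace.measurable_eq (α := ℝ)).trans (borel_eq_generateFrom_Iic ℝ))
    isPiSystem_Iic with
  | empty => simp
  | basic t ht => obtain ⟨x, rfl⟩ := ht; exact h x
  | compl t ht ih =>
    have := integral_add_compl ht hf
    rw [ih (measure_lt_top _ _), h0] at this
    linarith
  | iUnion g hd hm ih =>
    rw [integral_iUnion hm hd hf.integrableOn]
    simp [fun i => ih i (measure_lt_top _ _)]

theorem twoPoint_apply (x f g : ℝ) (A : Set ℝ) (hA : MeasurableSet A) :
    twoPoint x f g A = ENNReal.ofReal ((g - x) / (g - f)) * A.indicator 1 f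
      + ENNReal.ofReal ((x - f) / (g - f)) * A.indicator 1 g := by
  simp [twoPoint, Measure.dirac_apply' _ hA]

/-- Let `m₁` and `m₂` be carried by the graphs of `s₁` and `s₂` with right inverses `r₁`, `r₂` such
that the images under `r₁`, `r₂` add up to `m` in mass and barycentre. Then the martingale kernel
from `t` to `{s₁ t, s₂ t}` transports `m` to `m₁ + m₂`. -/
theorem lintegral_twoPoint_of_inverse {m m₁ m₂ : Measure ℝ} [IsFiniteMeasure m]
    [IsFiniteMeasure m₁] [IsFiniteMeasure m₂] (hm : Integrable id m) (hm₁ : Integrable id m₁)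
    (hm₂ : Integrable id m₂) {s₁ s₂ r₁ r₂ : ℝ → ℝ} (hs₁ : AEMeasurable s₁ m)
    (hs₂ : AEMeasurable s₂ m) (hr₁ : AEMeasurable r₁ m₁) (hr₂ : AEMeasurable r₂ m₂)
    (hsr₁ : ∀ᵐ z ∂m₁, s₁ (r₁ z) = z) (hsr₂ : ∀ᵐ z ∂m₂, s₂ (r₂ z) = z)
    (hlt : ∀ᵐ t ∂m, s₁ t < t ∧ t < s₂ t)
    (hmap : m₁.map r₁ + m₂.map r₂ = m)
    (hmean : ∀ x, ∫ z in r₁ ⁻¹' Iic x, z ∂m₁ + ∫ z in r₂ ⁻¹' Iic x, z ∂m₂ = ∫ t in Iic x, t ∂m)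
    (htot : ∫ z, z ∂m₁ + ∫ z, z ∂m₂ = ∫ t, t ∂m) {A : Set ℝ} (hA : MeasurableSet A) :
    ∫⁻ t, twoPoint t (s₁ t) (s₂ t) A ∂m = m₁ A + m₂ A := by
  set k₁ := m₁.map r₁ with hk₁
  set k₂ := m₂.map r₂ with hk₂
  have l₁ : k₁ ≤ m := hmap ▸ Measure.le_add_right le_rfl
  have l₂ : k₂ ≤ m := hmap ▸ Measure.le_add_left le_rfl
  have ac₁ : k₁ ≪ m := l₁.absolutelyContinuous
  have ac₂ : k₂ ≪ m := l₂.absolutelyContinuous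
  have branch : ∀ (n k : Measure ℝ) (r s : ℝ → ℝ) (_ : IsFiniteMeasure n), k = n.map r →
      AEMeasurable r n → k ≪ m → AEMeasurable s m → (∀ᵐ z ∂n, s (r z) = z) → Integrable id n →
      Integrable s k ∧ (∀ B, MeasurableSet B → ∫ t in B, s t ∂k = ∫ z in r ⁻¹' B, z ∂n) ∧
      ∫⁻ t, A.indicator 1 (s t) ∂k = n A := by
    intro n k r s _ hk hr hac hs hsr hn
    have hsk : AEMeasurable s k := hs.mono_ac hac
    subst hk
    refine ⟨?_, fun B hB => ?_, ?_⟩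
    · rw [integrable_map_measure hsk.aestronglyMeasurable hr]
      exact hn.congr (hsr.mono fun z hz => hz.symm)
    · rw [setIntegral_map hB hsk.aestronglyMeasurable hr]
      exact integral_congr_ae (ae_restrict_of_ae hsr)
    · have hi : Measurable (A.indicator (1 : ℝ → ENNReal)) := measurable_one.indicator hA
      rw [lintegral_map' (f := fun t => A.indicator 1 (s t)) (hi.comp_aemeasurable hsk) hr,
        ← lintegral_indicator_one hA]
      exact lintegral_congr_ae (hsr.mono fun z hz => by simp only [hz])
  obtain ⟨i₁, q₁, p₁⟩ := branch m₁ k₁ r₁ s₁ inferInstance rfl hr₁ ac₁ hs₁ hsr₁ hm₁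
  obtain ⟨i₂, q₂, p₂⟩ := branch m₂ k₂ r₂ s₂ inferInstance rfl hr₂ ac₂ hs₂ hsr₂ hm₂
  have fk₁ : IsFiniteMeasure k₁ := by rw [hk₁]; infer_instance
  have fk₂ : IsFiniteMeasure k₂ := by rw [hk₂]; infer_instance
  -- The densities of the two pullbacks with respect to `m` are the candidate transition
  -- probabilities. That the pullbacks add up to `m` says that these have sum one.
  have hw : ∀ᵐ t ∂m, k₁.rnDeriv m t + k₂.rnDeriv m t = 1 := by
    have h1 := Measure.rnDeriv_add' k₁ k₂ m
    rw [hmap] at h1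
    filter_upwards [h1, Measure.rnDeriv_self m] with t e1 e2
    rw [← e2, e1]; rfl
  have j₁ := (integrable_rnDeriv_smul_iff ac₁).2 i₁
  have j₂ := (integrable_rnDeriv_smul_iff ac₂).2 i₂
  set D : ℝ → ℝ := fun t => (k₁.rnDeriv m t).toReal • s₁ t + (k₂.rnDeriv m t).toReal • s₂ t - t
    with hD
  have jD : Integrable D m := (j₁.add j₂).sub hm
  -- Agreement of first moments on all initial segments gives the barycentre condition at almost
  -- every `t`. Sum one and mean `t` determine the weights on `{s₁ t, s₂ t}`, so they are those of
  -- `twoPoint`.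
  have hD0 : D =ᵐ[m] 0 := by
    have hB : ∀ B, MeasurableSet B → ∫ t in B, D t ∂m =
        ∫ z in r₁ ⁻¹' B, z ∂m₁ + ∫ z in r₂ ⁻¹' B, z ∂m₂ - ∫ t in B, t ∂m := by
      intro B hB
      have e1 := integral_sub (μ := m.restrict B) (j₁.add j₂).integrableOn.integrable
        hm.integrableOn.integrable
      have e2 := integral_add (μ := m.restrict B) j₁.integrableOn.integrable
        j₂.integrableOn.integrable
      simp only [Pi.add_apply, id] at e1 e2
      rw [hD, e1, e2, setIntegral_rnDeriv_smul ac₁ hB, setIntegral_rnDeriv_smul ac₂ hB,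
        q₁ B hB, q₂ B hB]
    refine ae_eq_zero_of_setIntegral_Iic jD ?_ fun x => ?_
    · have := hB univ MeasurableSet.univ
      simp only [preimage_univ, Measure.restrict_univ] at this
      rw [this, htot, sub_self]
    · rw [hB _ measurableSet_Iic, hmean, sub_self]
  have e₁ := lintegral_rnDeriv_mul ac₁ (f := fun t => A.indicator 1 (s₁ t))
    ((measurable_one.indicator hA : Measurable (A.indicator (1 : ℝ → ENNReal))).comp_aemeasurable
      hs₁)
  have e₂ := lintegral_rnDeriv_mul ac₂ (f := fun t => A.indicator 1 (s₂ t))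
    ((measurable_one.indicator hA : Measurable (A.indicator (1 : ℝ → ENNReal))).comp_aemeasurable
      hs₂)
  rw [← p₁, ← p₂, ← e₁, ← e₂, ← lintegral_add_left']
  · refine lintegral_congr_ae ?_
    filter_upwards [hw, hD0, hlt] with t hwt hDt ht
    rw [twoPoint_apply _ _ _ _ hA]
    have n1 : k₁.rnDeriv m t ≠ ⊤ := fun h => by rw [h] at hwt; simp at hwt
    have n2 : k₂.rnDeriv m t ≠ ⊤ := fun h => by rw [h] at hwt; simp at hwt
    have hr : (k₁.rnDeriv m t).toReal + (k₂.rnDeriv m t).toReal = 1 := by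
      rw [← ENNReal.toReal_add n1 n2, hwt, ENNReal.toReal_one]
    simp only [hD, smul_eq_mul, Pi.zero_apply] at hDt
    have hpos : 0 < s₂ t - s₁ t := by linarith [ht.1, ht.2]
    have v1 : (s₂ t - t) / (s₂ t - s₁ t) = (k₁.rnDeriv m t).toReal := by
      rw [div_eq_iff hpos.ne']
      linear_combination hDt - (s₂ t) * hr
    have v2 : (t - s₁ t) / (s₂ t - s₁ t) = (k₂.rnDeriv m t).toReal := by
      rw [div_eq_iff hpos.ne']
      linear_combination (-1) * hDt + (s₁ t) * hr
    rw [v1, v2, ENNReal.ofReal_toReal n1, ENNReal.ofReal_toReal n2]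
  · exact (Measure.measurable_rnDeriv k₁ m).aemeasurable.mul
      ((measurable_one.indicator hA : Measurable (A.indicator (1 : ℝ → ENNReal))).comp_aemeasurable
        hs₁)

/-- The map `s` need not be injective, but any choice of preimages is antitone, hence measurable.
Only at the value `z = s x` does the side of `x` on which the chosen preimage falls depend on the
choice, and a single point carries no mass. -/
theorem exists_inverse_antitoneOn {n : Measure ℝ} [NullSingletonClass n] {s : ℝ → ℝ} {I S : Set ℝ}
    (hs : AntitoneOn s I) (hS : MeasurableSet S) (hsurj : SurjOn s I S) (hn : n Sᶜ = 0) :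
    ∃ r : ℝ → ℝ, AEMeasurable r n ∧ (∀ᵐ z ∂n, r z ∈ I ∧ s (r z) = z) ∧
      ∀ x ∈ I, r ⁻¹' Iic x =ᵐ[n] Ioi (s x) := by
  choose! r hr using (fun z hz => hsurj hz : ∀ z ∈ S, ∃ x ∈ I, s x = z)
  have hnS : ∀ᵐ z ∂n, z ∈ S := mem_ae_iff.2 hn
  refine ⟨r, ?_, hnS.mono hr, fun x hx => ?_⟩
  · have h : AntitoneOn r S := by
      intro z hz w hw hzw
      by_contra! hlt
      have := hs (hr _ hz).1 (hr _ hw).1 hlt.le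
      rw [(hr _ hz).2, (hr _ hw).2] at this
      have : z = w := le_antisymm hzw this
      rw [this] at hlt
      exact lt_irrefl _ hlt
    have := aemeasurable_restrict_of_antitoneOn (μ := n) hS h
    rwa [Measure.restrict_eq_self_of_ae_mem hnS] at this
  · have hne : ∀ᵐ z ∂n, z ≠ s x := by
      rw [ae_iff]; simp
    filter_upwards [hnS, hne] with z hz hzx
    apply propext
    change r z ≤ x ↔ s x < z
    constructor
    · intro h
      have := hs (hr _ hz).1 hx h
      rw [(hr _ hz).2] at this
      exact lt_of_le_of_ne this hzx.symm
    · intro h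
      by_contra! hlt
      have := hs hx (hr _ hz).1 hlt.le
      rw [(hr _ hz).2] at this
      linarith

theorem exists_inverse_monotoneOn {n : Measure ℝ} [NullSingletonClass n] {s : ℝ → ℝ} {I S : Set ℝ}
    (hs : MonotoneOn s I) (hS : MeasurableSet S) (hsurj : SurjOn s I S) (hn : n Sᶜ = 0) :
    ∃ r : ℝ → ℝ, AEMeasurable r n ∧ (∀ᵐ z ∂n, r z ∈ I ∧ s (r z) = z) ∧
      ∀ x ∈ I, r ⁻¹' Iic x =ᵐ[n] Iio (s x) := by
  choose! r hr using (fun z hz => hsurj hz : ∀ z ∈ S, ∃ x ∈ I, s x = z)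
  have hnS : ∀ᵐ z ∂n, z ∈ S := mem_ae_iff.2 hn
  refine ⟨r, ?_, hnS.mono hr, fun x hx => ?_⟩
  · have h : MonotoneOn r S := by
      intro z hz w hw hzw
      by_contra! hlt
      have := hs (hr _ hw).1 (hr _ hz).1 hlt.le
      rw [(hr _ hz).2, (hr _ hw).2] at this
      have : z = w := le_antisymm hzw this
      rw [this] at hlt
      exact lt_irrefl _ hlt
    have := aemeasurable_restrict_of_monotoneOn (μ := n) hS h
    rwa [Measure.restrict_eq_self_of_ae_mem hnS] at this
  · have hne : ∀ᵐ z ∂n, z ≠ s x := by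
      rw [ae_iff]; simp
    filter_upwards [hnS, hne] with z hz hzx
    apply propext
    change r z ≤ x ↔ z < s x
    constructor
    · intro h
      have := hs (hr _ hz).1 hx h
      rw [(hr _ hz).2] at this
      exact lt_of_le_of_ne this hzx
    · intro h
      by_contra! hlt
      have := hs hx (hr _ hz).1 hlt.le
      rw [(hr _ hz).2] at this
      linarith

/-- The previous transport result with mass and barycentre tested on initial segments of an
interval carrying `m`. -/
theorem lintegral_twoPoint_of_segments {m m₁ m₂ : Measure ℝ} [IsFiniteMeasure m]
    [IsFiniteMeasure m₁] [IsFiniteMeasure m₂] (hm : Integrable id m) (hm₁ : Integrable id m₁)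
    (hm₂ : Integrable id m₂) {s₁ s₂ r₁ r₂ : ℝ → ℝ} {c d : ℝ} (hs₁ : AEMeasurable s₁ m)
    (hs₂ : AEMeasurable s₂ m) (hr₁ : AEMeasurable r₁ m₁) (hr₂ : AEMeasurable r₂ m₂)
    (hsr₁ : ∀ᵐ z ∂m₁, r₁ z ∈ Ioo c d ∧ s₁ (r₁ z) = z)
    (hsr₂ : ∀ᵐ z ∂m₂, r₂ z ∈ Ioo c d ∧ s₂ (r₂ z) = z)
    {U₁ U₂ : ℝ → Set ℝ} (hU₁ : ∀ x ∈ Ioo c d, r₁ ⁻¹' Iic x =ᵐ[m₁] U₁ x)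
    (hU₂ : ∀ x ∈ Ioo c d, r₂ ⁻¹' Iic x =ᵐ[m₂] U₂ x)
    (hmI : ∀ᵐ t ∂m, t ∈ Ioo c d)
    (hlt : ∀ᵐ t ∂m, s₁ t < t ∧ t < s₂ t)
    (hmass : ∀ x ∈ Ioo c d, m₁.real (U₁ x) + m₂.real (U₂ x) = m.real (Iic x))
    (hmean : ∀ x ∈ Ioo c d, ∫ z in U₁ x, z ∂m₁ + ∫ z in U₂ x, z ∂m₂ = ∫ t in Iic x, t ∂m)
    (hmass' : m₁.real univ + m₂.real univ = m.real univ)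
    (hmean' : ∫ z, z ∂m₁ + ∫ z, z ∂m₂ = ∫ t, t ∂m) {A : Set ℝ} (hA : MeasurableSet A) :
    ∫⁻ t, twoPoint t (s₁ t) (s₂ t) A ∂m = m₁ A + m₂ A := by
  have low : ∀ (n : Measure ℝ) (r : ℝ → ℝ), (∀ᵐ z ∂n, r z ∈ Ioo c d) → ∀ x ≤ c,
      r ⁻¹' Iic x =ᵐ[n] (∅ : Set ℝ) := by
    intro n r h x hx
    filter_upwards [h] with z hz
    apply propext
    change r z ≤ x ↔ False
    simp only [iff_false, not_le]
    exact hx.trans_lt hz.1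
  have high : ∀ (n : Measure ℝ) (r : ℝ → ℝ), (∀ᵐ z ∂n, r z ∈ Ioo c d) → ∀ x, d ≤ x →
      r ⁻¹' Iic x =ᵐ[n] (univ : Set ℝ) := by
    intro n r h x hx
    filter_upwards [h] with z hz
    apply propext
    change r z ≤ x ↔ True
    simp only [iff_true]
    exact hz.2.le.trans hx
  have g₁ := hsr₁.mono fun z h => h.1
  have g₂ := hsr₂.mono fun z h => h.1
  refine lintegral_twoPoint_of_inverse hm hm₁ hm₂ hs₁ hs₂ hr₁ hr₂ (hsr₁.mono fun z h => h.2)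
    (hsr₂.mono fun z h => h.2) hlt ?_ ?_ hmean' hA
  · refine Measure.ext_of_Iic _ _ fun x => ?_
    rw [Measure.add_apply, Measure.map_apply_of_aemeasurable hr₁ measurableSet_Iic,
      Measure.map_apply_of_aemeasurable hr₂ measurableSet_Iic,
      ← ENNReal.toReal_eq_toReal_iff' (by finiteness) (by finiteness),
      ENNReal.toReal_add (by finiteness) (by finiteness)]
    rcases le_or_gt x c with h1 | h1
    · rw [measure_congr (low _ _ g₁ x h1), measure_congr (low _ _ g₂ x h1),
        show Iic x = id ⁻¹' Iic x from rfl, measure_congr (low _ id hmI x h1)]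
      simp
    rcases le_or_gt d x with h2 | h2
    · rw [measure_congr (high _ _ g₁ x h2), measure_congr (high _ _ g₂ x h2),
        show Iic x = id ⁻¹' Iic x from rfl, measure_congr (high _ id hmI x h2)]
      exact hmass'
    · rw [measure_congr (hU₁ x ⟨h1, h2⟩), measure_congr (hU₂ x ⟨h1, h2⟩)]
      exact hmass x ⟨h1, h2⟩
  · intro x
    rcases le_or_gt x c with h1 | h1
    · rw [setIntegral_congr_set (low _ _ g₁ x h1), setIntegral_congr_set (low _ _ g₂ x h1),
        show Iic x = id ⁻¹' Iic x from rfl, setIntegral_congr_set (low _ id hmI x h1)]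
      simp
    rcases le_or_gt d x with h2 | h2
    · rw [setIntegral_congr_set (high _ _ g₁ x h2), setIntegral_congr_set (high _ _ g₂ x h2),
        show Iic x = id ⁻¹' Iic x from rfl, setIntegral_congr_set (high _ id hmI x h2)]
      simpa using hmean'
    · rw [setIntegral_congr_set (hU₁ x ⟨h1, h2⟩), setIntegral_congr_set (hU₂ x ⟨h1, h2⟩)]
      exact hmean x ⟨h1, h2⟩

/-! ### The curtain equations in terms of primitives -/

theorem exists_continuousOn_inverse {f : ℝ → ℝ} (hf : Continuous f) {a b : ℝ} (hab : a ≤ b)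
    (hm : StrictMonoOn f (Icc a b)) :
    ∃ h : ℝ → ℝ, ContinuousOn h (Icc (f a) (f b)) ∧
      ∀ y ∈ Icc (f a) (f b), h y ∈ Icc a b ∧ f (h y) = y := by
  choose! h hh using
    (fun y hy => intermediate_value_Icc hab hf.continuousOn hy :
      ∀ y ∈ Icc (f a) (f b), ∃ x ∈ Icc a b, f x = y)
  refine ⟨h, fun y hy => ?_, hh⟩
  have hy' := hh y hy
  refine tendsto_order.2 ⟨fun c hc => ?_, fun c hc => ?_⟩
  · rcases lt_or_ge c a with hca | hca
    · filter_upwards [self_mem_nhdsWithin] with z hz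
      exact hca.trans_le (hh z hz).1.1
    · have hcI : c ∈ Icc a b := ⟨hca, hc.le.trans hy'.1.2⟩
      have h1 : f c < y := by
        have := hm hcI hy'.1 hc
        rwa [hy'.2] at this
      filter_upwards [self_mem_nhdsWithin, mem_nhdsWithin_of_mem_nhds (Ioi_mem_nhds h1)] with z hz hz2
      by_contra! hle
      have := hm.monotoneOn (hh z hz).1 hcI hle
      rw [(hh z hz).2] at this
      exact absurd hz2 (not_lt.2 this)
  · rcases lt_or_ge b c with hca | hca
    · filter_upwards [self_mem_nhdsWithin] with z hz
      exact (hh z hz).1.2.trans_lt hca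
    · have hcI : c ∈ Icc a b := ⟨hy'.1.1.trans hc.le, hca⟩
      have h1 : y < f c := by
        have := hm hy'.1 hcI hc
        rwa [hy'.2] at this
      filter_upwards [self_mem_nhdsWithin, mem_nhdsWithin_of_mem_nhds (Iio_mem_nhds h1)] with z hz hz2
      by_contra! hle
      have := hm.monotoneOn hcI (hh z hz).1 hle
      rw [(hh z hz).2] at this
      exact absurd hz2 (not_lt.2 this)

/-- The curtain equations control the endpoints only through the primitives, that is, after
composition with a strictly increasing function. This removes the composition. -/
theorem continuousAt_of_comp_strictMonoOn {φ F : ℝ → ℝ} {B : Set ℝ} (hB : IsOpen B)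
    (hφ : StrictMonoOn φ B) {x : ℝ} (hF : ∀ᶠ y in nhds x, F y ∈ B)
    (hc : ContinuousAt (fun y => φ (F y)) x) : ContinuousAt F x := by
  have hx : F x ∈ B := hF.self_of_nhds
  refine tendsto_order.2 ⟨fun c hcx => ?_, fun c hcx => ?_⟩
  · obtain ⟨l, u, hlu, hsub⟩ := mem_nhds_iff_exists_Ioo_subset.1 (hB.mem_nhds hx)
    obtain ⟨d, hd1, hd2⟩ := exists_between (max_lt hcx hlu.1)
    have hdB : d ∈ B := hsub ⟨(le_max_right _ _).trans_lt hd1, hd2.trans hlu.2⟩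
    have h1 := hc.eventually (Ioi_mem_nhds (hφ hdB hx hd2))
    filter_upwards [h1, hF] with y hy hyB
    by_contra! hle
    have := hφ.monotoneOn hyB hdB (hle.trans ((le_max_left _ _).trans hd1.le))
    exact absurd hy (not_lt.2 this)
  · obtain ⟨l, u, hlu, hsub⟩ := mem_nhds_iff_exists_Ioo_subset.1 (hB.mem_nhds hx)
    obtain ⟨d, hd1, hd2⟩ := exists_between (lt_min hcx hlu.2)
    have hdB : d ∈ B := hsub ⟨hlu.1.trans hd1, hd2.trans_le (min_le_right _ _)⟩
    have h1 := hc.eventually (Iio_mem_nhds (hφ hx hdB hd1))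
    filter_upwards [h1, hF] with y hy hyB
    by_contra! hle
    have := hφ.monotoneOn hdB hyB ((hd2.le.trans (min_le_left _ _)).trans hle)
    exact absurd hy (not_lt.2 this)

/-- The increment of `(H, H₁)` from `p` to `q` is that of a positive measure on `(p, q)` and its
first moment. -/
def Bary (H H₁ : ℝ → ℝ) (p q : ℝ) : Prop :=
  0 < H q - H p ∧ p * (H q - H p) < H₁ q - H₁ p ∧ H₁ q - H₁ p < q * (H q - H p)

/-- What the analysis of the curtain equations uses about the primitives `M`, `N` of the two
densities and `M₁`, `N₁` of the first moments. -/
structure CurtainFns (M M₁ N N₁ : ℝ → ℝ) (B : Set ℝ) (e : ℝ) : Prop where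
  contM : Continuous M
  contM₁ : Continuous M₁
  contN : Continuous N
  contN₁ : Continuous N₁
  isOpen : IsOpen B
  ordConnected : B.OrdConnected
  e_pos : 0 < e
  e_mem : e ∈ B
  M_zero : M 0 = 0
  M₁_zero : M₁ 0 = 0
  N_zero : N 0 = 0
  N₁_zero : N₁ 0 = 0
  N_bary : ∀ p ∈ B, ∀ q ∈ B, p < q → Bary N N₁ p q
  M_bary : ∀ p q, 0 ≤ p → p < q → q ≤ e → Bary M M₁ p q
  W_in : ∀ p q, 0 ≤ p → p < q → q ≤ e → Bary (M - N) (M₁ - N₁) p q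
  W_out : ∀ p q, e ≤ p → p < q → q ∈ B → Bary (N - M) (N₁ - M₁) p q
  low : ∃ f ∈ B, f < 0 ∧ N f ≤ -(M e - N e)
  neg : ∃ g ∈ B, e < g ∧ M₁ g - N₁ g < 0
  small : ∀ y, 0 < y → ∃ g ∈ B, e < g ∧ M g - N g < y
  pos : ∀ g ∈ B, e ≤ g → 0 < M g - N g

/-- The right-curtain equations in terms of primitives. -/
structure CurtainPair (M M₁ N N₁ : ℝ → ℝ) (B : Set ℝ) (x f g : ℝ) : Prop where
  f_mem : f ∈ B
  g_mem : g ∈ B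
  f_lt : f < x
  lt_g : x < g
  mass : M g - M x = N g - N f
  mean : M₁ g - M₁ x = N₁ g - N₁ f

namespace CurtainFns

variable {M M₁ N N₁ : ℝ → ℝ} {B : Set ℝ} {e : ℝ}

theorem zero_mem (h : CurtainFns M M₁ N N₁ B e) : (0 : ℝ) ∈ B := by
  obtain ⟨f, hf, hf0, -⟩ := h.low
  exact h.ordConnected.out hf h.e_mem ⟨hf0.le, h.e_pos.le⟩

theorem mem_of_Icc (h : CurtainFns M M₁ N N₁ B e) {x : ℝ} (h0 : 0 ≤ x) (hx : x ≤ e) : x ∈ B :=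
  h.ordConnected.out h.zero_mem h.e_mem ⟨h0, hx⟩

/-- If `g ≤ e`, the equations equate `μ - ν` on `(x, g)` with `ν` on `(f, x)` in mass and first
moment, although these positive measures lie on opposite sides of `x`. -/
theorem e_lt_g (h : CurtainFns M M₁ N N₁ B e) {x f g : ℝ} (h0 : 0 < x) (hx : x < e)
    (hp : CurtainPair M M₁ N N₁ B x f g) : e < g := by
  by_contra! hg
  obtain ⟨-, h2, -⟩ := h.W_in x g h0.le hp.lt_g hg
  obtain ⟨-, -, h5⟩ := h.N_bary f hp.f_mem x (h.mem_of_Icc h0.le hx.le) hp.f_lt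
  have e1 := hp.mass
  have e2 := hp.mean
  simp only [Pi.sub_apply] at h2
  have : M g - N g - (M x - N x) = N x - N f := by linarith
  rw [this] at h2
  linarith

theorem strictMonoOn_N (h : CurtainFns M M₁ N N₁ B e) : StrictMonoOn N B :=
  fun p hp q hq hpq => by have := (h.N_bary p hp q hq hpq).1; linarith

theorem strictMonoOn_M (h : CurtainFns M M₁ N N₁ B e) : StrictMonoOn M (Icc 0 e) :=
  fun p hp q hq hpq => by have := (h.M_bary p q hp.1 hpq hq.2).1; linarith

theorem W_anti (h : CurtainFns M M₁ N N₁ B e) {p q : ℝ} (hp : e ≤ p) (hpq : p < q)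
    (hq : q ∈ B) : M q - N q < M p - N p := by
  have := (h.W_out p q hp hpq hq).1
  simp only [Pi.sub_apply] at this
  linarith

theorem strictMonoOn_neg_W (h : CurtainFns M M₁ N N₁ B e) :
    StrictMonoOn (fun g => N g - M g) (B ∩ Ioi e) := fun p hp q hq hpq => by
  have := h.W_anti (le_of_lt hp.2) hpq hq.1
  simp only
  linarith

/-- Subtracting the two systems balances `μ` on `(x, x')` against `ν` between `f` and `f'` and `ν -
μ` between the two upper endpoints. Each wrong order turns this into an equality of positive
measures lying on opposite sides of a point: of `e` if `f' ≤ f`, and of `x` if `f < f'` but `g ≤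
g'`. -/
theorem pair_lt (h : CurtainFns M M₁ N N₁ B e) {x f g x' f' g' : ℝ} (h0 : 0 < x)
    (hxx : x < x') (hx' : x' < e) (hp : CurtainPair M M₁ N N₁ B x f g)
    (hp' : CurtainPair M M₁ N N₁ B x' f' g') : f < f' ∧ g' < g := by
  have hg := h.e_lt_g h0 (hxx.trans hx') hp
  have hg' := h.e_lt_g (h0.trans hxx) hx' hp'
  obtain ⟨m1, m2, m3⟩ := h.M_bary x x' h0.le hxx hx'.le
  have e1 := hp.mass
  have e2 := hp.mean
  have e1' := hp'.mass
  have e2' := hp'.mean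
  have hff : f < f' := by
    by_contra! hle
    have hN : 0 ≤ N f - N f' ∧ N₁ f - N₁ f' ≤ f * (N f - N f') := by
      rcases hle.eq_or_lt with rfl | hlt
      · simp
      · obtain ⟨a1, -, a3⟩ := h.N_bary f' hp'.f_mem f hp.f_mem hlt
        exact ⟨a1.le, a3.le⟩
    have hgg : g' < g := by
      by_contra! hge
      rcases hge.eq_or_lt with rfl | hlt
      · linarith
      · have := h.W_anti hg.le hlt hp'.g_mem
        linarith
    obtain ⟨w1, w2, w3⟩ := h.W_out g' g hg'.le hgg hp.g_mem
    simp only [Pi.sub_apply] at w1 w2 w3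
    have i1 : N g - M g - (N g' - M g') = (M x' - M x) + (N f - N f') := by linarith
    have i2 : N₁ g - M₁ g - (N₁ g' - M₁ g') = (M₁ x' - M₁ x) + (N₁ f - N₁ f') := by linarith
    rw [i1] at w2
    rw [i2] at w2
    have i3 : f * (N f - N f') ≤ e * (N f - N f') :=
      mul_le_mul_of_nonneg_right (hp.f_lt.trans (hxx.trans hx')).le hN.1
    have i4 : x' * (M x' - M x) ≤ e * (M x' - M x) := mul_le_mul_of_nonneg_right hx'.le m1.le
    have i5 : e * (M x' - M x + (N f - N f')) ≤ g' * (M x' - M x + (N f - N f')) :=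
      mul_le_mul_of_nonneg_right hg'.le (by linarith [hN.1])
    linarith [hN.2]
  refine ⟨hff, ?_⟩
  by_contra! hge
  have hW : 0 ≤ N g' - M g' - (N g - M g) ∧
      e * (N g' - M g' - (N g - M g)) ≤ N₁ g' - M₁ g' - (N₁ g - M₁ g) := by
    rcases hge.eq_or_lt with rfl | hlt
    · simp
    · obtain ⟨w1, w2, -⟩ := h.W_out g g' hg.le hlt hp'.g_mem
      simp only [Pi.sub_apply] at w1 w2
      exact ⟨w1.le, (mul_le_mul_of_nonneg_right hg.le w1.le).trans w2.le⟩
  have hxe : x < e := hxx.trans hx'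
  have j3 : x * (N g' - M g' - (N g - M g)) ≤ e * (N g' - M g' - (N g - M g)) :=
    mul_le_mul_of_nonneg_right hxe.le hW.1
  have key : N f' - N f = (M x' - M x) + (N g' - M g' - (N g - M g)) := by linarith
  have key1 : N₁ f' - N₁ f = (M₁ x' - M₁ x) + (N₁ g' - M₁ g' - (N₁ g - M₁ g)) := by linarith
  rcases le_or_gt f' x with hfx | hfx
  · obtain ⟨a1, a2, a3⟩ := h.N_bary f hp.f_mem f' hp'.f_mem hff
    have i3 : f' * (N f' - N f) ≤ x * (N f' - N f) := mul_le_mul_of_nonneg_right hfx a1.le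
    rw [key] at i3 a3
    linarith
  -- Here `(f, f')` reaches beyond `x`. The part of `ν` on `(x, f')` is cancelled against `μ`, which
  -- leaves `ν` on `(f, x)` equal to `μ - ν` on `(x, f')` plus `μ` on `(f', x')` plus `ν - μ` on
  -- `(g, g')`.
  · have hxB := h.mem_of_Icc h0.le hxe.le
    obtain ⟨a1, a2, a3⟩ := h.N_bary f hp.f_mem x hxB hp.f_lt
    obtain ⟨b1, b2, b3⟩ := h.W_in x f' h0.le hfx (hp'.f_lt.trans hx').le
    obtain ⟨c1, c2, c3⟩ := h.M_bary f' x' (h0.trans hfx).le hp'.f_lt hx'.le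
    simp only [Pi.sub_apply] at b1 b2 b3
    have i3 : x * (M x' - M f') ≤ f' * (M x' - M f') := mul_le_mul_of_nonneg_right hfx.le c1.le
    have i4 : x * (N x - N f) = x * (M f' - N f' - (M x - N x)) + x * (M x' - M f') +
        x * (N g' - M g' - (N g - M g)) := by
      rw [← mul_add, ← mul_add]
      congr 1
      linarith
    linarith

/-- If `f < f'`, then `g < g'`, and `ν` on `(f, f')` would have the mass and first moment of `ν - μ`
on `(g, g')`, which lies entirely to its right. -/
theorem pair_unique (h : CurtainFns M M₁ N N₁ B e) {x f g f' g' : ℝ} (h0 : 0 < x)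
    (hx : x < e) (hp : CurtainPair M M₁ N N₁ B x f g)
    (hp' : CurtainPair M M₁ N N₁ B x f' g') : f = f' ∧ g = g' := by
  have hg := h.e_lt_g h0 hx hp
  have hg' := h.e_lt_g h0 hx hp'
  have aux : ∀ {f g f' g' : ℝ}, CurtainPair M M₁ N N₁ B x f g →
      CurtainPair M M₁ N N₁ B x f' g' → e < g → e < g' → ¬ f < f' := by
    intro f g f' g' hp hp' hg hg' hlt
    have e1 := hp.mass
    have e2 := hp.mean
    have e1' := hp'.mass
    have e2' := hp'.mean
    obtain ⟨a1, a2, a3⟩ := h.N_bary f hp.f_mem f' hp'.f_mem hlt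
    have hgg : g < g' := by
      by_contra! hge
      rcases hge.eq_or_lt with rfl | hlt
      · linarith
      · have := h.W_anti hg'.le hlt hp.g_mem
        linarith
    obtain ⟨w1, w2, -⟩ := h.W_out g g' hg.le hgg hp'.g_mem
    simp only [Pi.sub_apply] at w1 w2
    have i1 : f' * (N f' - N f) ≤ g * (N f' - N f) :=
      mul_le_mul_of_nonneg_right (hp'.f_lt.trans hp.lt_g).le a1.le
    have i2 : N g' - M g' - (N g - M g) = N f' - N f := by linarith
    rw [i2] at w2
    linarith
  have hf : f = f' :=
    le_antisymm (not_lt.1 (aux hp' hp hg' hg)) (not_lt.1 (aux hp hp' hg hg'))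
  subst hf
  refine ⟨rfl, ?_⟩
  have e1 := hp.mass
  have e1' := hp'.mass
  rcases lt_trichotomy g g' with hlt | heq | hlt
  · have := h.W_anti hg.le hlt hp'.g_mem
    linarith
  · exact heq
  · have := h.W_anti hg'.le hlt hp.g_mem
    linarith

/-- For each `g ≥ e` the mass equation determines `f`. The defect `Φ` in the mean equation is then a
continuous function of `g` that changes sign. -/
theorem exists_pair (h : CurtainFns M M₁ N N₁ B e) {x : ℝ} (h0 : 0 < x) (hx : x < e) :
    ∃ f g, CurtainPair M M₁ N N₁ B x f g := by
  have hxB := h.mem_of_Icc h0.le hx.le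
  obtain ⟨w1, w2, w3⟩ := h.W_in x e h0.le hx le_rfl
  obtain ⟨v1, -, -⟩ := h.W_in 0 x le_rfl h0 hx.le
  obtain ⟨m1, -, -⟩ := h.M_bary 0 x le_rfl h0 hx.le
  simp only [Pi.sub_apply] at w1 w2 w3 v1
  rw [h.M_zero, h.N_zero] at v1
  rw [h.M_zero] at m1
  obtain ⟨f', hf'B, hf'0, hf'⟩ := h.low
  -- `fl` is the lower endpoint that the mass equation prescribes when `g = e`; `low` guarantees
  -- that it exists in `B`.
  obtain ⟨fl, hfl, hNfl⟩ : M x - (M e - N e) ∈ N '' Icc f' x :=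
    intermediate_value_Icc (hf'0.trans h0).le h.contN.continuousOn ⟨by linarith, by linarith⟩
  have hflx : fl < x := by
    refine lt_of_le_of_ne hfl.2 fun heq => ?_
    rw [heq] at hNfl
    linarith
  have hflB : fl ∈ B := h.ordConnected.out hf'B hxB hfl
  obtain ⟨g', hg'B, hg'e, hg'⟩ := h.small (M x - N x) (by linarith)
  have contW : Continuous fun g => M g - N g := h.contM.sub h.contN
  -- `gh` is the upper endpoint at which the mass equation returns `f = x`: the surplus of `μ` over
  -- `ν` on `(x, e)` has been used up by the deficit on `(e, gh)`.
  obtain ⟨gh, hgh, hWgh⟩ : M x - N x ∈ (fun g => M g - N g) '' Icc e g' :=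
    intermediate_value_Icc' hg'e.le contW.continuousOn ⟨hg'.le, by linarith⟩
  simp only at hWgh
  have hghB : gh ∈ B := h.ordConnected.out h.e_mem hg'B hgh
  have hegh : e < gh := by
    refine lt_of_le_of_ne hgh.1 fun heq => ?_
    rw [← heq] at hWgh
    linarith
  have hsub : Icc fl x ⊆ B := fun z hz => h.ordConnected.out hflB hxB hz
  obtain ⟨k, hkc, hk⟩ := exists_continuousOn_inverse h.contN hflx.le (h.strictMonoOn_N.mono hsub)
  have hmem : ∀ g ∈ Icc e gh, M x - (M g - N g) ∈ Icc (N fl) (N x) := by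
    intro g hg
    have hgB : g ∈ B := h.ordConnected.out h.e_mem hghB hg
    have l1 : M g - N g ≤ M e - N e := by
      rcases hg.1.eq_or_lt with rfl | hlt
      · exact le_rfl
      · exact (h.W_anti le_rfl hlt hgB).le
    have l2 : M gh - N gh ≤ M g - N g := by
      rcases hg.2.eq_or_lt with rfl | hlt
      · exact le_rfl
      · exact (h.W_anti hg.1 hlt hghB).le
    exact ⟨by linarith, by linarith⟩
  set Φ : ℝ → ℝ := fun g => M₁ g - N₁ g - (M₁ x - N₁ (k (M x - (M g - N g)))) with hΦ
  have hΦc : ContinuousOn Φ (Icc e gh) := by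
    refine (h.contM₁.sub h.contN₁).continuousOn.sub (continuousOn_const.sub ?_)
    refine h.contN₁.comp_continuousOn ?_
    exact hkc.comp (continuous_const.sub contW).continuousOn hmem
  have inj := h.strictMonoOn_N.injOn
  have hke : k (M x - (M e - N e)) = fl := by
    have := hk _ (hmem e ⟨le_rfl, hegh.le⟩)
    exact inj (hsub this.1) hflB (by rw [this.2, hNfl])
  have hkh : k (M x - (M gh - N gh)) = x := by
    have := hk _ (hmem gh ⟨hegh.le, le_rfl⟩)
    exact inj (hsub this.1) hxB (by rw [this.2, hWgh]; ring)
  -- At `g = e` the balance is between `μ - ν` on `(x, e)` and `ν` on `(fl, x)`. At `gh` it is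
  -- between `μ - ν` on `(x, e)` and `ν - μ` on `(e, gh)`, which gives the opposite sign.
  have hΦe : 0 < Φ e := by
    simp only [hΦ]
    rw [hke]
    obtain ⟨n1, n2, n3⟩ := h.N_bary fl hflB x hxB hflx
    have : N x - N fl = M e - N e - (M x - N x) := by linarith
    rw [this] at n3
    linarith
  have hΦh : Φ gh < 0 := by
    simp only [hΦ]
    rw [hkh]
    obtain ⟨n1, n2, n3⟩ := h.W_out e gh le_rfl hegh hghB
    simp only [Pi.sub_apply] at n1 n2 n3
    have : N gh - M gh - (N e - M e) = M e - N e - (M x - N x) := by linarith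
    rw [this] at n2
    linarith
  obtain ⟨g, hg, hg0⟩ : (0 : ℝ) ∈ Φ '' Icc e gh :=
    intermediate_value_Icc' hegh.le hΦc ⟨hΦh.le, hΦe.le⟩
  have hgB : g ∈ B := h.ordConnected.out h.e_mem hghB hg
  have hggh : g < gh := by
    refine lt_of_le_of_ne hg.2 fun heq => ?_
    rw [heq] at hg0
    linarith
  have hkg := hk _ (hmem g hg)
  have hWg := h.W_anti hg.1 hggh hghB
  refine ⟨k (M x - (M g - N g)), g, hsub hkg.1, hgB, ?_, hx.trans_le hg.1, ?_, ?_⟩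
  · refine lt_of_le_of_ne hkg.1.2 fun heq => ?_
    have := hkg.2
    rw [heq] at this
    linarith
  · rw [hkg.2]; ring
  · simp only [hΦ] at hg0
    linarith

/-- With `f = 0` fixed, the mass equation determines `x` from `g`, and the mean equation is solved
for `g`. At `e` the defect is positive by the usual barycentre comparison. At a point provided by
`neg` it is negative, because the first moment of `μ` on `(0, x)` is positive. -/
theorem exists_pair_zero (h : CurtainFns M M₁ N N₁ B e) :
    ∃ x g, 0 < x ∧ x < e ∧ CurtainPair M M₁ N N₁ B x 0 g := by
  obtain ⟨g₁, hg₁B, hg₁e, hg₁⟩ := h.neg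
  obtain ⟨k, hkc, hk⟩ := exists_continuousOn_inverse h.contM h.e_pos.le h.strictMonoOn_M
  rw [h.M_zero] at hkc hk
  have hN := (h.N_bary 0 h.zero_mem e h.e_mem h.e_pos).1
  rw [h.N_zero] at hN
  have hmem : ∀ g ∈ Icc e g₁, M g - N g ∈ Icc 0 (M e) := by
    intro g hg
    have hgB : g ∈ B := h.ordConnected.out h.e_mem hg₁B hg
    have l1 : M g - N g ≤ M e - N e := by
      rcases hg.1.eq_or_lt with rfl | hlt
      · exact le_rfl
      · exact (h.W_anti le_rfl hlt hgB).le
    exact ⟨(h.pos g hgB hg.1).le, by linarith⟩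
  have contW : Continuous fun g => M g - N g := h.contM.sub h.contN
  set Φ : ℝ → ℝ := fun g => M₁ g - N₁ g - M₁ (k (M g - N g)) with hΦ
  have hΦc : ContinuousOn Φ (Icc e g₁) := by
    refine (h.contM₁.sub h.contN₁).continuousOn.sub ?_
    exact h.contM₁.comp_continuousOn (hkc.comp contW.continuousOn hmem)
  have bounds : ∀ g ∈ Icc e g₁, 0 < k (M g - N g) ∧ k (M g - N g) < e := by
    intro g hg
    have hgB : g ∈ B := h.ordConnected.out h.e_mem hg₁B hg
    obtain ⟨⟨c1, c2⟩, c3⟩ := hk _ (hmem g hg)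
    have hpos := h.pos g hgB hg.1
    constructor
    · refine lt_of_le_of_ne c1 fun heq => ?_
      rw [← heq, h.M_zero] at c3
      linarith
    · refine lt_of_le_of_ne c2 fun heq => ?_
      rw [heq] at c3
      have l1 : M g - N g ≤ M e - N e := by
        rcases hg.1.eq_or_lt with h1 | hlt
        · rw [← h1]
        · exact (h.W_anti le_rfl hlt hgB).le
      linarith
  have hΦe : 0 < Φ e := by
    have hI : e ∈ Icc e g₁ := ⟨le_rfl, hg₁e.le⟩
    obtain ⟨b1, b2⟩ := bounds e hI
    obtain ⟨-, hMx⟩ := hk _ (hmem e hI)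
    simp only [hΦ]
    set x := k (M e - N e)
    obtain ⟨w1, w2, w3⟩ := h.W_in x e b1.le b2 le_rfl
    obtain ⟨n1, n2, n3⟩ := h.N_bary 0 h.zero_mem x (h.mem_of_Icc b1.le b2.le) b1
    simp only [Pi.sub_apply] at w1 w2 w3
    rw [h.N_zero, h.N₁_zero] at n3
    have : M e - N e - (M x - N x) = N x - 0 := by linarith
    rw [this] at w2
    linarith
  have hΦ1 : Φ g₁ < 0 := by
    have hI : g₁ ∈ Icc e g₁ := ⟨hg₁e.le, le_rfl⟩
    obtain ⟨b1, b2⟩ := bounds g₁ hI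
    obtain ⟨m1, m2, m3⟩ := h.M_bary 0 _ le_rfl b1 b2.le
    rw [h.M₁_zero] at m2
    simp only [hΦ]
    linarith
  obtain ⟨g, hg, hg0⟩ : (0 : ℝ) ∈ Φ '' Icc e g₁ :=
    intermediate_value_Icc' hg₁e.le hΦc ⟨hΦ1.le, hΦe.le⟩
  obtain ⟨b1, b2⟩ := bounds g hg
  obtain ⟨-, hMx⟩ := hk _ (hmem g hg)
  have hgB : g ∈ B := h.ordConnected.out h.e_mem hg₁B hg
  refine ⟨k (M g - N g), g, b1, b2, h.zero_mem, hgB, b1, b2.trans_le hg.1, ?_, ?_⟩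
  · rw [hMx, h.N_zero]; ring
  · simp only [hΦ] at hg0
    rw [h.N₁_zero]
    linarith

/-! ### Continuity and range of the curtain endpoints -/

section Family

variable {F G : ℝ → ℝ}

/-- By monotonicity and the mass equation, the increments of `N ∘ F` and the decrements of `(N - M)
∘ G` are non-negative and add up to the increment of `M`. Each is therefore bounded by it, and
continuity follows from that of `M`. -/
theorem N_comp_increment (h : CurtainFns M M₁ N N₁ B e)
    (hFG : ∀ x, 0 < x → x < e → CurtainPair M M₁ N N₁ B x (F x) (G x)) {x x' : ℝ} (h0 : 0 < x)
    (hxx : x ≤ x') (hx' : x' < e) : N (F x) ≤ N (F x') ∧ N (F x') - N (F x) ≤ M x' - M x ∧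
      N (G x) - M (G x) ≥ N (G x') - M (G x') ∧
      (N (G x) - M (G x)) - (N (G x') - M (G x')) ≤ M x' - M x := by
  rcases hxx.eq_or_lt with rfl | hlt
  · simp
  · have hp := hFG x h0 (hlt.trans hx')
    have hp' := hFG x' (h0.trans hlt) hx'
    obtain ⟨l1, l2⟩ := h.pair_lt h0 hlt hx' hp hp'
    have a1 := h.strictMonoOn_N hp.f_mem hp'.f_mem l1
    have a2 := h.W_anti (h.e_lt_g (h0.trans hlt) hx' hp').le l2 hp.g_mem
    have e1 := hp.mass
    have e1' := hp'.mass
    exact ⟨a1.le, by linarith, by linarith, by linarith⟩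

theorem continuousOn_comp (h : CurtainFns M M₁ N N₁ B e)
    (hFG : ∀ x, 0 < x → x < e → CurtainPair M M₁ N N₁ B x (F x) (G x)) :
    ContinuousOn (fun x => N (F x)) (Ioo 0 e) ∧
      ContinuousOn (fun x => N (G x) - M (G x)) (Ioo 0 e) := by
  have aux : ∀ φ : ℝ → ℝ, (∀ x ∈ Ioo 0 e, ∀ y ∈ Ioo 0 e, |φ y - φ x| ≤ |M y - M x|) →
      ContinuousOn φ (Ioo 0 e) := by
    intro φ hφ x hx
    have h1 : Filter.Tendsto (fun y => |M y - M x|) (nhdsWithin x (Ioo 0 e)) (nhds 0) := by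
      have : Continuous fun y => |M y - M x| := (h.contM.sub continuous_const).abs
      have h2 := this.tendsto x
      simp only [sub_self, abs_zero] at h2
      exact h2.mono_left nhdsWithin_le_nhds
    refine tendsto_iff_dist_tendsto_zero.2 (squeeze_zero' (Filter.Eventually.of_forall
      fun _ => dist_nonneg) ?_ h1)
    filter_upwards [self_mem_nhdsWithin] with y hy
    exact hφ x hx y hy
  constructor
  · refine aux _ fun x hx y hy => ?_
    rcases le_total x y with hxy | hxy
    · obtain ⟨a1, a2, a3, a4⟩ := h.N_comp_increment hFG hx.1 hxy hy.2
      rw [abs_of_nonneg (by linarith)]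
      exact a2.trans (le_abs_self _)
    · obtain ⟨a1, a2, a3, a4⟩ := h.N_comp_increment hFG hy.1 hxy hx.2
      rw [abs_sub_comm, abs_of_nonneg (by linarith), abs_sub_comm]
      exact a2.trans (le_abs_self _)
  · refine aux _ fun x hx y hy => ?_
    rcases le_total x y with hxy | hxy
    · obtain ⟨a1, a2, a3, a4⟩ := h.N_comp_increment hFG hx.1 hxy hy.2
      rw [abs_sub_comm, abs_of_nonneg (by linarith)]
      exact a4.trans (le_abs_self _)
    · obtain ⟨a1, a2, a3, a4⟩ := h.N_comp_increment hFG hy.1 hxy hx.2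
      rw [abs_of_nonneg (by linarith), abs_sub_comm]
      exact a4.trans (le_abs_self _)

theorem continuousOn_F (h : CurtainFns M M₁ N N₁ B e)
    (hFG : ∀ x, 0 < x → x < e → CurtainPair M M₁ N N₁ B x (F x) (G x)) :
    ContinuousOn F (Ioo 0 e) := fun x hx => by
  refine (continuousAt_of_comp_strictMonoOn h.isOpen h.strictMonoOn_N ?_
    (((h.continuousOn_comp hFG).1).continuousAt (Ioo_mem_nhds hx.1 hx.2))).continuousWithinAt
  filter_upwards [Ioo_mem_nhds hx.1 hx.2] with y hy using (hFG y hy.1 hy.2).f_mem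

theorem continuousOn_G (h : CurtainFns M M₁ N N₁ B e)
    (hFG : ∀ x, 0 < x → x < e → CurtainPair M M₁ N N₁ B x (F x) (G x)) :
    ContinuousOn G (Ioo 0 e) := fun x hx => by
  refine (continuousAt_of_comp_strictMonoOn (h.isOpen.inter isOpen_Ioi) h.strictMonoOn_neg_W ?_
    (((h.continuousOn_comp hFG).2).continuousAt (Ioo_mem_nhds hx.1 hx.2))).continuousWithinAt
  filter_upwards [Ioo_mem_nhds hx.1 hx.2] with y hy
  exact ⟨(hFG y hy.1 hy.2).g_mem, h.e_lt_g hy.1 hy.2 (hFG y hy.1 hy.2)⟩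

theorem surjOn_F (h : CurtainFns M M₁ N N₁ B e)
    (hFG : ∀ x, 0 < x → x < e → CurtainPair M M₁ N N₁ B x (F x) (G x)) {c : ℝ} (hc : 0 < c)
    (hce : c < e) : SurjOn F (Ioo c e) (Ioo (F c) e) := by
  intro z hz
  have hcp := hFG c hc hce
  have hzB : z ∈ B := h.ordConnected.out hcp.f_mem h.e_mem ⟨hz.1.le, hz.2.le⟩
  have hNz := h.strictMonoOn_N hzB h.e_mem hz.2
  -- Since `G x₁ > e`, the mass equation gives `N (F x₁) > M x₁ - (M e - N e)`. The choice of `x₁`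
  -- makes this exceed `N z`, so `F` passes `z` before `x₁`.
  obtain ⟨x₁, hx₁, hM⟩ : ∃ x₁ ∈ Ioo c e, M e - (N e - N z) < M x₁ := by
    have h1 := (h.contM.tendsto e).mono_left (nhdsWithin_le_nhds (s := Iio e))
    have h2 := h1.eventually (lt_mem_nhds (show M e - (N e - N z) < M e by linarith))
    exact ((h2.and (Ioo_mem_nhdsLT hce)).exists).imp fun x hx => ⟨hx.2, hx.1⟩
  have hp1 := hFG x₁ (hc.trans hx₁.1) hx₁.2
  have hW := h.W_anti le_rfl (h.e_lt_g (hc.trans hx₁.1) hx₁.2 hp1) hp1.g_mem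
  have e1 := hp1.mass
  obtain ⟨x, hx, hxz⟩ : N z ∈ (fun x => N (F x)) '' Icc c x₁ := by
    refine intermediate_value_Icc hx₁.1.le ((h.continuousOn_comp hFG).1.mono fun y hy =>
      ⟨hc.trans_le hy.1, hy.2.trans_lt hx₁.2⟩) ⟨?_, ?_⟩
    · exact (h.strictMonoOn_N hcp.f_mem hzB hz.1).le
    · linarith
  have hFx : F x = z :=
    h.strictMonoOn_N.injOn (hFG x (hc.trans_le hx.1) (hx.2.trans_lt hx₁.2)).f_mem hzB hxz
  refine ⟨x, ⟨lt_of_le_of_ne hx.1 fun heq => ?_, hx.2.trans_lt hx₁.2⟩, hFx⟩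
  rw [← heq] at hFx
  exact hz.1.ne hFx

theorem surjOn_G (h : CurtainFns M M₁ N N₁ B e)
    (hFG : ∀ x, 0 < x → x < e → CurtainPair M M₁ N N₁ B x (F x) (G x)) {c : ℝ} (hc : 0 < c)
    (hce : c < e) : SurjOn G (Ioo c e) (Ioo e (G c)) := by
  intro z hz
  have hcp := hFG c hc hce
  have hzB : z ∈ B := h.ordConnected.out h.e_mem hcp.g_mem ⟨hz.1.le, hz.2.le⟩
  have hWz := h.W_anti le_rfl hz.1 hzB
  -- Since `F x₁ < x₁`, the value of `M - N` at `G x₁` exceeds its value at `x₁`, hence its value at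
  -- `z`. As `M - N` decreases beyond `e`, `G` has come below `z`.
  obtain ⟨x₁, hx₁, hM⟩ : ∃ x₁ ∈ Ioo c e, M z - N z < M x₁ - N x₁ := by
    have h1 := ((h.contM.sub h.contN).tendsto e).mono_left (nhdsWithin_le_nhds (s := Iio e))
    have h2 := h1.eventually (lt_mem_nhds hWz)
    exact ((h2.and (Ioo_mem_nhdsLT hce)).exists).imp fun x hx => ⟨hx.2, hx.1⟩
  have hp1 := hFG x₁ (hc.trans hx₁.1) hx₁.2
  have hN := h.strictMonoOn_N hp1.f_mem
    (h.mem_of_Icc (hc.trans hx₁.1).le hx₁.2.le) hp1.f_lt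
  have e1 := hp1.mass
  obtain ⟨x, hx, hxz⟩ : N z - M z ∈ (fun x => N (G x) - M (G x)) '' Icc c x₁ := by
    refine intermediate_value_Icc' hx₁.1.le ((h.continuousOn_comp hFG).2.mono fun y hy =>
      ⟨hc.trans_le hy.1, hy.2.trans_lt hx₁.2⟩) ⟨?_, ?_⟩
    · linarith
    · have := h.W_anti hz.1.le hz.2 hcp.g_mem
      linarith
  have hpx := hFG x (hc.trans_le hx.1) (hx.2.trans_lt hx₁.2)
  have hGx : G x = z :=
    h.strictMonoOn_neg_W.injOn
      ⟨hpx.g_mem, h.e_lt_g (hc.trans_le hx.1) (hx.2.trans_lt hx₁.2) hpx⟩ ⟨hzB, hz.1⟩ hxz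
  refine ⟨x, ⟨lt_of_le_of_ne hx.1 fun heq => ?_, hx.2.trans_lt hx₁.2⟩, hGx⟩
  rw [← heq] at hGx
  exact hz.2.ne' hGx

theorem F_strictMonoOn (h : CurtainFns M M₁ N N₁ B e)
    (hFG : ∀ x, 0 < x → x < e → CurtainPair M M₁ N N₁ B x (F x) (G x)) :
    StrictMonoOn F (Ioo 0 e) := fun x hx y hy hxy =>
  (h.pair_lt hx.1 hxy hy.2 (hFG x hx.1 hx.2) (hFG y hy.1 hy.2)).1

theorem G_strictAntiOn (h : CurtainFns M M₁ N N₁ B e)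
    (hFG : ∀ x, 0 < x → x < e → CurtainPair M M₁ N N₁ B x (F x) (G x)) :
    StrictAntiOn G (Ioo 0 e) := fun x hx y hy hxy =>
  (h.pair_lt hx.1 hxy hy.2 (hFG x hx.1 hx.2) (hFG y hy.1 hy.2)).2

end Family

end CurtainFns

/-! ### The Hobson-Klimmek equations in terms of primitives -/

/-- What the analysis of the Hobson-Klimmek equations uses: `m`, `m₁` are the primitives from `-γ`
of the source density and its first moment, `K`, `K₁` those from `γ` of the target density, which is
symmetric and has mass `T` and first moment `T₁` on `(γ, ∞)`, where it is carried by `S`. -/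
structure HKFns (m m₁ K K₁ : ℝ → ℝ) (S : Set ℝ) (γ a T T₁ : ℝ) : Prop where
  contm : Continuous m
  contK : Continuous K
  contK₁ : Continuous K₁
  isOpen : IsOpen S
  γ_pos : 0 < γ
  γ_le : γ ≤ a
  gt_a : ∀ z ∈ S, a < z
  mem_S : ∀ z, a < z → ∀ w ∈ S, z ≤ w → z ∈ S
  K_a : K a = 0
  K_bary : ∀ p ∈ S, ∀ q ∈ S, p < q → Bary K K₁ p q
  K_low : ∀ z, γ ≤ z → 0 ≤ K z ∧ γ * K z ≤ K₁ z
  K_high : ∀ z, γ ≤ z → K z ≤ T ∧ γ * (T - K z) ≤ T₁ - K₁ z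
  K_eq_zero : ∀ z, γ ≤ z → K z = 0 → K₁ z = 0
  K_eq_top : ∀ z, γ ≤ z → K z = T → K₁ z = T₁
  mem_of_K : ∀ z, γ ≤ z → 0 < K z → K z < T → z ∈ S
  small : ∀ ε, 0 < ε → ∃ B ∈ S, T - K B < ε ∧ T₁ - K₁ B < ε
  m_low : m (-γ) = 0
  m_high : m γ = 2 * T
  m_incr : ∀ x x', -γ ≤ x → x ≤ x' → x' ≤ γ → 0 ≤ m x' - m x ∧
    -(γ * (m x' - m x)) ≤ m₁ x' - m₁ x ∧ m₁ x' - m₁ x ≤ γ * (m x' - m x)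
  m_strict : ∀ x, -γ < x → x < γ → 0 < m x ∧ m x < 2 * T ∧ m₁ x ≤ 0 ∧ -m₁ x < γ * m x ∧
    -m₁ x < γ * (2 * T - m x)

/-- The Hobson-Klimmek equations in terms of primitives, with `p` the reflected lower point. -/
structure HKSol (m m₁ K K₁ : ℝ → ℝ) (γ T T₁ x p q : ℝ) : Prop where
  le_p : γ ≤ p
  le_q : γ ≤ q
  mass : m x = T - K q + K p
  mean : m₁ x = T₁ - K₁ q - K₁ p

namespace HKFns

variable {m m₁ K K₁ : ℝ → ℝ} {S : Set ℝ} {γ a T T₁ : ℝ}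

/-- If `K` took one of its extreme values at `p` or `q`, all the target mass of one equation would
lie on one side. Its first moment would then be at least `γ` times its mass in absolute value,
against the bounds in `m_strict`. -/
theorem mem (h : HKFns m m₁ K K₁ S γ a T T₁) {x p q : ℝ} (h1 : -γ < x) (h2 : x < γ)
    (hs : HKSol m m₁ K K₁ γ T T₁ x p q) : p ∈ S ∧ q ∈ S := by
  obtain ⟨a1, a2, a3, a4, a5⟩ := h.m_strict x h1 h2
  have e1 := hs.mass
  have e2 := hs.mean
  obtain ⟨p1, p2⟩ := h.K_low p hs.le_p
  obtain ⟨p3, p4⟩ := h.K_high p hs.le_p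
  obtain ⟨q1, q2⟩ := h.K_low q hs.le_q
  obtain ⟨q3, q4⟩ := h.K_high q hs.le_q
  have hγ := h.γ_pos
  have i1 := mul_pos hγ a1
  have i2 : 0 < γ * (2 * T - m x) := mul_pos hγ (by linarith)
  constructor
  · refine h.mem_of_K p hs.le_p (lt_of_le_of_ne p1 fun heq => ?_) (lt_of_le_of_ne p3 fun heq => ?_)
    · have := h.K_eq_zero p hs.le_p heq.symm
      have e : T - K q = m x := by linarith
      rw [e] at q4
      linarith
    · have := h.K_eq_top p hs.le_p heq
      have e : K q = 2 * T - m x := by linarith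
      rw [e] at q2
      linarith
  · refine h.mem_of_K q hs.le_q (lt_of_le_of_ne q1 fun heq => ?_) (lt_of_le_of_ne q3 fun heq => ?_)
    · have := h.K_eq_zero q hs.le_q heq.symm
      have e : T - K p = 2 * T - m x := by linarith
      rw [e] at p4
      linarith
    · have := h.K_eq_top q hs.le_q heq
      have e : K p = m x := by linarith
      rw [e] at p2
      linarith

theorem strictMonoOn_K (h : HKFns m m₁ K K₁ S γ a T T₁) : StrictMonoOn K S :=
  fun p hp q hq hpq => by have := (h.K_bary p hp q hq hpq).1; linarith

theorem K_pos (h : HKFns m m₁ K K₁ S γ a T T₁) {z : ℝ} (hz : z ∈ S) : 0 < K z := by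
  obtain ⟨w, hw1, hw2⟩ := exists_between (h.gt_a z hz)
  have hw := h.mem_S w hw1 z hz hw2.le
  have := h.strictMonoOn_K hw hz hw2
  linarith [(h.K_low w (h.γ_le.trans hw1.le)).1]

theorem K_lt (h : HKFns m m₁ K K₁ S γ a T T₁) {z : ℝ} (hz : z ∈ S) : K z < T := by
  obtain ⟨l, u, hlu, hsub⟩ := mem_nhds_iff_exists_Ioo_subset.1 (h.isOpen.mem_nhds hz)
  obtain ⟨w, hw1, hw2⟩ := exists_between hlu.2
  have hw : w ∈ S := hsub ⟨hlu.1.trans hw1, hw2⟩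
  have := h.strictMonoOn_K hz hw hw1
  linarith [(h.K_high w (h.γ_le.trans (h.gt_a w hw).le)).1]

theorem strictMonoOn_K_Icc (h : HKFns m m₁ K K₁ S γ a T T₁) {B : ℝ} (hB : B ∈ S) :
    StrictMonoOn K (Icc a B) := by
  intro p hp q hq hpq
  have hqS := h.mem_S q (hp.1.trans_lt hpq) B hB hq.2
  rcases hp.1.eq_or_lt with rfl | hlt
  · rw [h.K_a]; exact h.K_pos hqS
  · exact h.strictMonoOn_K (h.mem_S p hlt B hB hp.2) hqS hpq

/-- If `p' < p`, the mass equation gives `q' < q`, and the first moment of the source on `(x, x')`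
would exceed `γ` times its mass. If `q < q'`, then `p < p'`, and it would be less than `-γ` times
its mass. Both are impossible for a measure on `(-γ, γ)`. -/
theorem sol_mono (h : HKFns m m₁ K K₁ S γ a T T₁) {x p q x' p' q' : ℝ} (h1 : -γ < x)
    (hxx : x ≤ x') (h2 : x' < γ) (hs : HKSol m m₁ K K₁ γ T T₁ x p q)
    (hs' : HKSol m m₁ K K₁ γ T T₁ x' p' q') : p ≤ p' ∧ q' ≤ q := by
  obtain ⟨hp, hq⟩ := h.mem h1 (hxx.trans_lt h2) hs
  obtain ⟨hp', hq'⟩ := h.mem (h1.trans_le hxx) h2 hs'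
  obtain ⟨i1, i2, i3⟩ := h.m_incr x x' h1.le hxx h2.le
  have e1 := hs.mass
  have e2 := hs.mean
  have e1' := hs'.mass
  have e2' := hs'.mean
  have hγ := h.γ_pos
  constructor
  · by_contra! hlt
    obtain ⟨a1, a2, a3⟩ := h.K_bary p' hp' p hp hlt
    have hqq : q' < q := by
      by_contra! hle
      have := h.strictMonoOn_K.monotoneOn hq hq' hle
      linarith
    obtain ⟨b1, b2, b3⟩ := h.K_bary q' hq' q hq hqq
    have j1 : γ * (K p - K p') ≤ p' * (K p - K p') := mul_le_mul_of_nonneg_right hs'.le_p a1.le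
    have j2 : γ * (K q - K q') ≤ q' * (K q - K q') := mul_le_mul_of_nonneg_right hs'.le_q b1.le
    have j3 : γ * (m x' - m x) ≤ γ * (K p - K p') + γ * (K q - K q') := by
      rw [← mul_add]; exact mul_le_mul_of_nonneg_left (by linarith) hγ.le
    linarith
  · by_contra! hlt
    obtain ⟨b1, b2, b3⟩ := h.K_bary q hq q' hq' hlt
    have hpp : p < p' := by
      by_contra! hle
      have := h.strictMonoOn_K.monotoneOn hp' hp hle
      linarith
    obtain ⟨a1, a2, a3⟩ := h.K_bary p hp p' hp' hpp
    have j1 : γ * (K p' - K p) ≤ p * (K p' - K p) := mul_le_mul_of_nonneg_right hs.le_p a1.le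
    have j2 : γ * (K q' - K q) ≤ q * (K q' - K q) := mul_le_mul_of_nonneg_right hs.le_q b1.le
    have j3 : γ * (m x' - m x) ≤ γ * (K p' - K p) + γ * (K q' - K q) := by
      rw [← mul_add]; exact mul_le_mul_of_nonneg_left (by linarith) hγ.le
    linarith

theorem exists_sol (h : HKFns m m₁ K K₁ S γ a T T₁) {x : ℝ} (h1 : -γ < x) (h2 : x < γ) :
    ∃ p q, HKSol m m₁ K K₁ γ T T₁ x p q := by
  obtain ⟨a1, a2, a3, a4, a5⟩ := h.m_strict x h1 h2
  have hγ := h.γ_pos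
  -- `gap` is the slack in the two strict moment bounds of `m_strict`. The truncation point `B` is
  -- taken so far out that the target mass and moment beyond it do not use up this slack; on `[a,
  -- B]` the function `K` has a continuous inverse.
  set gap := min (γ * m x + m₁ x) (γ * (2 * T - m x) + m₁ x) with hgap
  have hgap0 : 0 < gap := lt_min (by linarith) (by linarith)
  obtain ⟨B, hB, hB1, hB2⟩ := h.small (gap / (2 * (1 + γ))) (by positivity)
  have haB := h.gt_a B hB
  have hBγ : γ ≤ B := h.γ_le.trans haB.le
  have hsm : T₁ - K₁ B + γ * (T - K B) < gap := by
    have h3 : γ * (T - K B) ≤ γ * (gap / (2 * (1 + γ))) :=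
      mul_le_mul_of_nonneg_left hB1.le hγ.le
    have h4 : gap / (2 * (1 + γ)) + γ * (gap / (2 * (1 + γ))) = gap / 2 := by
      field_simp
    linarith
  have g1 : T₁ - K₁ B + γ * (T - K B) < γ * m x + m₁ x := hsm.trans_le (min_le_left _ _)
  have g2 : T₁ - K₁ B + γ * (T - K B) < γ * (2 * T - m x) + m₁ x :=
    hsm.trans_le (min_le_right _ _)
  obtain ⟨t1, t2⟩ := h.K_high B hBγ
  have l1 : T - K B ≤ m x := by
    have : 0 ≤ γ * (T - K B) := mul_nonneg hγ.le (by linarith)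
    exact le_of_mul_le_mul_left (a := γ) (by linarith) hγ
  have l2 : T - K B ≤ 2 * T - m x := by
    have : 0 ≤ γ * (T - K B) := mul_nonneg hγ.le (by linarith)
    exact le_of_mul_le_mul_left (a := γ) (by linarith) hγ
  have hKB := h.K_pos hB
  obtain ⟨k, hkc, hk⟩ := exists_continuousOn_inverse h.contK haB.le (h.strictMonoOn_K_Icc hB)
  rw [h.K_a] at hkc hk
  -- The unknown is `y = K q`. The mass equation makes `K p = m x - T + y`, and `[lo, hi]` is the
  -- range in which both levels lie in `[0, K B]`.
  set lo := max 0 (T - m x) with hlo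
  set hi := min (K B) (K B + T - m x) with hhi
  have hlohi : lo ≤ hi := le_min (max_le hKB.le (by linarith)) (max_le (by linarith) (by linarith))
  have mem1 : ∀ y ∈ Icc lo hi, y ∈ Icc 0 (K B) := fun y hy =>
    ⟨(le_max_left _ _).trans hy.1, hy.2.trans (min_le_left _ _)⟩
  have mem2 : ∀ y ∈ Icc lo hi, m x - T + y ∈ Icc 0 (K B) := fun y hy =>
    ⟨by linarith [(le_max_right 0 (T - m x)).trans hy.1],
      by linarith [hy.2.trans (min_le_right (K B) (K B + T - m x))]⟩
  set Φ : ℝ → ℝ := fun y => T₁ - K₁ (k y) - K₁ (k (m x - T + y)) - m₁ x with hΦ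
  have hΦc : ContinuousOn Φ (Icc lo hi) := by
    refine ((continuousOn_const.sub (h.contK₁.comp_continuousOn (hkc.mono mem1))).sub ?_).sub
      continuousOn_const
    exact h.contK₁.comp_continuousOn
      (hkc.comp (continuous_const.add continuous_id).continuousOn mem2)
  -- At each end of the range one level is extreme. At `lo` one of them is zero, and the sign comes
  -- from `m₁ x ≤ 0`. At `hi` one of them is `K B`, and the sign comes from the slack.
  have hΦlo : 0 ≤ Φ lo := by
    have hI : lo ∈ Icc lo hi := ⟨le_rfl, hlohi⟩
    obtain ⟨⟨c1, -⟩, c2⟩ := hk _ (mem1 lo hI)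
    obtain ⟨⟨d1, -⟩, d2⟩ := hk _ (mem2 lo hI)
    simp only [hΦ]
    rcases le_total (T - m x) 0 with hle | hle
    · have hl : lo = 0 := max_eq_left hle
      have := h.K_eq_zero _ (h.γ_le.trans c1) (by rw [c2, hl])
      have h5 := (h.K_high _ (h.γ_le.trans d1)).2
      rw [d2, hl] at h5
      rw [hl] at this ⊢
      have h6 : 0 ≤ γ * (T - (m x - T + 0)) := mul_nonneg hγ.le (by linarith)
      linarith
    · have hl : lo = T - m x := max_eq_right hle
      have := h.K_eq_zero _ (h.γ_le.trans d1) (by rw [d2, hl]; ring)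
      have h5 := (h.K_high _ (h.γ_le.trans c1)).2
      rw [c2, hl] at h5
      rw [hl] at this ⊢
      have h6 : 0 ≤ γ * (T - (T - m x)) := mul_nonneg hγ.le (by linarith)
      linarith
  have hinj := (h.strictMonoOn_K_Icc hB).injOn
  have hΦhi : Φ hi ≤ 0 := by
    have hI : hi ∈ Icc lo hi := ⟨hlohi, le_rfl⟩
    have hc := hk _ (mem1 hi hI)
    have hd := hk _ (mem2 hi hI)
    simp only [hΦ]
    rcases le_total (m x) T with hle | hle
    · have hl : hi = K B := min_eq_left (by linarith)
      rw [hl] at hc hd ⊢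
      have := hinj hc.1 ⟨haB.le, le_rfl⟩ hc.2
      have h5 := (h.K_low _ (h.γ_le.trans hd.1.1)).2
      rw [hd.2] at h5
      rw [this]
      linarith
    · have hl : hi = K B + T - m x := min_eq_right (by linarith)
      rw [hl] at hc hd ⊢
      have hd2 := hd.2
      have := hinj hd.1 ⟨haB.le, le_rfl⟩ (by rw [hd.2]; ring)
      have h5 := (h.K_low _ (h.γ_le.trans hc.1.1)).2
      rw [hc.2] at h5
      rw [this]
      linarith
  obtain ⟨y, hy, hy0⟩ : (0 : ℝ) ∈ Φ '' Icc lo hi :=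
    intermediate_value_Icc' hlohi hΦc ⟨hΦhi, hΦlo⟩
  obtain ⟨⟨c1, -⟩, c2⟩ := hk _ (mem1 y hy)
  obtain ⟨⟨d1, -⟩, d2⟩ := hk _ (mem2 y hy)
  refine ⟨k (m x - T + y), k y, h.γ_le.trans d1, h.γ_le.trans c1, ?_, ?_⟩
  · rw [c2, d2]; ring
  · simp only [hΦ] at hy0
    linarith

/-! ### Continuity and range of the Hobson-Klimmek endpoints -/

section Family

variable {p q : ℝ → ℝ}

/-- As for the curtain, two non-negative increments add up to that of `m`, so each is bounded by it.
-/
theorem K_comp_increment (h : HKFns m m₁ K K₁ S γ a T T₁)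
    (hs : ∀ x, -γ < x → x < γ → HKSol m m₁ K K₁ γ T T₁ x (p x) (q x)) {x x' : ℝ} (h1 : -γ < x)
    (hxx : x ≤ x') (h2 : x' < γ) : K (p x) ≤ K (p x') ∧ K (p x') - K (p x) ≤ m x' - m x ∧
      K (q x') ≤ K (q x) ∧ K (q x) - K (q x') ≤ m x' - m x := by
  have s := hs x h1 (hxx.trans_lt h2)
  have s' := hs x' (h1.trans_le hxx) h2
  obtain ⟨l1, l2⟩ := h.sol_mono h1 hxx h2 s s'
  obtain ⟨hp, hq⟩ := h.mem h1 (hxx.trans_lt h2) s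
  obtain ⟨hp', hq'⟩ := h.mem (h1.trans_le hxx) h2 s'
  have k1 := h.strictMonoOn_K.monotoneOn hp hp' l1
  have k2 := h.strictMonoOn_K.monotoneOn hq' hq l2
  have e1 := s.mass
  have e1' := s'.mass
  exact ⟨k1, by linarith, k2, by linarith⟩

theorem continuousOn_comp (h : HKFns m m₁ K K₁ S γ a T T₁)
    (hs : ∀ x, -γ < x → x < γ → HKSol m m₁ K K₁ γ T T₁ x (p x) (q x)) :
    ContinuousOn (fun x => K (p x)) (Ioo (-γ) γ) ∧
      ContinuousOn (fun x => K (q x)) (Ioo (-γ) γ) := by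
  have aux : ∀ φ : ℝ → ℝ, (∀ x ∈ Ioo (-γ) γ, ∀ y ∈ Ioo (-γ) γ, x ≤ y →
      |φ y - φ x| ≤ m y - m x) → ContinuousOn φ (Ioo (-γ) γ) := by
    intro φ hφ x hx
    have h1 : Filter.Tendsto (fun y => |m y - m x|) (nhdsWithin x (Ioo (-γ) γ)) (nhds 0) := by
      have : Continuous fun y => |m y - m x| := (h.contm.sub continuous_const).abs
      have h2 := this.tendsto x
      simp only [sub_self, abs_zero] at h2
      exact h2.mono_left nhdsWithin_le_nhds
    refine tendsto_iff_dist_tendsto_zero.2 (squeeze_zero' (Filter.Eventually.of_forall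
      fun _ => dist_nonneg) ?_ h1)
    filter_upwards [self_mem_nhdsWithin] with y hy
    rw [Real.dist_eq]
    rcases le_total x y with hxy | hxy
    · exact (hφ x hx y hy hxy).trans (le_abs_self _)
    · rw [abs_sub_comm, abs_sub_comm (m y)]
      exact (hφ y hy x hx hxy).trans (le_abs_self _)
  constructor
  · refine aux _ fun x hx y hy hxy => ?_
    obtain ⟨a1, a2, a3, a4⟩ := h.K_comp_increment hs hx.1 hxy hy.2
    rw [abs_of_nonneg (by linarith)]
    exact a2
  · refine aux _ fun x hx y hy hxy => ?_
    obtain ⟨a1, a2, a3, a4⟩ := h.K_comp_increment hs hx.1 hxy hy.2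
    rw [abs_sub_comm, abs_of_nonneg (by linarith)]
    exact a4

theorem exists_near (h : HKFns m m₁ K K₁ S γ a T T₁) {ε : ℝ} (hε : 0 < ε) :
    (∃ x ∈ Ioo (-γ) 0, m x < ε) ∧ ∃ x ∈ Ioo 0 γ, 2 * T - m x < ε := by
  have hγ := h.γ_pos
  constructor
  · have h1 := (h.contm.tendsto (-γ)).mono_left (nhdsWithin_le_nhds (s := Ioi (-γ)))
    have h2 := h1.eventually (gt_mem_nhds (show m (-γ) < ε by rw [h.m_low]; exact hε))
    exact ((h2.and (Ioo_mem_nhdsGT (by linarith : -γ < 0))).exists).imp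
      fun x hx => ⟨hx.2, hx.1⟩
  · have h1 := (h.contm.tendsto γ).mono_left (nhdsWithin_le_nhds (s := Iio γ))
    have h2 := h1.eventually (lt_mem_nhds (show 2 * T - ε < m γ by rw [h.m_high]; linarith))
    exact ((h2.and (Ioo_mem_nhdsLT hγ)).exists).imp fun x hx => ⟨hx.2, by linarith [hx.1]⟩

theorem surjOn_q (h : HKFns m m₁ K K₁ S γ a T T₁)
    (hs : ∀ x, -γ < x → x < γ → HKSol m m₁ K K₁ γ T T₁ x (p x) (q x)) :
    SurjOn q (Ioo (-γ) γ) S := by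
  intro z hz
  have hγ := h.γ_pos
  -- Close to `-γ` little mass has been sent, so `K (q x₁) ≥ T - m x₁` exceeds `K z`. Close to `γ`
  -- little mass is left, so `K (q x₂) ≤ 2 * T - m x₂` is below `K z`.
  obtain ⟨⟨x₁, h1, h1'⟩, -⟩ := h.exists_near (sub_pos.2 (h.K_lt hz))
  obtain ⟨-, ⟨x₂, h2, h2'⟩⟩ := h.exists_near (h.K_pos hz)
  have s1 := hs x₁ h1.1 (h1.2.trans hγ)
  have s2 := hs x₂ (by linarith [h2.1]) h2.2
  have b1 := (h.K_low _ s1.le_p).1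
  have b2 := (h.K_high _ s2.le_p).1
  have e1 := s1.mass
  have e2 := s2.mass
  obtain ⟨x, hx, hxz⟩ : K z ∈ (fun x => K (q x)) '' Icc x₁ x₂ :=
    intermediate_value_Icc' (h1.2.trans h2.1).le ((h.continuousOn_comp hs).2.mono fun y hy =>
      ⟨h1.1.trans_le hy.1, hy.2.trans_lt h2.2⟩) ⟨by linarith, by linarith⟩
  have hxI : x ∈ Ioo (-γ) γ := ⟨h1.1.trans_le hx.1, hx.2.trans_lt h2.2⟩
  exact ⟨x, hxI, h.strictMonoOn_K.injOn (h.mem hxI.1 hxI.2 (hs x hxI.1 hxI.2)).2 hz hxz⟩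

theorem surjOn_p (h : HKFns m m₁ K K₁ S γ a T T₁)
    (hs : ∀ x, -γ < x → x < γ → HKSol m m₁ K K₁ γ T T₁ x (p x) (q x)) :
    SurjOn p (Ioo (-γ) γ) S := by
  intro z hz
  have hγ := h.γ_pos
  obtain ⟨⟨x₁, h1, h1'⟩, -⟩ := h.exists_near (h.K_pos hz)
  obtain ⟨-, ⟨x₂, h2, h2'⟩⟩ := h.exists_near (sub_pos.2 (h.K_lt hz))
  have s1 := hs x₁ h1.1 (h1.2.trans hγ)
  have s2 := hs x₂ (by linarith [h2.1]) h2.2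
  have b1 := (h.K_high _ s1.le_q).1
  have b2 := (h.K_low _ s2.le_q).1
  have e1 := s1.mass
  have e2 := s2.mass
  obtain ⟨x, hx, hxz⟩ : K z ∈ (fun x => K (p x)) '' Icc x₁ x₂ :=
    intermediate_value_Icc (h1.2.trans h2.1).le ((h.continuousOn_comp hs).1.mono fun y hy =>
      ⟨h1.1.trans_le hy.1, hy.2.trans_lt h2.2⟩) ⟨by linarith, by linarith⟩
  have hxI : x ∈ Ioo (-γ) γ := ⟨h1.1.trans_le hx.1, hx.2.trans_lt h2.2⟩
  exact ⟨x, hxI, h.strictMonoOn_K.injOn (h.mem hxI.1 hxI.2 (hs x hxI.1 hxI.2)).1 hz hxz⟩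

end Family

end HKFns

/-! ### Integrals of densities -/

theorem bary_of_pos {h : ℝ → ℝ} (hi : Integrable h) (hi₁ : Integrable fun z => z * h z) (c : ℝ)
    {p q : ℝ} (hpq : p < q) (hpos : ∀ z ∈ Ioo p q, 0 < h z) :
    Bary (fun x => ∫ z in c..x, h z) (fun x => ∫ z in c..x, z * h z) p q := by
  have i0 : ∀ r s : ℝ, IntervalIntegrable h volume r s := fun r s => hi.intervalIntegrable
  have i1 : ∀ r s : ℝ, IntervalIntegrable (fun z => z * h z) volume r s :=
    fun r s => hi₁.intervalIntegrable
  have e0 := intervalIntegral.integral_interval_sub_left (i0 c q) (i0 c p)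
  have e1 := intervalIntegral.integral_interval_sub_left (i1 c q) (i1 c p)
  have j1 : ∀ r, IntervalIntegrable (fun z => r * h z) volume p q := fun r => (i0 p q).const_mul r
  unfold Bary
  rw [e0, e1, ← intervalIntegral.integral_const_mul, ← intervalIntegral.integral_const_mul]
  refine ⟨intervalIntegral.intervalIntegral_pos_of_pos_on (i0 p q) hpos hpq, ?_, ?_⟩
  · rw [← sub_pos, ← intervalIntegral.integral_sub (i1 p q) (j1 p)]
    refine intervalIntegral.intervalIntegral_pos_of_pos_on ((i1 p q).sub (j1 p)) (fun z hz => ?_) hpq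
    have := mul_pos (sub_pos.2 hz.1) (hpos z hz)
    linarith
  · rw [← sub_pos, ← intervalIntegral.integral_sub (j1 q) (i1 p q)]
    refine intervalIntegral.intervalIntegral_pos_of_pos_on ((j1 q).sub (i1 p q)) (fun z hz => ?_) hpq
    have := mul_pos (sub_pos.2 hz.2) (hpos z hz)
    linarith

theorem interval_bounds_of_nonneg {h : ℝ → ℝ} (hi : Integrable h)
    (hi₁ : Integrable fun z => z * h z) {p q : ℝ} (hpq : p ≤ q) (h0 : ∀ z, 0 ≤ h z) :
    0 ≤ ∫ z in p..q, h z ∧ p * ∫ z in p..q, h z ≤ ∫ z in p..q, z * h z ∧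
      ∫ z in p..q, z * h z ≤ q * ∫ z in p..q, h z := by
  have i0 : IntervalIntegrable h volume p q := hi.intervalIntegrable
  have i1 : IntervalIntegrable (fun z => z * h z) volume p q := hi₁.intervalIntegrable
  rw [← intervalIntegral.integral_const_mul, ← intervalIntegral.integral_const_mul]
  exact ⟨intervalIntegral.integral_nonneg hpq fun z _ => h0 z,
    intervalIntegral.integral_mono_on hpq (i0.const_mul p) i1
      fun z hz => mul_le_mul_of_nonneg_right hz.1 (h0 z),
    intervalIntegral.integral_mono_on hpq i1 (i0.const_mul q)
      fun z hz => mul_le_mul_of_nonneg_right hz.2 (h0 z)⟩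

theorem tail_bounds_of_nonneg {h : ℝ → ℝ} (hi : Integrable h)
    (hi₁ : Integrable fun z => z * h z) (p : ℝ) (h0 : ∀ z, 0 ≤ h z) :
    0 ≤ ∫ z in Ioi p, h z ∧ p * ∫ z in Ioi p, h z ≤ ∫ z in Ioi p, z * h z := by
  rw [← integral_const_mul]
  exact ⟨setIntegral_nonneg measurableSet_Ioi fun z _ => h0 z,
    setIntegral_mono_on (hi.const_mul p).integrableOn hi₁.integrableOn measurableSet_Ioi
      fun z hz => mul_le_mul_of_nonneg_right (le_of_lt hz) (h0 z)⟩

/-- A real sequence increasing to `b` lets finite and infinite right endpoints be treated together.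
-/
theorem exists_seq_real_tendsto {b : EReal} {c : ℝ} (hcb : (c : EReal) < b) :
    ∃ x : ℕ → ℝ, Monotone x ∧ (∀ n, c < x n ∧ (x n : EReal) < b) ∧
      ∀ z : ℝ, (z : EReal) < b → ∃ n, z < x n := by
  obtain ⟨v, hv, hvI, hvt⟩ := exists_seq_strictMono_tendsto' hcb
  have hcoe : ∀ n, ((v n).toReal : EReal) = v n := fun n =>
    EReal.coe_toReal (ne_top_of_lt (hvI n).2) (ne_bot_of_gt (hvI n).1)
  refine ⟨fun n => (v n).toReal, fun i j hij => ?_, fun n => ⟨?_, ?_⟩, fun z hz => ?_⟩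
  · have := hv.monotone hij
    rw [← hcoe i, ← hcoe j] at this
    exact_mod_cast this
  · have := (hvI n).1
    rw [← hcoe n] at this
    exact_mod_cast this
  · rw [hcoe n]; exact (hvI n).2
  · obtain ⟨n, hn⟩ := (hvt.eventually (lt_mem_nhds hz)).exists
    refine ⟨n, ?_⟩
    rw [← hcoe n] at hn
    exact_mod_cast hn

theorem tendsto_tail_integral {b : EReal} {x : ℕ → ℝ} (hx : Monotone x)
    (hxb : ∀ z : ℝ, (z : EReal) < b → ∃ n, z < x n) {h : ℝ → ℝ} (hi : Integrable h)
    (h0 : ∀ᵐ z : ℝ, b ≤ z → h z = 0) :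
    Filter.Tendsto (fun n => ∫ z in Ioi (x n), h z) Filter.atTop (nhds 0) := by
  have h1 := tendsto_setIntegral_of_antitone (μ := volume) (f := h) (s := fun n => Ioi (x n))
    (fun _ => measurableSet_Ioi) (fun i j hij => Ioi_subset_Ioi (hx hij)) ⟨0, hi.integrableOn⟩
  have h2 : ∫ z in ⋂ n, Ioi (x n), h z = 0 := by
    rw [← integral_zero ℝ ℝ (μ := volume.restrict (⋂ n, Ioi (x n)))]
    refine setIntegral_congr_ae (MeasurableSet.iInter fun _ => measurableSet_Ioi) ?_
    filter_upwards [h0] with z hz hzI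
    refine hz ?_
    by_contra! hlt
    obtain ⟨n, hn⟩ := hxb z hlt
    exact absurd (mem_iInter.1 hzI n) (not_lt.2 hn.le)
  rwa [h2] at h1

/-- A non-negative density with a first moment. -/
structure IsDensity (h : ℝ → ℝ) : Prop where
  measurable : Measurable h
  nonneg : ∀ z, 0 ≤ h z
  integrable : Integrable h
  integrable₁ : Integrable fun z => z * h z

/-- The measure with density `h`. -/
noncomputable def dens (h : ℝ → ℝ) : Measure ℝ := volume.withDensity fun x => ENNReal.ofReal (h x)

instance (h : ℝ → ℝ) : NullSingletonClass (dens h) := by unfold dens; infer_instance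

namespace IsDensity

variable {h : ℝ → ℝ}

theorem isFiniteMeasure (hh : IsDensity h) : IsFiniteMeasure (dens h) :=
  isFiniteMeasure_withDensity_ofReal hh.integrable.2

theorem apply (hh : IsDensity h) {A : Set ℝ} (hA : MeasurableSet A) :
    dens h A = ENNReal.ofReal (∫ z in A, h z) := by
  rw [dens, withDensity_apply _ hA, ofReal_integral_eq_lintegral_ofReal hh.integrable.integrableOn]
  exact Filter.Eventually.of_forall hh.nonneg

theorem real_apply (hh : IsDensity h) {A : Set ℝ} (hA : MeasurableSet A) :
    (dens h).real A = ∫ z in A, h z := by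
  rw [measureReal_def, hh.apply hA, ENNReal.toReal_ofReal]
  exact setIntegral_nonneg hA fun z _ => hh.nonneg z

theorem setIntegral_id (hh : IsDensity h) {A : Set ℝ} (hA : MeasurableSet A) :
    ∫ z in A, z ∂(dens h) = ∫ z in A, z * h z := by
  rw [dens, setIntegral_withDensity_eq_setIntegral_toReal_smul (by have := hh.measurable; fun_prop)
    (by simp) _ hA]
  refine integral_congr_ae (Filter.Eventually.of_forall fun z => ?_)
  simp only [smul_eq_mul]
  rw [ENNReal.toReal_ofReal (hh.nonneg z), mul_comm]

theorem integrable_id (hh : IsDensity h) : Integrable id (dens h) := by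
  rw [dens, integrable_withDensity_iff (by have := hh.measurable; fun_prop) (by simp)]
  refine hh.integrable₁.congr (Filter.Eventually.of_forall fun z => ?_)
  simp only [id]
  rw [ENNReal.toReal_ofReal (hh.nonneg z)]

theorem indicator (hh : IsDensity h) {A : Set ℝ} (hA : MeasurableSet A) :
    IsDensity (A.indicator h) where
  measurable := hh.measurable.indicator hA
  nonneg z := indicator_nonneg (fun z _ => hh.nonneg z) z
  integrable := hh.integrable.indicator hA
  integrable₁ := by
    refine (hh.integrable₁.indicator hA).congr (Filter.Eventually.of_forall fun z => ?_)
    by_cases hz : z ∈ A <;> simp [hz]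

end IsDensity

theorem dens_indicator (h : ℝ → ℝ) {A : Set ℝ} (hA : MeasurableSet A) :
    dens (A.indicator h) = (dens h).restrict A := by
  rw [dens, dens, restrict_withDensity hA, ← withDensity_indicator hA]
  congr 1
  ext x
  by_cases hx : x ∈ A <;> simp [hx]

theorem dens_ae_iff {h : ℝ → ℝ} (hm : Measurable h) {p : ℝ → Prop} :
    (∀ᵐ z ∂(dens h), p z) ↔ ∀ᵐ z : ℝ, 0 < h z → p z := by
  rw [dens, ae_withDensity_iff (by fun_prop)]
  simp [ENNReal.ofReal_eq_zero]

theorem lintegral_dens {h : ℝ → ℝ} (hm : Measurable h) (f : ℝ → ENNReal) :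
    ∫⁻ x, f x ∂(dens h) = ∫⁻ x, ENNReal.ofReal (h x) * f x := by
  rw [dens, lintegral_withDensity_eq_lintegral_mul_non_measurable _ (by fun_prop) (by simp)]
  rfl

theorem setIntegral_Ioo_eq_interval {p q : ℝ} (hpq : p ≤ q) (h : ℝ → ℝ) :
    ∫ z in Ioo p q, h z = ∫ z in p..q, h z := by
  rw [intervalIntegral.integral_of_le hpq, integral_Ioc_eq_integral_Ioo]

theorem interval_odd_part {h : ℝ → ℝ} (he : ∀ z, h (-z) = h z) (p q : ℝ) :
    ∫ z in p..q, h z = ∫ z in (-q)..(-p), h z ∧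
      ∫ z in p..q, z * h z = -∫ z in (-q)..(-p), z * h z := by
  constructor
  · rw [← intervalIntegral.integral_comp_neg]; simp only [he]
  · rw [← intervalIntegral.integral_comp_neg, ← intervalIntegral.integral_neg]
    simp only [he]
    refine intervalIntegral.integral_congr fun z _ => ?_
    simp

/-! ### The Hobson-Klimmek coupling of two symmetric densities -/

/-- Symmetric densities of equal mass, `χ` carried by `(-γ, γ)` and positive near `±γ`, and `ξ`
carried by `{z | a < |z| < b}` and positive there. -/
structure HKDens (χ ξ : ℝ → ℝ) (γ a : ℝ) (b : EReal) : Prop where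
  source : IsDensity χ
  target : IsDensity ξ
  source_even : ∀ z, χ (-z) = χ z
  target_even : ∀ z, ξ (-z) = ξ z
  γ_pos : 0 < γ
  γ_le : γ ≤ a
  a_lt : (a : EReal) < b
  source_zero : ∀ z, γ ≤ |z| → χ z = 0
  source_pos : ∃ c, c < γ ∧ ∀ z, c < z → z < γ → 0 < χ z
  target_zero_low : ∀ z, |z| ≤ a → ξ z = 0
  target_zero_high : ∀ z : ℝ, b ≤ ((|z| : ℝ) : EReal) → ξ z = 0
  target_pos : ∀ z : ℝ, a < |z| → ((|z| : ℝ) : EReal) < b → 0 < ξ z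
  mass : ∫ z in (0 : ℝ)..γ, χ z = ∫ z in Ioi γ, ξ z

namespace HKDens

variable {χ ξ : ℝ → ℝ} {γ a : ℝ} {b : EReal}

theorem target_interval_zero (h : HKDens χ ξ γ a b) {p q : ℝ} (hp : -a ≤ p) (hpq : p ≤ q)
    (hq : q ≤ a) : ∫ z in p..q, ξ z = 0 ∧ ∫ z in p..q, z * ξ z = 0 := by
  have h0 : ∀ z ∈ uIcc p q, ξ z = 0 := fun z hz => by
    rw [uIcc_of_le hpq] at hz
    exact h.target_zero_low z (abs_le.2 ⟨hp.trans hz.1, hz.2.trans hq⟩)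
  constructor
  · rw [intervalIntegral.integral_congr (g := fun _ => 0) h0]; simp
  · rw [intervalIntegral.integral_congr (g := fun _ => 0) fun z hz => by simp [h0 z hz]]; simp

theorem tail_zero (h : HKDens χ ξ γ a b) {z : ℝ} (hz : b ≤ (z : EReal)) :
    ∫ y in Ioi z, ξ y = 0 := by
  refine setIntegral_eq_zero_of_forall_eq_zero fun y hy => h.target_zero_high y (hz.trans ?_)
  exact_mod_cast (le_of_lt hy).trans (le_abs_self y)

theorem sub_interval (h : HKDens χ ξ γ a b) (z : ℝ) :
    (∫ y in Ioi γ, ξ y) - ∫ y in γ..z, ξ y = ∫ y in Ioi z, ξ y ∧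
      (∫ y in Ioi γ, y * ξ y) - ∫ y in γ..z, y * ξ y = ∫ y in Ioi z, y * ξ y := by
  have e1 := intervalIntegral.integral_interval_add_Ioi (a := γ) (b := z)
    h.target.integrable.integrableOn h.target.integrable.integrableOn
  have e2 := intervalIntegral.integral_interval_add_Ioi (a := γ) (b := z)
    h.target.integrable₁.integrableOn h.target.integrable₁.integrableOn
  exact ⟨by linarith, by linarith⟩

theorem source_total (h : HKDens χ ξ γ a b) :
    ∫ z in (-γ)..γ, χ z = 2 * ∫ z in Ioi γ, ξ z ∧ ∫ z in (-γ)..γ, z * χ z = 0 := by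
  have i0 : ∀ r s : ℝ, IntervalIntegrable χ volume r s :=
    fun r s => h.source.integrable.intervalIntegrable
  have e1 := (interval_odd_part h.source_even (-γ) 0).1
  have e2 := (interval_odd_part h.source_even (-γ) γ).2
  rw [neg_zero, neg_neg] at e1
  rw [neg_neg] at e2
  refine ⟨?_, by linarith⟩
  rw [← intervalIntegral.integral_add_adjacent_intervals (i0 (-γ) 0) (i0 0 γ), e1, h.mass]
  ring

theorem source_reflect (h : HKDens χ ξ γ a b) (x : ℝ) :
    ∫ z in (-γ)..(-x), χ z = 2 * (∫ z in Ioi γ, ξ z) - ∫ z in (-γ)..x, χ z ∧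
      ∫ z in (-γ)..(-x), z * χ z = ∫ z in (-γ)..x, z * χ z := by
  have i0 : ∀ r s : ℝ, IntervalIntegrable χ volume r s :=
    fun r s => h.source.integrable.intervalIntegrable
  have i1 : ∀ r s : ℝ, IntervalIntegrable (fun z => z * χ z) volume r s :=
    fun r s => h.source.integrable₁.intervalIntegrable
  obtain ⟨e1, e2⟩ := interval_odd_part h.source_even (-γ) (-x)
  obtain ⟨t1, t2⟩ := h.source_total
  rw [neg_neg, neg_neg] at e1 e2
  have a1 := intervalIntegral.integral_add_adjacent_intervals (i0 (-γ) x) (i0 x γ)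
  have a2 := intervalIntegral.integral_add_adjacent_intervals (i1 (-γ) x) (i1 x γ)
  exact ⟨by linarith, by linarith⟩

/-- Strictness needs mass only near `-γ`, which evenness and `source_pos` provide; elsewhere
non-negativity is enough. This matters because the density `chi3` vanishes on a whole central
interval. -/
theorem source_strict (h : HKDens χ ξ γ a b) {x : ℝ} (h1 : -γ < x) :
    0 < ∫ z in (-γ)..x, χ z ∧
      -(∫ z in (-γ)..x, z * χ z) < γ * ∫ z in (-γ)..x, χ z := by
  have i0 : ∀ r s : ℝ, IntervalIntegrable χ volume r s :=
    fun r s => h.source.integrable.intervalIntegrable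
  have i1 : ∀ r s : ℝ, IntervalIntegrable (fun z => z * χ z) volume r s :=
    fun r s => h.source.integrable₁.intervalIntegrable
  obtain ⟨c, hc, hpos⟩ := h.source_pos
  have hy : -γ < min x (-c) := lt_min h1 (by linarith)
  obtain ⟨b1, b2, -⟩ := bary_of_pos h.source.integrable h.source.integrable₁ (-γ) hy fun z hz => by
    rw [← h.source_even]
    exact hpos _ (by linarith [hz.2.trans_le (min_le_right x (-c))]) (by linarith [hz.1])
  obtain ⟨w1, w2, -⟩ := interval_bounds_of_nonneg h.source.integrable h.source.integrable₁
    (min_le_left x (-c)) h.source.nonneg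
  simp only [intervalIntegral.integral_same, sub_zero] at b1 b2
  have a1 := intervalIntegral.integral_add_adjacent_intervals (i0 (-γ) (min x (-c)))
    (i0 (min x (-c)) x)
  have a2 := intervalIntegral.integral_add_adjacent_intervals (i1 (-γ) (min x (-c)))
    (i1 (min x (-c)) x)
  rw [← a1, ← a2]
  have w3 := mul_le_mul_of_nonneg_right hy.le w1
  exact ⟨by linarith, by linarith⟩

theorem hkFns (h : HKDens χ ξ γ a b) :
    HKFns (fun x => ∫ z in (-γ)..x, χ z) (fun x => ∫ z in (-γ)..x, z * χ z)
      (fun x => ∫ z in γ..x, ξ z) (fun x => ∫ z in γ..x, z * ξ z)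
      {z : ℝ | a < z ∧ (z : EReal) < b} γ a (∫ z in Ioi γ, ξ z) (∫ z in Ioi γ, z * ξ z) where
  contm := intervalIntegral.continuous_primitive
    (fun _ _ => h.source.integrable.intervalIntegrable) _
  contK := intervalIntegral.continuous_primitive
    (fun _ _ => h.target.integrable.intervalIntegrable) _
  contK₁ := intervalIntegral.continuous_primitive
    (fun _ _ => h.target.integrable₁.intervalIntegrable) _
  isOpen := isOpen_Ioi.inter (isOpen_Iio.preimage continuous_coe_real_ereal)
  γ_pos := h.γ_pos
  γ_le := h.γ_le
  gt_a z hz := hz.1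
  mem_S z hz w hw hzw := ⟨hz, lt_of_le_of_lt (by exact_mod_cast hzw) hw.2⟩
  K_a := (h.target_interval_zero (by linarith [h.γ_pos, h.γ_le]) h.γ_le le_rfl).1
  K_bary p hp q hq hpq := bary_of_pos h.target.integrable h.target.integrable₁ γ hpq fun z hz => by
    have h0 : 0 < z := (h.γ_pos.trans_le h.γ_le).trans (hp.1.trans hz.1)
    refine h.target_pos z ?_ ?_
    · rw [abs_of_pos h0]; exact hp.1.trans hz.1
    · rw [abs_of_pos h0]; exact lt_trans (by exact_mod_cast hz.2) hq.2
  K_low z hz := by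
    obtain ⟨w1, w2, -⟩ := interval_bounds_of_nonneg h.target.integrable h.target.integrable₁ hz
      h.target.nonneg
    exact ⟨w1, w2⟩
  K_high z hz := by
    obtain ⟨e1, e2⟩ := h.sub_interval z
    obtain ⟨w1, w2⟩ := tail_bounds_of_nonneg h.target.integrable h.target.integrable₁ z
      h.target.nonneg
    rw [e1, e2]
    exact ⟨by linarith, (mul_le_mul_of_nonneg_right hz w1).trans w2⟩
  K_eq_zero z hz h0 := by
    obtain ⟨-, w2, w3⟩ := interval_bounds_of_nonneg h.target.integrable h.target.integrable₁ hz
      h.target.nonneg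
    rw [h0, mul_zero] at w2 w3
    exact le_antisymm w3 w2
  K_eq_top z hz h0 := by
    obtain ⟨e1, e2⟩ := h.sub_interval z
    rw [h0, sub_self] at e1
    have h1 := (setIntegral_eq_zero_iff_of_nonneg_ae
      (Filter.Eventually.of_forall h.target.nonneg) h.target.integrable.integrableOn).1 e1.symm
    have h2 : ∫ y in Ioi z, y * ξ y = 0 := by
      rw [← integral_zero ℝ ℝ (μ := volume.restrict (Ioi z))]
      refine integral_congr_ae (h1.mono fun y hy => ?_)
      simp [hy]
    linarith
  mem_of_K z hz h0 hT := by
    refine ⟨?_, ?_⟩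
    · by_contra! hle
      have := (h.target_interval_zero (by linarith [h.γ_pos, h.γ_le]) hz hle).1
      linarith
    · by_contra! hle
      have := h.tail_zero hle
      have := (h.sub_interval z).1
      linarith
  small ε hε := by
    obtain ⟨x, hx, hxI, hxb⟩ := exists_seq_real_tendsto h.a_lt
    have hz : ∀ᵐ z : ℝ, b ≤ z → ξ z = 0 := Filter.Eventually.of_forall fun z hz =>
      h.target_zero_high z (hz.trans (by exact_mod_cast le_abs_self z))
    have t1 := tendsto_tail_integral hx hxb h.target.integrable hz
    have t2 := tendsto_tail_integral hx hxb h.target.integrable₁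
      (hz.mono fun z hz hb => by rw [hz hb, mul_zero])
    obtain ⟨n, n1, n2⟩ := ((t1.eventually (gt_mem_nhds hε)).and
      (t2.eventually (gt_mem_nhds hε))).exists
    obtain ⟨e1, e2⟩ := h.sub_interval (x n)
    exact ⟨x n, hxI n, by rw [e1]; exact n1, by rw [e2]; exact n2⟩
  m_low := intervalIntegral.integral_same
  m_high := h.source_total.1
  m_incr x x' hx hxx hx' := by
    have e0 := intervalIntegral.integral_interval_sub_left
      (h.source.integrable.intervalIntegrable (a := -γ) (b := x'))
      (h.source.integrable.intervalIntegrable (a := -γ) (b := x))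
    have e1 := intervalIntegral.integral_interval_sub_left
      (h.source.integrable₁.intervalIntegrable (a := -γ) (b := x'))
      (h.source.integrable₁.intervalIntegrable (a := -γ) (b := x))
    obtain ⟨w1, w2, w3⟩ := interval_bounds_of_nonneg h.source.integrable h.source.integrable₁ hxx
      h.source.nonneg
    have j1 := mul_le_mul_of_nonneg_right hx w1
    have j2 := mul_le_mul_of_nonneg_right hx' w1
    rw [e0, e1]
    exact ⟨w1, by linarith, by linarith⟩
  m_strict x hx hx' := by
    obtain ⟨s1, s2⟩ := h.source_strict hx
    obtain ⟨s3, s4⟩ := h.source_strict (x := -x) (by linarith)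
    obtain ⟨r1, r2⟩ := h.source_reflect x
    have aux : ∀ y, -γ < y → y ≤ 0 → ∫ z in (-γ)..y, z * χ z ≤ 0 := fun y h1 h2 => by
      obtain ⟨w1, -, w3⟩ := interval_bounds_of_nonneg h.source.integrable h.source.integrable₁ h1.le
        h.source.nonneg
      exact w3.trans (mul_nonpos_of_nonpos_of_nonneg h2 w1)
    rw [r1] at s3 s4
    rw [r2] at s4
    refine ⟨s1, by linarith, ?_, s2, s4⟩
    rcases le_total x 0 with h0 | h0
    · exact aux x hx h0
    · rw [← r2]; exact aux (-x) (by linarith) (by linarith)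

theorem hkSol_of_isHKPair (h : HKDens χ ξ γ a b) {x : ℝ} {p : ℝ × ℝ}
    (hp : IsHKPair χ ξ γ x p) :
    HKSol (fun x => ∫ z in (-γ)..x, χ z) (fun x => ∫ z in (-γ)..x, z * χ z)
      (fun x => ∫ z in γ..x, ξ z) (fun x => ∫ z in γ..x, z * ξ z) γ
      (∫ z in Ioi γ, ξ z) (∫ z in Ioi γ, z * ξ z) x (-p.1) p.2 := by
  obtain ⟨h1, h2, h3⟩ := hp
  have e0 := h3 0 (by norm_num)
  have e1 := h3 1 le_rfl
  simp only [pow_zero, one_mul, pow_one] at e0 e1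
  obtain ⟨s1, s2⟩ := h.sub_interval p.2
  obtain ⟨o1, o2⟩ := interval_odd_part h.target_even p.1 (-γ)
  rw [neg_neg] at o1 o2
  exact ⟨by linarith, h2.le, by linarith, by linarith⟩

theorem isHKPair_of_hkSol (h : HKDens χ ξ γ a b) {x p q : ℝ} (h1 : -γ < x) (h2 : x < γ)
    (hs : HKSol (fun x => ∫ z in (-γ)..x, χ z) (fun x => ∫ z in (-γ)..x, z * χ z)
      (fun x => ∫ z in γ..x, ξ z) (fun x => ∫ z in γ..x, z * ξ z) γ
      (∫ z in Ioi γ, ξ z) (∫ z in Ioi γ, z * ξ z) x p q) : IsHKPair χ ξ γ x (-p, q) := by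
  obtain ⟨m1, m2⟩ := h.hkFns.mem h1 h2 hs
  obtain ⟨s1, s2⟩ := h.sub_interval q
  obtain ⟨o1, o2⟩ := interval_odd_part h.target_even (-p) (-γ)
  rw [neg_neg, neg_neg] at o1 o2
  have e0 := hs.mass
  have e1 := hs.mean
  refine ⟨by linarith [m1.1, h.γ_le], by linarith [m2.1, h.γ_le], fun i hi => ?_⟩
  interval_cases i
  · simp only [pow_zero, one_mul]; linarith
  · simp only [pow_one]; linarith

/-- The points charged by the Hobson-Klimmek kernel. -/
theorem epsilon_sol (h : HKDens χ ξ γ a b) {x : ℝ} (h1 : -γ < x) (h2 : x < γ) :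
    HKSol (fun x => ∫ z in (-γ)..x, χ z) (fun x => ∫ z in (-γ)..x, z * χ z)
      (fun x => ∫ z in γ..x, ξ z) (fun x => ∫ z in γ..x, z * ξ z) γ
      (∫ z in Ioi γ, ξ z) (∫ z in Ioi γ, z * ξ z) x
      (-(Classical.epsilon (IsHKPair χ ξ γ x)).1) (Classical.epsilon (IsHKPair χ ξ γ x)).2 := by
  obtain ⟨p, q, hs⟩ := h.hkFns.exists_sol h1 h2
  exact h.hkSol_of_isHKPair (Classical.epsilon_spec ⟨_, h.isHKPair_of_hkSol h1 h2 hs⟩)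

theorem epsilon_mem (h : HKDens χ ξ γ a b) {x : ℝ} (h1 : -γ < x) (h2 : x < γ) :
    (Classical.epsilon (IsHKPair χ ξ γ x)).1 < -a ∧
      a < (Classical.epsilon (IsHKPair χ ξ γ x)).2 := by
  obtain ⟨m1, m2⟩ := h.hkFns.mem h1 h2 (h.epsilon_sol h1 h2)
  exact ⟨by linarith [m1.1], m2.1⟩

theorem epsilon_antitoneOn (h : HKDens χ ξ γ a b) :
    AntitoneOn (fun x => (Classical.epsilon (IsHKPair χ ξ γ x)).1) (Ioo (-γ) γ) ∧
      AntitoneOn (fun x => (Classical.epsilon (IsHKPair χ ξ γ x)).2) (Ioo (-γ) γ) := by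
  constructor <;> intro x hx y hy hxy <;>
  obtain ⟨l1, l2⟩ := h.hkFns.sol_mono hx.1 hxy hy.2 (h.epsilon_sol hx.1 hx.2)
    (h.epsilon_sol hy.1 hy.2)
  · simp only; linarith
  · exact l2

/-- The target is split at `0` into the two branches. Both endpoints decrease in `x`, so the source
up to `x` corresponds to `(s₁ x, 0)` and `(s₂ x, ∞)`. The segment conditions are then exactly the
Hobson-Klimmek equations, because `ξ` vanishes between `-γ` and `γ`. -/
theorem lintegral_hkKernel (h : HKDens χ ξ γ a b) {A : Set ℝ} (hA : MeasurableSet A) :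
    ∫⁻ x, hkKernel χ ξ γ x A ∂(dens χ) = dens ξ A := by
  have hγ := h.γ_pos
  have hγa := h.γ_le
  have := h.source.isFiniteMeasure
  have := h.target.isFiniteMeasure
  set s₁ : ℝ → ℝ := fun x => (Classical.epsilon (IsHKPair χ ξ γ x)).1 with hs₁
  set s₂ : ℝ → ℝ := fun x => (Classical.epsilon (IsHKPair χ ξ γ x)).2 with hs₂
  obtain ⟨an₁, an₂⟩ := h.epsilon_antitoneOn
  have hsol : ∀ x, -γ < x → x < γ → HKSol (fun x => ∫ z in (-γ)..x, χ z)
      (fun x => ∫ z in (-γ)..x, z * χ z) (fun x => ∫ z in γ..x, ξ z) (fun x => ∫ z in γ..x, z * ξ z)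
      γ (∫ z in Ioi γ, ξ z) (∫ z in Ioi γ, z * ξ z) x (-s₁ x) (s₂ x) :=
    fun x h1 h2 => h.epsilon_sol h1 h2
  set S : Set ℝ := {z : ℝ | a < z ∧ (z : EReal) < b} with hS
  have hSm : MeasurableSet S := h.hkFns.isOpen.measurableSet
  have surj₂ : SurjOn s₂ (Ioo (-γ) γ) S := h.hkFns.surjOn_q hsol
  have surj₁ : SurjOn s₁ (Ioo (-γ) γ) (Neg.neg ⁻¹' S) := by
    intro z hz
    obtain ⟨x, hx, hxz⟩ := h.hkFns.surjOn_p (p := fun x => -s₁ x) hsol hz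
    exact ⟨x, hx, neg_injective hxz⟩
  have car₂ : ((dens ξ).restrict (Ioi 0)) Sᶜ = 0 := by
    change ∀ᵐ z ∂((dens ξ).restrict (Ioi 0)), z ∈ S
    rw [ae_restrict_iff' measurableSet_Ioi, dens_ae_iff h.target.measurable]
    refine Filter.Eventually.of_forall fun z hz hz0 => ?_
    constructor
    · by_contra! hle
      exact hz.ne' (h.target_zero_low z (by rw [abs_of_pos hz0]; exact hle))
    · by_contra! hle
      exact hz.ne' (h.target_zero_high z (by rw [abs_of_pos hz0]; exact hle))
  have car₁ : ((dens ξ).restrict (Iio 0)) (Neg.neg ⁻¹' S)ᶜ = 0 := by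
    change ∀ᵐ z ∂((dens ξ).restrict (Iio 0)), -z ∈ S
    rw [ae_restrict_iff' measurableSet_Iio, dens_ae_iff h.target.measurable]
    refine Filter.Eventually.of_forall fun z hz hz0 => ?_
    have habs : |z| = -z := abs_of_neg hz0
    constructor
    · by_contra! hle
      exact hz.ne' (h.target_zero_low z (by rw [habs]; exact hle))
    · by_contra! hle
      exact hz.ne' (h.target_zero_high z (by rw [habs]; exact hle))
  have carχ : ∀ᵐ t ∂(dens χ), t ∈ Ioo (-γ) γ := by
    rw [dens_ae_iff h.source.measurable]
    refine Filter.Eventually.of_forall fun z hz => ?_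
    by_contra hlt
    exact hz.ne' (h.source_zero z (not_lt.1 fun hlt' => hlt (abs_lt.1 hlt')))
  obtain ⟨r₁, hr₁, hsr₁, hU₁⟩ := exists_inverse_antitoneOn an₁ (measurable_neg hSm) surj₁ car₁
  obtain ⟨r₂, hr₂, hsr₂, hU₂⟩ := exists_inverse_antitoneOn an₂ hSm surj₂ car₂
  have hmeas : ∀ s : ℝ → ℝ, AntitoneOn s (Ioo (-γ) γ) → AEMeasurable s (dens χ) := by
    intro s hs
    have := aemeasurable_restrict_of_antitoneOn (μ := dens χ) measurableSet_Ioo hs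
    rwa [Measure.restrict_eq_self_of_ae_mem carχ] at this
  have i0 : ∀ r s : ℝ, IntervalIntegrable ξ volume r s :=
    fun r s => h.target.integrable.intervalIntegrable
  have i1 : ∀ r s : ℝ, IntervalIntegrable (fun z => z * ξ z) volume r s :=
    fun r s => h.target.integrable₁.intervalIntegrable
  obtain ⟨z1, z2⟩ := h.target_interval_zero (p := -γ) (q := 0) (by linarith) (by linarith)
    (by linarith)
  obtain ⟨z3, z4⟩ := h.target_interval_zero (p := 0) (q := γ) (by linarith) (by linarith) hγa
  have o0 : ∫ z in Iio (0 : ℝ), ξ z = ∫ z in Ioi (0 : ℝ), ξ z := by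
    have := integral_comp_neg_Ioi (0 : ℝ) ξ
    rw [neg_zero, integral_Iic_eq_integral_Iio] at this
    rw [← this]; simp only [h.target_even]
  have o1 : ∫ z in Iio (0 : ℝ), z * ξ z = -∫ z in Ioi (0 : ℝ), z * ξ z := by
    have := integral_comp_neg_Ioi (0 : ℝ) fun z => z * ξ z
    rw [neg_zero, integral_Iic_eq_integral_Iio] at this
    rw [← this, ← integral_neg]; simp only [h.target_even, neg_mul]
  have p0 : ∫ z in Ioi (0 : ℝ), ξ z = ∫ z in Ioi γ, ξ z := by
    rw [← intervalIntegral.integral_interval_add_Ioi (a := 0) (b := γ)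
      h.target.integrable.integrableOn h.target.integrable.integrableOn, z3, zero_add]
  have q0 : ∀ f : ℝ → ℝ, (∀ z, γ ≤ |z| → f z = 0) → ∫ z, f z = ∫ z in (-γ)..γ, f z := by
    intro f hf
    rw [intervalIntegral.integral_of_le (by linarith), setIntegral_eq_integral_of_forall_compl_eq_zero]
    intro z hz
    refine hf z (not_lt.1 fun hlt => hz ?_)
    exact ⟨(abs_lt.1 hlt).1, (abs_lt.1 hlt).2.le⟩
  have q1 : ∀ f : ℝ → ℝ, (∀ z, γ ≤ |z| → f z = 0) → ∀ x, -γ < x →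
      ∫ z in Iic x, f z = ∫ z in (-γ)..x, f z := by
    intro f hf x hx
    rw [intervalIntegral.integral_of_le hx.le]
    refine setIntegral_eq_of_subset_of_forall_sdiff_eq_zero measurableSet_Iic
      (fun z hz => hz.2) fun z hz => hf z ?_
    have : z ≤ -γ := by
      by_contra! hlt
      exact hz.2 ⟨hlt, hz.1⟩
    exact (by linarith : γ ≤ -z).trans (neg_le_abs z)
  have f0 := h.source_zero
  have f1 : ∀ z, γ ≤ |z| → z * χ z = 0 := fun z hz => by rw [f0 z hz, mul_zero]
  have inter : ∀ x ∈ Ioo (-γ) γ, Ioi (s₁ x) ∩ Iio 0 = Ioo (s₁ x) 0 ∧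
      Ioi (s₂ x) ∩ Ioi 0 = Ioi (s₂ x) ∧ s₁ x ≤ 0 := by
    intro x hx
    obtain ⟨e1, e2⟩ := h.epsilon_mem hx.1 hx.2
    have e2' : 0 ≤ s₂ x := by simp only [hs₂]; linarith
    refine ⟨Ioi_inter_Iio, ?_, ?_⟩
    · rw [Ioi_inter_Ioi, max_eq_left e2']
    · simp only [hs₁]; linarith
  have main := lintegral_twoPoint_of_segments (m := dens χ) (m₁ := (dens ξ).restrict (Iio 0))
    (m₂ := (dens ξ).restrict (Ioi 0)) h.source.integrable_id h.target.integrable_id.integrableOn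
    h.target.integrable_id.integrableOn (hmeas s₁ an₁) (hmeas s₂ an₂) hr₁ hr₂ hsr₁ hsr₂ hU₁ hU₂
    carχ (carχ.mono fun t ht => by
      obtain ⟨e1, e2⟩ := h.epsilon_mem ht.1 ht.2
      exact ⟨by linarith [ht.1], by linarith [ht.2]⟩)
    (fun x hx => by
      obtain ⟨in1, in2, le1⟩ := inter x hx
      have hm := (hsol x hx.1 hx.2).mass
      rw [measureReal_restrict_apply measurableSet_Ioi, measureReal_restrict_apply measurableSet_Ioi,
        in1, in2, h.target.real_apply measurableSet_Ioo, h.target.real_apply measurableSet_Ioi,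
        h.source.real_apply measurableSet_Iic, setIntegral_Ioo_eq_interval le1, q1 _ f0 x hx.1,
        hm, ← intervalIntegral.integral_add_adjacent_intervals (i0 (s₁ x) (-γ)) (i0 (-γ) 0), z1,
        (h.sub_interval (s₂ x)).1, (interval_odd_part h.target_even (s₁ x) (-γ)).1, neg_neg]
      ring)
    (fun x hx => by
      obtain ⟨in1, in2, le1⟩ := inter x hx
      have hm := (hsol x hx.1 hx.2).mean
      rw [Measure.restrict_restrict measurableSet_Ioi, Measure.restrict_restrict measurableSet_Ioi,
        in1, in2, h.target.setIntegral_id measurableSet_Ioo,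
        h.target.setIntegral_id measurableSet_Ioi, h.source.setIntegral_id measurableSet_Iic,
        setIntegral_Ioo_eq_interval le1, q1 _ f1 x hx.1,
        hm, ← intervalIntegral.integral_add_adjacent_intervals (i1 (s₁ x) (-γ)) (i1 (-γ) 0), z2,
        (h.sub_interval (s₂ x)).2, (interval_odd_part h.target_even (s₁ x) (-γ)).2, neg_neg]
      ring)
    (by
      rw [measureReal_restrict_apply MeasurableSet.univ,
        measureReal_restrict_apply MeasurableSet.univ, univ_inter, univ_inter,
        h.target.real_apply measurableSet_Iio, h.target.real_apply measurableSet_Ioi,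
        h.source.real_apply MeasurableSet.univ, Measure.restrict_univ, q0 _ f0, h.source_total.1,
        o0, p0]
      ring)
    (by
      rw [h.target.setIntegral_id measurableSet_Iio, h.target.setIntegral_id measurableSet_Ioi]
      have := h.source.setIntegral_id MeasurableSet.univ
      rw [Measure.restrict_univ, Measure.restrict_univ] at this
      rw [this, q0 _ f1, h.source_total.2, o1]
      ring) hA
  have hsum : (dens ξ).restrict (Iio 0) A + (dens ξ).restrict (Ioi 0) A = dens ξ A := by
    have e1 := measure_inter_add_sdiff (μ := dens ξ) A (measurableSet_Iio (a := (0 : ℝ)))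
    rw [Measure.restrict_apply hA, Measure.restrict_apply hA, ← e1]
    congr 1
    have : (A \ Iio 0 : Set ℝ) =ᵐ[dens ξ] (A ∩ Ioi 0 : Set ℝ) := by
      have hne : ∀ᵐ z ∂(dens ξ), z ≠ 0 := by rw [ae_iff]; simp
      filter_upwards [hne] with z hz
      apply propext
      change (z ∈ A ∧ ¬ z < 0) ↔ (z ∈ A ∧ 0 < z)
      rw [not_lt]
      exact ⟨fun h => ⟨h.1, lt_of_le_of_ne h.2 hz.symm⟩, fun h => ⟨h.1, h.2.le⟩⟩
    exact (measure_congr this).symm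
  rw [← hsum, ← main]
  rfl

end HKDens

/-! ### Consequences of the dispersion assumption -/

theorem integral_Ioi_even {h : ℝ → ℝ} (hi : Integrable h) (he : ∀ z, h (-z) = h z) :
    ∫ z, h z = 2 * ∫ z in Ioi (0 : ℝ), h z := by
  have h1 := integral_comp_neg_Ioi (0 : ℝ) h
  rw [neg_zero] at h1
  simp only [he] at h1
  rw [← intervalIntegral.integral_Iic_add_Ioi (b := 0) hi.integrableOn hi.integrableOn, ← h1]
  ring

/-- The interval `(-β, β)`. -/
def symInterval (β : EReal) : Set ℝ := {x : ℝ | ((|x| : ℝ) : EReal) < β}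

namespace SymmetricDispersion

variable {μ ν : Measure ℝ} {ρ η : ℝ → ℝ} {α β : EReal} {e : ℝ}

theorem isDensity_of_eq {m : Measure ℝ} [IsProbabilityMeasure m] {h : ℝ → ℝ} (hm : Measurable h)
    (h0 : ∀ x, 0 ≤ h x) (hd : m = dens h) (hid : Integrable id m) : IsDensity h where
  measurable := hm
  nonneg := h0
  integrable := by
    rw [← lintegral_ofReal_ne_top_iff_integrable hm.aestronglyMeasurable
      (Filter.Eventually.of_forall h0)]
    have : dens h univ = 1 := by rw [← hd]; exact measure_univ
    rw [dens, withDensity_apply _ MeasurableSet.univ, Measure.restrict_univ] at this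
    rw [this]; simp
  integrable₁ := by
    rw [hd, dens, integrable_withDensity_iff (by fun_prop) (by simp)] at hid
    refine hid.congr (Filter.Eventually.of_forall fun z => ?_)
    simp only [id]
    rw [ENNReal.toReal_ofReal (h0 z)]

theorem integral_eq_one {m : Measure ℝ} [IsProbabilityMeasure m] {h : ℝ → ℝ} (hh : IsDensity h)
    (hd : m = dens h) : ∫ z, h z = 1 := by
  have := hh.real_apply MeasurableSet.univ
  rw [← hd, Measure.restrict_univ] at this
  rw [← this]; simp

variable [IsProbabilityMeasure μ] [IsProbabilityMeasure ν]
  (h : SymmetricDispersion μ ν ρ η α β e)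

section
include h

omit [IsProbabilityMeasure ν] in
theorem rho : IsDensity ρ :=
  isDensity_of_eq (m := μ) h.measurable_rho h.rho_nonneg h.density_mu h.convexOrder.1

omit [IsProbabilityMeasure μ] in
theorem eta : IsDensity η :=
  isDensity_of_eq (m := ν) h.measurable_eta h.eta_nonneg h.density_nu h.convexOrder.2.1

omit [IsProbabilityMeasure μ] in
theorem eta_zero : ∀ᵐ z : ℝ, β ≤ ((|z| : ℝ) : EReal) → η z = 0 := by
  have h1 : ∀ᵐ z ∂ν, z ∈ {x : ℝ | ((|x| : ℝ) : EReal) < β} := by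
    have hm : MeasurableSet {x : ℝ | ((|x| : ℝ) : EReal) < β} :=
      (isOpen_Iio.preimage (continuous_coe_real_ereal.comp continuous_abs)).measurableSet
    exact (prob_compl_eq_zero_iff hm).2 h.nu_support
  rw [show ν = dens η from h.density_nu, dens_ae_iff h.measurable_eta] at h1
  filter_upwards [h1] with z hz hb
  by_contra hne
  exact absurd (hz (lt_of_le_of_ne (h.eta_nonneg z) (Ne.symm hne))) (not_lt.2 hb)

omit [IsProbabilityMeasure μ] in
-- For finite `β = r`, test the convex order with `(|x| - r)⁺`. Its `ν`-integral vanishes, hence so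
-- does its `μ`-integral.
theorem rho_zero : ∀ᵐ z : ℝ, β ≤ ((|z| : ℝ) : EReal) → ρ z = 0 := by
  induction hβ : β with
  | top => exact Filter.Eventually.of_forall fun z hz => by simp at hz
  | bot => have := h.beta_pos; simp [hβ] at this
  | coe r =>
    set f : ℝ → ℝ := fun x => max (|x| - r) 0 with hf
    have hf0 : ∀ x, 0 ≤ f x := fun x => le_max_right _ _
    have hfc : ConvexOn ℝ univ f := by
      have habs : ConvexOn ℝ univ fun x : ℝ => |x| := convexOn_univ_norm (E := ℝ)
      exact ((habs.add_const (-r)).congr fun x _ => (sub_eq_add_neg _ _).symm).sup (convexOn_const 0 convex_univ)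
    have hle := h.convexOrder.2.2 f hfc
    rw [extIntegral_of_nonneg _ hf0, extIntegral_of_nonneg _ hf0] at hle
    have hν : ∫⁻ x, ENNReal.ofReal (f x) ∂ν = 0 := by
      rw [show ν = dens η from h.density_nu, lintegral_dens h.measurable_eta, ← lintegral_zero]
      refine lintegral_congr_ae ?_
      filter_upwards [h.eta_zero] with z hz
      rcases le_or_gt r |z| with hr | hr
      · rw [hz (by rw [hβ]; exact_mod_cast hr)]; simp
      · simp only [hf, max_eq_right (by linarith : |z| - r ≤ 0)]; simp
    rw [hν] at hle
    have hμ : ∫⁻ x, ENNReal.ofReal (f x) ∂μ = 0 := by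
      have : ∫⁻ x, ENNReal.ofReal (f x) ∂μ ≤ 0 := by exact_mod_cast hle
      exact le_antisymm this zero_le
    have hfm : Measurable f := by fun_prop
    rw [lintegral_eq_zero_iff (by fun_prop), show μ = dens ρ from h.density_mu] at hμ
    have h1 := (dens_ae_iff h.measurable_rho (p := fun z => ENNReal.ofReal (f z) = 0)).1 hμ
    have hne : ∀ᵐ z : ℝ, z ≠ r ∧ z ≠ -r := by
      rw [ae_iff]
      refine measure_mono_null (t := {r, -r}) (fun z hz => ?_) ((Set.toFinite _).measure_zero _)
      by_contra hcon
      simp only [mem_insert_iff, mem_singleton_iff, not_or] at hcon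
      exact hz hcon
    filter_upwards [h1, hne] with z hz hzr hb
    by_contra hne
    have h2 := hz (lt_of_le_of_ne (h.rho_nonneg z) (Ne.symm hne))
    have h3 : r ≤ |z| := by exact_mod_cast hb
    have h4 : f z ≤ 0 := ENNReal.ofReal_eq_zero.1 h2
    have h5 : |z| - r ≤ 0 := (le_max_left _ _).trans h4
    have h6 : |z| = r := by linarith
    rcases abs_choice z with hc | hc <;> rw [hc] at h6
    · exact hzr.1 h6
    · exact hzr.2 (by linarith)

omit [IsProbabilityMeasure μ] in
-- Since `e < α`, `ρ` is positive just to the right of `e`; if `β ≤ e`, it would vanish there almost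
-- everywhere.
theorem e_lt_beta : (e : EReal) < β := by
  by_contra! hle
  obtain ⟨t, ht1, ht2⟩ := EReal.lt_iff_exists_real_btwn.1 h.e_lt
  have het : e < t := by exact_mod_cast ht1
  have h1 : ∀ᵐ z : ℝ, z ∉ Ioo e t := by
    filter_upwards [h.rho_zero] with z hz hzI
    have h0 : 0 < z := h.e_pos.trans hzI.1
    have h2 := h.rho_pos z (by
      rw [abs_of_pos h0]
      exact lt_trans (by exact_mod_cast hzI.2) ht2)
    have h3 := hz (hle.trans (by rw [abs_of_pos h0]; exact_mod_cast hzI.1.le))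
    linarith
  have h2 : volume (Ioo e t) = 0 := by
    rw [ae_iff] at h1
    exact measure_mono_null (fun z hz => not_not.2 hz) h1
  rw [Real.volume_Ioo, ENNReal.ofReal_eq_zero] at h2
  linarith

omit [IsProbabilityMeasure μ] [IsProbabilityMeasure ν] h in
theorem isOpen_symInterval : IsOpen (symInterval β) :=
  isOpen_Iio.preimage (continuous_coe_real_ereal.comp continuous_abs)

omit [IsProbabilityMeasure μ] [IsProbabilityMeasure ν] h in
theorem mem_symInterval_of_abs_le {x y : ℝ} (hy : y ∈ symInterval β) (hxy : |x| ≤ |y|) :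
    x ∈ symInterval β :=
  lt_of_le_of_lt (by exact_mod_cast hxy) (show ((|y| : ℝ) : EReal) < β from hy)

omit [IsProbabilityMeasure μ] [IsProbabilityMeasure ν] h in
theorem ordConnected_symInterval : (symInterval β).OrdConnected := by
  refine ⟨fun p hp q hq z hz => ?_⟩
  rcases le_total 0 z with h0 | h0
  · refine mem_symInterval_of_abs_le hq ?_
    rw [abs_of_nonneg h0]
    exact hz.2.trans (le_abs_self q)
  · refine mem_symInterval_of_abs_le hp ?_
    rw [abs_of_nonpos h0]
    exact (by linarith [hz.1] : -z ≤ -p).trans (neg_le_abs p)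

omit [IsProbabilityMeasure μ] in
theorem e_mem : e ∈ symInterval β := by
  change ((|e| : ℝ) : EReal) < β
  rw [abs_of_pos h.e_pos]
  exact h.e_lt_beta

theorem integrable_diff : Integrable (fun z => η z - ρ z) ∧
    Integrable (fun z => z * (η z - ρ z)) := by
  refine ⟨h.eta.integrable.sub h.rho.integrable, ?_⟩
  refine (h.eta.integrable₁.sub h.rho.integrable₁).congr (Filter.Eventually.of_forall fun z => ?_)
  simp only [Pi.sub_apply]; ring

theorem integrable_diff' : Integrable (fun z => ρ z - η z) ∧
    Integrable (fun z => z * (ρ z - η z)) := by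
  refine ⟨h.rho.integrable.sub h.eta.integrable, ?_⟩
  refine (h.rho.integrable₁.sub h.eta.integrable₁).congr (Filter.Eventually.of_forall fun z => ?_)
  simp only [Pi.sub_apply]; ring

theorem interval_diff (p q : ℝ) :
    ∫ z in p..q, (η z - ρ z) = (∫ z in p..q, η z) - ∫ z in p..q, ρ z ∧
      ∫ z in p..q, z * (η z - ρ z) = (∫ z in p..q, z * η z) - ∫ z in p..q, z * ρ z ∧
      ∫ z in p..q, (ρ z - η z) = (∫ z in p..q, ρ z) - ∫ z in p..q, η z ∧
      ∫ z in p..q, z * (ρ z - η z) = (∫ z in p..q, z * ρ z) - ∫ z in p..q, z * η z := by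
  have a1 := h.eta.integrable.intervalIntegrable (a := p) (b := q)
  have a2 := h.rho.integrable.intervalIntegrable (a := p) (b := q)
  have a3 := h.eta.integrable₁.intervalIntegrable (a := p) (b := q)
  have a4 := h.rho.integrable₁.intervalIntegrable (a := p) (b := q)
  refine ⟨intervalIntegral.integral_sub a1 a2, ?_, intervalIntegral.integral_sub a2 a1, ?_⟩
  · rw [← intervalIntegral.integral_sub a3 a4]
    exact intervalIntegral.integral_congr fun z _ => by ring
  · rw [← intervalIntegral.integral_sub a4 a3]
    exact intervalIntegral.integral_congr fun z _ => by ring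

/-- Both measures give mass one half to `(0, ∞)`, so the primitive of `ρ - η` is the tail integral
of `η - ρ`. For first moments the same holds up to the constant `∫ z in Ioi 0, z * (η z - ρ z)`. -/
theorem tail_diff (g : ℝ) :
    (∫ z in (0 : ℝ)..g, ρ z) - ∫ z in (0 : ℝ)..g, η z = ∫ z in Ioi g, (η z - ρ z) ∧
      (∫ z in (0 : ℝ)..g, z * ρ z) - ∫ z in (0 : ℝ)..g, z * η z =
        (∫ z in Ioi g, z * (η z - ρ z)) - ∫ z in Ioi (0 : ℝ), z * (η z - ρ z) := by
  have e0 := intervalIntegral.integral_interval_add_Ioi (a := 0) (b := g)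
    h.integrable_diff.1.integrableOn h.integrable_diff.1.integrableOn
  have e1 := intervalIntegral.integral_interval_add_Ioi (a := 0) (b := g)
    h.integrable_diff.2.integrableOn h.integrable_diff.2.integrableOn
  obtain ⟨d0, d1, -, -⟩ := h.interval_diff 0 g
  have t1 := integral_Ioi_even h.rho.integrable h.rho_even
  have t2 := integral_Ioi_even h.eta.integrable h.eta_even
  rw [integral_eq_one (m := μ) h.rho h.density_mu] at t1
  rw [integral_eq_one (m := ν) h.eta h.density_nu] at t2
  have t3 : ∫ z in Ioi (0 : ℝ), (η z - ρ z) = 0 := by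
    rw [integral_sub h.eta.integrable.integrableOn h.rho.integrable.integrableOn]
    linarith
  exact ⟨by linarith, by linarith⟩

omit [IsProbabilityMeasure μ] in
theorem diff_nonneg_ae : ∀ᵐ z : ℝ, e < z → 0 ≤ η z - ρ z := by
  filter_upwards [h.eta_zero, h.rho_zero] with z h1 h2 hz
  have h0 : 0 < z := h.e_pos.trans hz
  rcases lt_or_ge (((|z| : ℝ) : EReal)) β with hb | hb
  · have := h.outside z (by rw [abs_of_pos h0]; exact hz) hb
    linarith
  · rw [h1 hb, h2 hb]; simp

theorem tail_diff_nonneg {g : ℝ} (hg : e ≤ g) : 0 ≤ ∫ z in Ioi g, (η z - ρ z) ∧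
    g * ∫ z in Ioi g, (η z - ρ z) ≤ ∫ z in Ioi g, z * (η z - ρ z) := by
  have h1 : ∀ᵐ z ∂(volume.restrict (Ioi g)), 0 ≤ η z - ρ z := by
    rw [ae_restrict_iff' measurableSet_Ioi]
    exact h.diff_nonneg_ae.mono fun z hz hzg => hz (hg.trans_lt hzg)
  refine ⟨integral_nonneg_of_ae h1, ?_⟩
  rw [← integral_const_mul]
  refine integral_mono_ae (h.integrable_diff.1.const_mul g).integrableOn
    h.integrable_diff.2.integrableOn ?_
  filter_upwards [h1, ae_restrict_mem measurableSet_Ioi] with z hz hzg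
  exact mul_le_mul_of_nonneg_right (le_of_lt hzg) hz

theorem curtainFns : CurtainFns (fun x => ∫ z in (0 : ℝ)..x, ρ z)
    (fun x => ∫ z in (0 : ℝ)..x, z * ρ z) (fun x => ∫ z in (0 : ℝ)..x, η z)
    (fun x => ∫ z in (0 : ℝ)..x, z * η z) (symInterval β) e := by
  have heβ := h.e_mem
  have he := h.e_pos
  have hord := ordConnected_symInterval (β := β)
  have h0 : (0 : ℝ) ∈ symInterval β := mem_symInterval_of_abs_le heβ (by simp)
  have hN : ∀ p ∈ symInterval β, ∀ q ∈ symInterval β, p < q →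
      Bary (fun x => ∫ z in (0 : ℝ)..x, η z) (fun x => ∫ z in (0 : ℝ)..x, z * η z) p q :=
    fun p hp q hq hpq => bary_of_pos h.eta.integrable h.eta.integrable₁ 0 hpq fun z hz =>
      h.eta_pos z (hord.out hp hq ⟨hz.1.le, hz.2.le⟩)
  have hin : ∀ p q z, 0 ≤ p → q ≤ e → z ∈ Ioo p q → |z| < e := fun p q z hp hq hz =>
    abs_lt.2 ⟨by linarith [hz.1], hz.2.trans_le hq⟩
  have hWin : ∀ p q, 0 ≤ p → p < q → q ≤ e →
      Bary ((fun x => ∫ z in (0 : ℝ)..x, ρ z) - fun x => ∫ z in (0 : ℝ)..x, η z)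
        ((fun x => ∫ z in (0 : ℝ)..x, z * ρ z) - fun x => ∫ z in (0 : ℝ)..x, z * η z) p q := by
    intro p q hp hpq hq
    convert bary_of_pos h.integrable_diff'.1 h.integrable_diff'.2 0 hpq
      (fun z hz => sub_pos.2 (h.inside z (hin p q z hp hq hz))) using 1
    · ext x; exact (h.interval_diff 0 x).2.2.1.symm
    · ext x; exact (h.interval_diff 0 x).2.2.2.symm
  have hWout : ∀ p q, e ≤ p → p < q → q ∈ symInterval β →
      Bary ((fun x => ∫ z in (0 : ℝ)..x, η z) - fun x => ∫ z in (0 : ℝ)..x, ρ z)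
        ((fun x => ∫ z in (0 : ℝ)..x, z * η z) - fun x => ∫ z in (0 : ℝ)..x, z * ρ z) p q := by
    intro p q hp hpq hq
    convert bary_of_pos h.integrable_diff.1 h.integrable_diff.2 0 hpq
      (fun z hz => sub_pos.2 (h.outside z
        (lt_of_lt_of_le (hp.trans_lt hz.1) (le_abs_self z))
        (hord.out heβ hq ⟨hp.trans hz.1.le, hz.2.le⟩))) using 1
    · ext x; exact (h.interval_diff 0 x).1.symm
    · ext x; exact (h.interval_diff 0 x).2.1.symm
  obtain ⟨x, hx, hxI, hxb⟩ := exists_seq_real_tendsto h.e_lt_beta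
  have hxB : ∀ n, x n ∈ symInterval β := fun n => by
    change ((|x n| : ℝ) : EReal) < β
    rw [abs_of_pos (he.trans (hxI n).1)]
    exact (hxI n).2
  have hηz : ∀ᵐ z : ℝ, β ≤ z → η z = 0 := h.eta_zero.mono fun z hz hb =>
    hz (hb.trans (by exact_mod_cast le_abs_self z))
  have hρz : ∀ᵐ z : ℝ, β ≤ z → ρ z = 0 := h.rho_zero.mono fun z hz hb =>
    hz (hb.trans (by exact_mod_cast le_abs_self z))
  have hdz : ∀ᵐ z : ℝ, β ≤ z → η z - ρ z = 0 := by
    filter_upwards [hηz, hρz] with z h1 h2 hb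
    rw [h1 hb, h2 hb, sub_zero]
  have td := tendsto_tail_integral hx hxb h.integrable_diff.1 hdz
  have hNe := (hN 0 h0 e heβ he).1
  simp only [intervalIntegral.integral_same, sub_zero] at hNe
  exact {
    contM := intervalIntegral.continuous_primitive
      (fun _ _ => h.rho.integrable.intervalIntegrable) _
    contM₁ := intervalIntegral.continuous_primitive
      (fun _ _ => h.rho.integrable₁.intervalIntegrable) _
    contN := intervalIntegral.continuous_primitive
      (fun _ _ => h.eta.integrable.intervalIntegrable) _
    contN₁ := intervalIntegral.continuous_primitive
      (fun _ _ => h.eta.integrable₁.intervalIntegrable) _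
    isOpen := isOpen_symInterval
    ordConnected := hord
    e_pos := he
    e_mem := heβ
    M_zero := intervalIntegral.integral_same
    M₁_zero := intervalIntegral.integral_same
    N_zero := intervalIntegral.integral_same
    N₁_zero := intervalIntegral.integral_same
    N_bary := hN
    M_bary := fun p q hp hpq hq => bary_of_pos h.rho.integrable h.rho.integrable₁ 0 hpq
      fun z hz => (h.eta_nonneg z).trans_lt (h.inside z (hin p q z hp hq hz))
    W_in := hWin
    W_out := hWout
    -- Take `f = -x n` with the `ν`-mass beyond `x n` below that of `(0, e)`. Then the mass of `(0,
    -- x n)` exceeds the `ν`-mass beyond `e`, which is at least the tail integral of `η - ρ`, that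
    -- is, `M e - N e`.
    low := by
      have tη := tendsto_tail_integral hx hxb h.eta.integrable hηz
      obtain ⟨n, hn⟩ := (tη.eventually (gt_mem_nhds hNe)).exists
      refine ⟨-x n, mem_symInterval_of_abs_le (hxB n) (by rw [abs_neg]),
        by linarith [(hxI n).1], ?_⟩
      have e1 := (interval_odd_part h.eta_even 0 (-x n)).1
      rw [neg_neg, neg_zero, intervalIntegral.integral_symm 0 (x n)] at e1
      have e2 := (h.tail_diff e).1
      rw [integral_sub h.eta.integrable.integrableOn h.rho.integrable.integrableOn] at e2
      have e3 := (tail_bounds_of_nonneg h.rho.integrable h.rho.integrable₁ e h.rho_nonneg).1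
      have e4 := intervalIntegral.integral_interval_add_Ioi (a := 0) (b := x n)
        h.eta.integrable.integrableOn h.eta.integrable.integrableOn
      have e5 := intervalIntegral.integral_interval_add_Ioi (a := 0) (b := e)
        h.eta.integrable.integrableOn h.eta.integrable.integrableOn
      linarith
    neg := by
      have tm := tendsto_tail_integral hx hxb h.integrable_diff.2
        (hdz.mono fun z hz hb => by rw [hz hb, mul_zero])
      obtain ⟨w1, w2, w3⟩ := hWin 0 e le_rfl he le_rfl
      simp only [Pi.sub_apply, intervalIntegral.integral_same, sub_zero] at w1 w2 w3
      obtain ⟨q1, q2⟩ := h.tail_diff e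
      obtain ⟨r1, r2⟩ := h.tail_diff_nonneg le_rfl
      -- On the half-line, `ν - μ` takes mass from below `e` and puts the same mass above `e`, so
      -- its first moment is positive. Far out, `M₁ - N₁` is close to the negative of this number.
      have hneg : 0 < ∫ z in Ioi (0 : ℝ), z * (η z - ρ z) := by
        rw [q1] at w3
        linarith
      obtain ⟨n, hn⟩ := (tm.eventually (gt_mem_nhds hneg)).exists
      refine ⟨x n, hxB n, (hxI n).1, ?_⟩
      rw [(h.tail_diff (x n)).2]
      linarith
    small := by
      intro y hy
      obtain ⟨n, hn⟩ := (td.eventually (gt_mem_nhds hy)).exists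
      exact ⟨x n, hxB n, (hxI n).1, by rw [(h.tail_diff (x n)).1]; exact hn⟩
    pos := by
      intro g hg hge
      have hgβ : (g : EReal) < β := by
        have : ((|g| : ℝ) : EReal) < β := hg
        rwa [abs_of_pos (he.trans_le hge)] at this
      obtain ⟨n, hn⟩ := hxb g hgβ
      have w1 := (hWout g (x n) hge hn (hxB n)).1
      simp only [Pi.sub_apply] at w1
      have w2 := (h.tail_diff (x n)).1
      have w3 := (h.tail_diff_nonneg (hge.trans hn.le)).1
      linarith }

theorem isRightCurtainPair_iff {x : ℝ} {p : ℝ × ℝ} : IsRightCurtainPair ρ η β x p ↔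
    CurtainPair (fun x => ∫ z in (0 : ℝ)..x, ρ z)
      (fun x => ∫ z in (0 : ℝ)..x, z * ρ z) (fun x => ∫ z in (0 : ℝ)..x, η z)
      (fun x => ∫ z in (0 : ℝ)..x, z * η z) (symInterval β) x p.1 p.2 := by
  have sub : ∀ {f : ℝ → ℝ}, Integrable f → ∀ p q : ℝ,
      (∫ z in (0 : ℝ)..q, f z) - ∫ z in (0 : ℝ)..p, f z = ∫ z in p..q, f z := fun hf p q =>
    intervalIntegral.integral_interval_sub_left hf.intervalIntegrable hf.intervalIntegrable
  constructor
  · rintro ⟨h1, h2, h3, h4, h5⟩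
    have e0 := h5 0 (by norm_num)
    have e1 := h5 1 le_rfl
    simp only [pow_zero, one_mul, pow_one] at e0 e1
    refine ⟨h1, h2, h3, h4, ?_, ?_⟩
    · rw [sub h.rho.integrable, sub h.eta.integrable, e0]
    · rw [sub h.rho.integrable₁, sub h.eta.integrable₁, e1]
  · rintro ⟨h1, h2, h3, h4, h5, h6⟩
    rw [sub h.rho.integrable, sub h.eta.integrable] at h5
    rw [sub h.rho.integrable₁, sub h.eta.integrable₁] at h6
    refine ⟨h1, h2, h3, h4, fun i hi => ?_⟩
    interval_cases i
    · simpa using h5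
    · simpa using h6

theorem isRightCurtainPair_epsilon {x : ℝ} (h0 : 0 < x) (hx : x < e) :
    IsRightCurtainPair ρ η β x (Classical.epsilon (IsRightCurtainPair ρ η β x)) := by
  obtain ⟨f, g, hp⟩ := h.curtainFns.exists_pair h0 hx
  exact Classical.epsilon_spec ⟨(f, g), h.isRightCurtainPair_iff.2 hp⟩

theorem curtainPair {x : ℝ} (h0 : 0 < x) (hx : x < e) :
    CurtainPair (fun x => ∫ z in (0 : ℝ)..x, ρ z)
      (fun x => ∫ z in (0 : ℝ)..x, z * ρ z) (fun x => ∫ z in (0 : ℝ)..x, η z)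
      (fun x => ∫ z in (0 : ℝ)..x, z * η z) (symInterval β) x (fR ρ η β x) (gR ρ η β x) :=
  h.isRightCurtainPair_iff.1 (h.isRightCurtainPair_epsilon h0 hx)

/-- The equations have a solution with `f = 0`, and uniqueness identifies it with the chosen value
of `fR`. -/
theorem x₀_spec : 0 < x₀ ρ η β e ∧ x₀ ρ η β e < e ∧ fR ρ η β (x₀ ρ η β e) = 0 := by
  obtain ⟨x, g, h0, hx, hp⟩ := h.curtainFns.exists_pair_zero
  have hu := h.curtainFns.pair_unique h0 hx (h.curtainPair h0 hx) hp
  exact Classical.epsilon_spec (p := fun x => 0 < x ∧ x < e ∧ fR ρ η β x = 0) ⟨x, h0, hx, hu.1⟩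

omit [IsProbabilityMeasure μ] [IsProbabilityMeasure ν] in
theorem isLeftCurtainPair_iff {x : ℝ} {p : ℝ × ℝ} :
    IsLeftCurtainPair ρ η β (-x) p ↔ IsRightCurtainPair ρ η β x (-p.2, -p.1) := by
  obtain ⟨a1, a2⟩ := interval_odd_part h.rho_even p.1 (-x)
  obtain ⟨b1, b2⟩ := interval_odd_part h.eta_even p.1 p.2
  rw [neg_neg] at a1 a2
  unfold IsLeftCurtainPair IsRightCurtainPair
  simp only [abs_neg]
  constructor
  · rintro ⟨h1, h2, h3, h4, h5⟩
    have e0 := h5 0 (by norm_num)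
    have e1 := h5 1 le_rfl
    simp only [pow_zero, one_mul, pow_one] at e0 e1
    refine ⟨h2, h1, by linarith, by linarith, fun i hi => ?_⟩
    interval_cases i
    · simp only [pow_zero, one_mul]; linarith
    · simp only [pow_one]; linarith
  · rintro ⟨h1, h2, h3, h4, h5⟩
    have e0 := h5 0 (by norm_num)
    have e1 := h5 1 le_rfl
    simp only [pow_zero, one_mul, pow_one] at e0 e1
    refine ⟨h2, h1, by linarith, by linarith, fun i hi => ?_⟩
    interval_cases i
    · simp only [pow_zero, one_mul]; linarith
    · simp only [pow_one]; linarith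

/-- Reflection exchanges the left and right systems; uniqueness makes the chosen solutions
correspond. All statements about the left curtain are reduced to the right one in this way. -/
theorem left_eq {x : ℝ} (h0 : 0 < x) (hx : x < e) :
    fL ρ η β (-x) = -gR ρ η β x ∧ gL ρ η β (-x) = -fR ρ η β x := by
  have h1 := h.isRightCurtainPair_epsilon h0 hx
  have h2 : IsLeftCurtainPair ρ η β (-x) (Classical.epsilon (IsLeftCurtainPair ρ η β (-x))) := by
    refine Classical.epsilon_spec (p := IsLeftCurtainPair ρ η β (-x))
      ⟨(-gR ρ η β x, -fR ρ η β x), h.isLeftCurtainPair_iff.2 ?_⟩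
    simp only [neg_neg]
    exact h1
  have h3 := h.isRightCurtainPair_iff.1 (h.isLeftCurtainPair_iff.1 h2)
  obtain ⟨u1, u2⟩ := h.curtainFns.pair_unique h0 hx h3 (h.curtainPair h0 hx)
  exact ⟨by unfold fL; linarith, by unfold gL; linarith⟩

theorem fR_strictMonoOn : StrictMonoOn (fR ρ η β) (Ioo 0 e) :=
  h.curtainFns.F_strictMonoOn fun _ h0 hx => h.curtainPair h0 hx

theorem gR_strictAntiOn : StrictAntiOn (gR ρ η β) (Ioo 0 e) :=
  h.curtainFns.G_strictAntiOn fun _ h0 hx => h.curtainPair h0 hx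

theorem e_lt_gR {x : ℝ} (h0 : 0 < x) (hx : x < e) : e < gR ρ η β x :=
  h.curtainFns.e_lt_g h0 hx (h.curtainPair h0 hx)

/-- The density of `ν - μ` outside the dispersion interval. -/
theorem isDensity_outside {A : Set ℝ} (hA : MeasurableSet A)
    (hAe : ∀ z ∈ A, e < |z| ∧ ((|z| : ℝ) : EReal) < β) :
    IsDensity (A.indicator fun z => η z - ρ z) where
  measurable := (h.measurable_eta.sub h.measurable_rho).indicator hA
  nonneg z := indicator_nonneg
    (fun z hz => (sub_pos.2 (h.outside z (hAe z hz).1 (hAe z hz).2)).le) z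
  integrable := h.integrable_diff.1.indicator hA
  integrable₁ := by
    refine (h.integrable_diff.2.indicator hA).congr (Filter.Eventually.of_forall fun z => ?_)
    by_cases hz : z ∈ A <;> simp [hz]

theorem isDensity_inside {A : Set ℝ} (hA : MeasurableSet A) (hAe : ∀ z ∈ A, |z| < e) :
    IsDensity (A.indicator fun z => ρ z - η z) where
  measurable := (h.measurable_rho.sub h.measurable_eta).indicator hA
  nonneg z := indicator_nonneg (fun z hz => (sub_pos.2 (h.inside z (hAe z hz))).le) z
  integrable := h.integrable_diff'.1.indicator hA
  integrable₁ := by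
    refine (h.integrable_diff'.2.indicator hA).congr (Filter.Eventually.of_forall fun z => ?_)
    by_cases hz : z ∈ A <;> simp [hz]

/-- The right-curtain kernel transports `μ` on `(c, e)` to `ν` on `(f^R(c), e)` plus `ν - μ` on
`(e, g^R(c))`. -/
theorem lintegral_right {c : ℝ} (hc : 0 < c) (hce : c < e) {A : Set ℝ} (hA : MeasurableSet A) :
    ∫⁻ t in Ioo c e, twoPoint t (fR ρ η β t) (gR ρ η β t) A ∂(dens ρ) =
      dens ((Ioo (fR ρ η β c) e).indicator η) A +
      dens ((Ioo e (gR ρ η β c)).indicator fun z => η z - ρ z) A := by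
  have hFG : ∀ x, 0 < x → x < e → _ := fun x h0 hx => h.curtainPair (x := x) h0 hx
  have hcp := hFG c hc hce
  have hge := h.e_lt_gR hc hce
  have hfe : fR ρ η β c < e := hcp.f_lt.trans hce
  have hsub : Ioo c e ⊆ Ioo 0 e := Ioo_subset_Ioo_left hc.le
  have d₀ : IsDensity ((Ioo c e).indicator ρ) := h.rho.indicator measurableSet_Ioo
  have d₁ : IsDensity ((Ioo (fR ρ η β c) e).indicator η) := h.eta.indicator measurableSet_Ioo
  have d₂ : IsDensity ((Ioo e (gR ρ η β c)).indicator fun z => η z - ρ z) := by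
    refine h.isDensity_outside measurableSet_Ioo fun z hz => ⟨hz.1.trans_le (le_abs_self z), ?_⟩
    exact (ordConnected_symInterval (β := β)).out h.e_mem hcp.g_mem ⟨hz.1.le, hz.2.le⟩
  have := d₀.isFiniteMeasure
  have := d₁.isFiniteMeasure
  have := d₂.isFiniteMeasure
  have mF : MonotoneOn (fR ρ η β) (Ioo c e) := (h.fR_strictMonoOn.mono hsub).monotoneOn
  have mG : AntitoneOn (gR ρ η β) (Ioo c e) := (h.gR_strictAntiOn.mono hsub).antitoneOn
  have car : ∀ (k : ℝ → ℝ) (p q : ℝ), Measurable ((Ioo p q).indicator k) →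
      dens ((Ioo p q).indicator k) (Ioo p q)ᶜ = 0 := by
    intro k p q hk
    change ∀ᵐ z ∂(dens ((Ioo p q).indicator k)), z ∈ Ioo p q
    rw [dens_ae_iff hk]
    refine Filter.Eventually.of_forall fun z hz => ?_
    by_contra hcon
    rw [indicator_of_notMem hcon] at hz
    exact lt_irrefl _ hz
  have car₀ : ∀ᵐ t ∂(dens ((Ioo c e).indicator ρ)), t ∈ Ioo c e := car ρ c e d₀.measurable
  obtain ⟨r₁, hr₁, hsr₁, hU₁⟩ := exists_inverse_monotoneOn
    (n := dens ((Ioo (fR ρ η β c) e).indicator η)) mF measurableSet_Ioo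
    (h.curtainFns.surjOn_F hFG hc hce) (car _ _ _ d₁.measurable)
  obtain ⟨r₂, hr₂, hsr₂, hU₂⟩ := exists_inverse_antitoneOn
    (n := dens ((Ioo e (gR ρ η β c)).indicator fun z => η z - ρ z)) mG measurableSet_Ioo
    (h.curtainFns.surjOn_G hFG hc hce) (car _ _ _ d₂.measurable)
  have hsF : AEMeasurable (fR ρ η β) (dens ((Ioo c e).indicator ρ)) := by
    have := aemeasurable_restrict_of_monotoneOn (μ := dens ((Ioo c e).indicator ρ))
      measurableSet_Ioo mF
    rwa [Measure.restrict_eq_self_of_ae_mem car₀] at this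
  have hsG : AEMeasurable (gR ρ η β) (dens ((Ioo c e).indicator ρ)) := by
    have := aemeasurable_restrict_of_antitoneOn (μ := dens ((Ioo c e).indicator ρ))
      measurableSet_Ioo mG
    rwa [Measure.restrict_eq_self_of_ae_mem car₀] at this
  have sub : ∀ {f : ℝ → ℝ}, Integrable f → ∀ p q : ℝ,
      ∫ z in p..q, f z = (∫ z in (0 : ℝ)..q, f z) - ∫ z in (0 : ℝ)..p, f z := fun hf p q =>
    (intervalIntegral.integral_interval_sub_left hf.intervalIntegrable hf.intervalIntegrable).symm
  have mom : ∀ (k : ℝ → ℝ) (V W : Set ℝ), MeasurableSet W →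
      ∫ z in V, W.indicator k z = ∫ z in V ∩ W, k z ∧
      ∫ z in V, z * W.indicator k z = ∫ z in V ∩ W, z * k z := by
    intro k V W hW
    have e2 : (fun z => z * W.indicator k z) = W.indicator fun z => z * k z := by
      ext z; by_cases hz : z ∈ W <;> simp [hz]
    rw [e2, setIntegral_indicator hW, setIntegral_indicator hW]
    exact ⟨rfl, rfl⟩
  -- The source on `(c, x]` corresponds to `ν` on `(fR c, fR x)` and to `ν - μ` on `(gR x, gR c)`.
  -- The segment conditions are differences of the curtain equations at `c` and `x`.
  have inter : ∀ x ∈ Ioo c e, Iio (fR ρ η β x) ∩ Ioo (fR ρ η β c) e =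
      Ioo (fR ρ η β c) (fR ρ η β x) ∧
      Ioi (gR ρ η β x) ∩ Ioo e (gR ρ η β c) = Ioo (gR ρ η β x) (gR ρ η β c) ∧
      Iic x ∩ Ioo c e = Ioc c x ∧ fR ρ η β c ≤ fR ρ η β x ∧ gR ρ η β x ≤ gR ρ η β c := by
    intro x hx
    have hxp := hFG x (hc.trans hx.1) hx.2
    have hgx := h.e_lt_gR (hc.trans hx.1) hx.2
    have hfx := hxp.f_lt.trans hx.2
    refine ⟨?_, ?_, ?_, ?_, ?_⟩
    · ext z
      simp only [mem_inter_iff, mem_Iio, mem_Ioo]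
      exact ⟨fun h => ⟨h.2.1, h.1⟩, fun h => ⟨h.2, h.1, h.2.trans hfx⟩⟩
    · ext z
      simp only [mem_inter_iff, mem_Ioi, mem_Ioo]
      exact ⟨fun h => ⟨h.1, h.2.2⟩, fun h => ⟨h.1, hgx.trans h.1, h.2⟩⟩
    · ext z
      simp only [mem_inter_iff, mem_Iic, mem_Ioo, mem_Ioc]
      exact ⟨fun h => ⟨h.2.1, h.1⟩, fun h => ⟨h.2, h.1, h.2.trans_lt hx.2⟩⟩
    · exact (h.fR_strictMonoOn ⟨hc, hce⟩ (hsub hx) hx.1).le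
    · exact (h.gR_strictAntiOn ⟨hc, hce⟩ (hsub hx) hx.1).le
  have tot : ∀ {k : ℝ → ℝ}, IsDensity k → (dens k).real univ = ∫ z in univ, k z ∧
      ∫ z, z ∂(dens k) = ∫ z in univ, z * k z := fun hk =>
    ⟨hk.real_apply MeasurableSet.univ, by
      have := hk.setIntegral_id MeasurableSet.univ
      rwa [Measure.restrict_univ (μ := dens _)] at this⟩
  rw [← dens_indicator ρ measurableSet_Ioo]
  refine lintegral_twoPoint_of_segments d₀.integrable_id d₁.integrable_id d₂.integrable_id hsF hsG
    hr₁ hr₂ hsr₁ hsr₂ hU₁ hU₂ car₀ (car₀.mono fun t ht => ?_) (fun x hx => ?_) (fun x hx => ?_)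
    ?_ ?_ hA
  · have := hFG t (hc.trans ht.1) ht.2
    exact ⟨this.f_lt, this.lt_g⟩
  · obtain ⟨i1, i2, i3, l1, l2⟩ := inter x hx
    have hxm := (hFG x (hc.trans hx.1) hx.2).mass
    have hcm := hcp.mass
    rw [d₀.real_apply measurableSet_Iic, d₁.real_apply measurableSet_Iio,
      d₂.real_apply measurableSet_Ioi, (mom _ _ _ measurableSet_Ioo).1,
      (mom _ _ _ measurableSet_Ioo).1, (mom _ _ _ measurableSet_Ioo).1, i1, i2, i3,
      setIntegral_Ioo_eq_interval l1, setIntegral_Ioo_eq_interval l2,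
      ← intervalIntegral.integral_of_le hx.1.le, (h.interval_diff _ _).1,
      sub h.rho.integrable c x, sub h.eta.integrable (fR ρ η β c) (fR ρ η β x),
      sub h.eta.integrable (gR ρ η β x) (gR ρ η β c), sub h.rho.integrable (gR ρ η β x) (gR ρ η β c)]
    linarith
  · obtain ⟨i1, i2, i3, l1, l2⟩ := inter x hx
    have hxm := (hFG x (hc.trans hx.1) hx.2).mean
    have hcm := hcp.mean
    rw [d₀.setIntegral_id measurableSet_Iic, d₁.setIntegral_id measurableSet_Iio,
      d₂.setIntegral_id measurableSet_Ioi, (mom _ _ _ measurableSet_Ioo).2,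
      (mom _ _ _ measurableSet_Ioo).2, (mom _ _ _ measurableSet_Ioo).2, i1, i2, i3,
      setIntegral_Ioo_eq_interval l1, setIntegral_Ioo_eq_interval l2,
      ← intervalIntegral.integral_of_le hx.1.le, (h.interval_diff _ _).2.1,
      sub h.rho.integrable₁ c x, sub h.eta.integrable₁ (fR ρ η β c) (fR ρ η β x),
      sub h.eta.integrable₁ (gR ρ η β x) (gR ρ η β c), sub h.rho.integrable₁ (gR ρ η β x) (gR ρ η β c)]
    linarith
  · have hcm := hcp.mass
    rw [(tot d₀).1, (tot d₁).1, (tot d₂).1, (mom _ _ _ measurableSet_Ioo).1,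
      (mom _ _ _ measurableSet_Ioo).1, (mom _ _ _ measurableSet_Ioo).1, univ_inter, univ_inter,
      univ_inter, setIntegral_Ioo_eq_interval hfe.le, setIntegral_Ioo_eq_interval hge.le,
      setIntegral_Ioo_eq_interval hce.le, (h.interval_diff _ _).1,
      sub h.rho.integrable c e, sub h.eta.integrable (fR ρ η β c) e,
      sub h.eta.integrable e (gR ρ η β c), sub h.rho.integrable e (gR ρ η β c)]
    linarith
  · have hcm := hcp.mean
    rw [(tot d₀).2, (tot d₁).2, (tot d₂).2, (mom _ _ _ measurableSet_Ioo).2,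
      (mom _ _ _ measurableSet_Ioo).2, (mom _ _ _ measurableSet_Ioo).2, univ_inter, univ_inter,
      univ_inter, setIntegral_Ioo_eq_interval hfe.le, setIntegral_Ioo_eq_interval hge.le,
      setIntegral_Ioo_eq_interval hce.le, (h.interval_diff _ _).2.1,
      sub h.rho.integrable₁ c e, sub h.eta.integrable₁ (fR ρ η β c) e,
      sub h.eta.integrable₁ e (gR ρ η β c), sub h.rho.integrable₁ e (gR ρ η β c)]
    linarith

end

end SymmetricDispersion

/-! ### Models built from martingale kernels -/

theorem lintegral_twoPoint (x p q : ℝ) (f : ℝ → ENNReal) :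
    ∫⁻ y, f y ∂(twoPoint x p q) =
      ENNReal.ofReal ((q - x) / (q - p)) * f p + ENNReal.ofReal ((x - p) / (q - p)) * f q := by
  rw [twoPoint, lintegral_add_measure, lintegral_smul_measure, lintegral_smul_measure,
    lintegral_dirac, lintegral_dirac, smul_eq_mul, smul_eq_mul]

theorem twoPoint_weights {x p q : ℝ} (hp : p < x) (hq : x < q) :
    0 ≤ (q - x) / (q - p) ∧ 0 ≤ (x - p) / (q - p) ∧ (q - x) / (q - p) + (x - p) / (q - p) = 1 ∧
      (q - x) / (q - p) * p + (x - p) / (q - p) * q = x := by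
  have h : 0 < q - p := by linarith
  refine ⟨div_nonneg (by linarith) h.le, div_nonneg (by linarith) h.le, ?_, ?_⟩ <;>
  · field_simp
    ring

theorem isProbabilityMeasure_twoPoint {x p q : ℝ} (hp : p < x) (hq : x < q) :
    IsProbabilityMeasure (twoPoint x p q) := by
  obtain ⟨h1, h2, h3, -⟩ := twoPoint_weights hp hq
  constructor
  rw [twoPoint_apply _ _ _ _ MeasurableSet.univ]
  simp only [indicator_univ, Pi.one_apply, mul_one]
  rw [← ENNReal.ofReal_add h1 h2, h3, ENNReal.ofReal_one]

theorem integrable_id_twoPoint (x p q : ℝ) : Integrable id (twoPoint x p q) := by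
  have hd : ∀ z : ℝ, Integrable id (Measure.dirac z) := fun z => integrable_dirac (by simp)
  exact ((hd p).smul_measure ENNReal.ofReal_ne_top).add_measure
    ((hd q).smul_measure ENNReal.ofReal_ne_top)

theorem integral_id_twoPoint {x p q : ℝ} (hp : p < x) (hq : x < q) :
    ∫ y, y ∂(twoPoint x p q) = x := by
  have hd : ∀ z : ℝ, Integrable (fun y : ℝ => y) (Measure.dirac z) :=
    fun z => integrable_dirac (by simp)
  obtain ⟨h1, h2, -, h4⟩ := twoPoint_weights hp hq
  rw [twoPoint, integral_add_measure ((hd p).smul_measure ENNReal.ofReal_ne_top)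
    ((hd q).smul_measure ENNReal.ofReal_ne_top), integral_smul_measure, integral_smul_measure,
    integral_dirac, integral_dirac, ENNReal.toReal_ofReal h1, ENNReal.toReal_ofReal h2]
  exact h4

theorem lintegral_twoPoint_of_affine {x p q : ℝ} (hp : p < x) (hq : x < q) {ψ : ℝ → ℝ}
    (h0 : ∀ y, 0 ≤ ψ y) {A s c : ℝ} (h1 : ψ x = A + s * (x - c)) (h2 : ψ p = A + s * (p - c))
    (h3 : ψ q = A + s * (q - c)) :
    ∫⁻ y, ENNReal.ofReal (ψ y) ∂(twoPoint x p q) = ENNReal.ofReal (ψ x) := by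
  obtain ⟨w1, w2, w3, w4⟩ := twoPoint_weights hp hq
  rw [lintegral_twoPoint, ← ENNReal.ofReal_mul w1, ← ENNReal.ofReal_mul w2,
    ← ENNReal.ofReal_add (mul_nonneg w1 (h0 _)) (mul_nonneg w2 (h0 _)), h1, h2, h3]
  congr 1
  generalize (q - x) / (q - p) = u at *
  generalize (x - p) / (q - p) = v at *
  linear_combination (A - s * c) * w3 + s * w4

theorem measurable_twoPoint {Ω : Type*} [MeasurableSpace Ω] {x p q : Ω → ℝ} (hx : Measurable x)
    (hp : Measurable p) (hq : Measurable q) :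
    Measurable fun w => twoPoint (x w) (p w) (q w) := by
  refine Measure.measurable_of_measurable_coe _ fun A hA => ?_
  simp only [twoPoint_apply _ _ _ _ hA]
  have h1 : Measurable (A.indicator (1 : ℝ → ENNReal)) := measurable_one.indicator hA
  exact ((by fun_prop : Measurable _).mul (h1.comp hp)).add
    ((by fun_prop : Measurable _).mul (h1.comp hq))

/-- A family of measures that are Dirac on `B` and two-point martingale transitions off `B` agrees
almost everywhere with a martingale Markov kernel. -/
theorem exists_martingale_kernel {Q : Measure (ℝ × ℝ)} {κ : ℝ × ℝ → Measure ℝ} {B : Set (ℝ × ℝ)}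
    (hB : MeasurableSet B) {s₁ s₂ : ℝ × ℝ → ℝ} (hs₁ : AEMeasurable s₁ Q) (hs₂ : AEMeasurable s₂ Q)
    (hκ : ∀ᵐ w ∂Q, (w ∈ B → κ w = Measure.dirac w.2) ∧
      (w ∉ B → κ w = twoPoint w.2 (s₁ w) (s₂ w) ∧ s₁ w < w.2 ∧ w.2 < s₂ w)) :
    ∃ K : Kernel (ℝ × ℝ) ℝ, IsMarkovKernel K ∧ (∀ᵐ w ∂Q, κ w = K w) ∧
      ∀ w, Integrable id (K w) ∧ ∫ y, y ∂(K w) = w.2 := by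
  classical
  set t₁ := hs₁.mk s₁
  set t₂ := hs₂.mk s₂
  have m₁ : Measurable t₁ := hs₁.measurable_mk
  have m₂ : Measurable t₂ := hs₂.measurable_mk
  -- Measurable versions of the endpoints may violate `t₁ < x < t₂` on a null set. There the kernel
  -- is replaced by a Dirac mass, which makes it Markov and a martingale transition at every point.
  set C : Set (ℝ × ℝ) := Bᶜ ∩ {w | t₁ w < w.2} ∩ {w | w.2 < t₂ w} with hC
  have hCm : MeasurableSet C := (hB.compl.inter (measurableSet_lt m₁ measurable_snd)).inter
    (measurableSet_lt measurable_snd m₂)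
  let K : Kernel (ℝ × ℝ) ℝ :=
    { toFun := fun w => if w ∈ C then twoPoint w.2 (t₁ w) (t₂ w) else Measure.dirac w.2
      measurable' := Measurable.ite hCm (measurable_twoPoint measurable_snd m₁ m₂)
        (Measure.measurable_dirac.comp measurable_snd) }
  have hK : ∀ w, K w = if w ∈ C then twoPoint w.2 (t₁ w) (t₂ w) else Measure.dirac w.2 :=
    fun w => rfl
  refine ⟨K, ⟨fun w => ?_⟩, ?_, fun w => ?_⟩
  · rw [hK]
    split_ifs with hw
    · exact isProbabilityMeasure_twoPoint hw.1.2 hw.2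
    · infer_instance
  · filter_upwards [hκ, hs₁.ae_eq_mk, hs₂.ae_eq_mk] with w h1 h2 h3
    rw [hK]
    by_cases hw : w ∈ B
    · rw [if_neg fun hc : w ∈ C => hc.1.1 hw]
      exact h1.1 hw
    · obtain ⟨e1, e2, e3⟩ := h1.2 hw
      rw [h2] at e1 e2
      rw [h3] at e1 e3
      rw [if_pos (show w ∈ C from ⟨⟨hw, e2⟩, e3⟩)]
      exact e1
  · rw [hK]
    split_ifs with hw
    · exact ⟨integrable_id_twoPoint _ _ _, integral_id_twoPoint hw.1.2 hw.2⟩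
    · exact ⟨integrable_dirac (by simp), integral_dirac _ _⟩

/-- The law of the uniform randomisation together with the time-1 price. -/
noncomputable def randomised (μ : Measure ℝ) : Measure (ℝ × ℝ) :=
  ((volume : Measure ℝ).restrict (Icc 0 1)).prod μ

instance : IsProbabilityMeasure ((volume : Measure ℝ).restrict (Icc 0 1)) := ⟨by simp⟩

instance (μ : Measure ℝ) [IsProbabilityMeasure μ] : IsProbabilityMeasure (randomised μ) := by
  unfold randomised; infer_instance

/-- The family `κ` is built from arbitrary choices and need not be measurable. Since `bind` depends
on it only up to null sets, agreement almost everywhere with a kernel is enough. -/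
theorem jointLaw_eq_compProd {μ : Measure ℝ} [IsProbabilityMeasure μ] {κ : ℝ → ℝ → Measure ℝ}
    {K : Kernel (ℝ × ℝ) ℝ} [IsMarkovKernel K] (hK : ∀ᵐ w ∂(randomised μ), κ w.1 w.2 = K w) :
    jointLaw μ κ = (randomised μ ⊗ₘ K).map fun p => (p.1.1, p.1.2, p.2) := by
  have hm : Measurable fun w : ℝ × ℝ => (K w).map fun y => (w.1, w.2, y) := by
    refine Measure.measurable_of_measurable_coe _ fun A hA => ?_
    have : ∀ w : ℝ × ℝ, ((K w).map fun y => (w.1, w.2, y)) A =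
        K w (Prod.mk w ⁻¹' ((fun p : (ℝ × ℝ) × ℝ => (p.1.1, p.1.2, p.2)) ⁻¹' A)) := fun w => by
      rw [Measure.map_apply (by fun_prop) hA]; rfl
    simp only [this]
    exact Kernel.measurable_kernel_prodMk_left ((by fun_prop : Measurable fun
      p : (ℝ × ℝ) × ℝ => (p.1.1, p.1.2, p.2)) hA)
  have h1 : jointLaw μ κ = (randomised μ).bind fun w => (K w).map fun y => (w.1, w.2, y) := by
    unfold jointLaw Measure.bind
    rw [← randomised]
    congr 1
    refine Measure.map_congr ?_
    filter_upwards [hK] with w hw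
    rw [hw]
  rw [h1]
  ext A hA
  rw [Measure.bind_apply hA hm.aemeasurable, Measure.map_apply (by fun_prop) hA,
    Measure.compProd_apply ((by fun_prop : Measurable fun
      p : (ℝ × ℝ) × ℝ => (p.1.1, p.1.2, p.2)) hA)]
  refine lintegral_congr fun w => ?_
  rw [Measure.map_apply (by fun_prop) hA]
  rfl

theorem lintegral_jointLaw {μ : Measure ℝ} [IsProbabilityMeasure μ] {κ : ℝ → ℝ → Measure ℝ}
    {K : Kernel (ℝ × ℝ) ℝ} [IsMarkovKernel K] (hK : ∀ᵐ w ∂(randomised μ), κ w.1 w.2 = K w)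
    {f : ℝ × ℝ × ℝ → ENNReal} (hf : Measurable f) :
    ∫⁻ ω, f ω ∂(jointLaw μ κ) = ∫⁻ w, ∫⁻ y, f (w.1, w.2, y) ∂(κ w.1 w.2) ∂(randomised μ) := by
  rw [jointLaw_eq_compProd hK, lintegral_map hf (by fun_prop),
    Measure.lintegral_compProd (by fun_prop)]
  refine lintegral_congr_ae ?_
  filter_upwards [hK] with w hw
  rw [hw]

theorem tripleProcess_one (w : ℝ × ℝ × ℝ) : tripleProcess 1 w = w.2.1 := by simp [tripleProcess]

theorem tripleProcess_two (w : ℝ × ℝ × ℝ) : tripleProcess 2 w = w.2.2 := by simp [tripleProcess]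

theorem randomised_map_snd (μ : Measure ℝ) [IsProbabilityMeasure μ] :
    (randomised μ).map Prod.snd = μ := by
  rw [randomised, Measure.map_snd_prod, measure_univ, one_smul]

/-- Time-1 events are preimages of sets of pairs `(u, x)`, so integrals over them disintegrate
through `K`, and the mean of `K` gives the martingale step from 1 to 2. At time 0 the σ-algebra is
trivial and only the zero mean of `μ` is needed. -/
theorem isModel_jointLaw {μ ν : Measure ℝ} [IsProbabilityMeasure μ] {κ : ℝ → ℝ → Measure ℝ}
    {K : Kernel (ℝ × ℝ) ℝ} [IsMarkovKernel K] (hK : ∀ᵐ w ∂(randomised μ), κ w.1 w.2 = K w)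
    (hKm : ∀ w, Integrable id (K w) ∧ ∫ y, y ∂(K w) = w.2)
    (hμ : Integrable id μ) (hν : Integrable id ν) (hμ0 : ∫ x, x ∂μ = 0)
    (hlaw : ∀ A, MeasurableSet A → ∫⁻ w, κ w.1 w.2 A ∂(randomised μ) = ν A) :
    IsModel μ ν (jointLaw μ κ) tripleFiltration tripleProcess := by
  have hP := jointLaw_eq_compProd hK
  set E : (ℝ × ℝ) × ℝ → ℝ × ℝ × ℝ := fun p => (p.1.1, p.1.2, p.2) with hE
  have hEm : Measurable E := by fun_prop
  have hprob : IsProbabilityMeasure (jointLaw μ κ) := by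
    rw [hP]; exact Measure.isProbabilityMeasure_map hEm.aemeasurable
  have hZ1 : (tripleProcess 1) = fun w => w.2.1 := funext tripleProcess_one
  have hZ2 : (tripleProcess 2) = fun w => w.2.2 := funext tripleProcess_two
  have hZ0 : (tripleProcess 0) = fun _ => 0 := by ext w; simp [tripleProcess]
  have law1 : (jointLaw μ κ).map (tripleProcess 1) = μ := by
    rw [hZ1, hP, Measure.map_map (by fun_prop) hEm]
    change ((randomised μ) ⊗ₘ K).map (Prod.snd ∘ Prod.fst) = μ
    rw [← Measure.map_map measurable_snd measurable_fst]
    change ((randomised μ) ⊗ₘ K).fst.map _ = μ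
    rw [Measure.fst_compProd, randomised_map_snd]
  have law2 : (jointLaw μ κ).map (tripleProcess 2) = ν := by
    ext A hA
    rw [hZ2, hP, Measure.map_map (by fun_prop) hEm, Measure.map_apply (by fun_prop) hA,
      Measure.compProd_apply (by
        exact (by fun_prop : Measurable ((fun w : ℝ × ℝ × ℝ => w.2.2) ∘ E)) hA), ← hlaw A hA]
    refine lintegral_congr_ae ?_
    filter_upwards [hK] with w hw
    rw [hw]; rfl
  have int1 : Integrable (fun w : ℝ × ℝ × ℝ => w.2.1) (jointLaw μ κ) := by
    rw [← law1, hZ1] at hμ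
    exact hμ.comp_measurable (by fun_prop)
  have int2 : Integrable (fun w : ℝ × ℝ × ℝ => w.2.2) (jointLaw μ κ) := by
    rw [← law2, hZ2] at hν
    exact hν.comp_measurable (by fun_prop)
  have F0 : tripleFiltration 0 = ⊥ := rfl
  have F1 : tripleFiltration 1 =
      MeasurableSpace.comap (fun w : ℝ × ℝ × ℝ => (w.1, w.2.1)) inferInstance := rfl
  have F2 : tripleFiltration 2 = (inferInstance : MeasurableSpace (ℝ × ℝ × ℝ)) := rfl
  have sm1 : StronglyMeasurable[tripleFiltration 1] fun w : ℝ × ℝ × ℝ => w.2.1 := by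
    refine Measurable.stronglyMeasurable ?_
    rw [F1]
    exact measurable_snd.comp (comap_measurable fun w : ℝ × ℝ × ℝ => (w.1, w.2.1))
  have adapted : StronglyAdapted tripleFiltration tripleProcess := by
    intro i
    fin_cases i
    · change StronglyMeasurable[tripleFiltration 0] (tripleProcess 0)
      rw [hZ0]
      exact stronglyMeasurable_const
    · change StronglyMeasurable[tripleFiltration 1] (tripleProcess 1)
      rw [hZ1]
      exact sm1
    · change StronglyMeasurable[tripleFiltration 2] (tripleProcess 2)
      rw [hZ2]
      refine Measurable.stronglyMeasurable ?_
      rw [F2]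
      fun_prop
  have restr : ∀ S : Set (ℝ × ℝ), MeasurableSet S → ∀ f : ℝ × ℝ × ℝ → ℝ, Measurable f →
      Integrable f (jointLaw μ κ) →
      ∫ ω in (fun w : ℝ × ℝ × ℝ => (w.1, w.2.1)) ⁻¹' S, f ω ∂(jointLaw μ κ) =
        ∫ w in S, ∫ y, f (w.1, w.2, y) ∂(K w) ∂(randomised μ) := by
    intro S hS f hf hfi
    have hpre : E ⁻¹' ((fun w : ℝ × ℝ × ℝ => (w.1, w.2.1)) ⁻¹' S) = S ×ˢ univ := by
      ext p; simp [hE]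
    rw [hP, setIntegral_map ((by fun_prop : Measurable fun w : ℝ × ℝ × ℝ => (w.1, w.2.1)) hS)
      hf.aestronglyMeasurable hEm.aemeasurable, hpre, Measure.setIntegral_compProd hS
      MeasurableSet.univ]
    · simp only [Measure.restrict_univ]; rfl
    · rw [hP] at hfi
      exact (hfi.comp_measurable hEm).integrableOn
  have mean2 : ∫ ω, ω.2.2 ∂(jointLaw μ κ) = ∫ ω, ω.2.1 ∂(jointLaw μ κ) := by
    have r1 := restr univ MeasurableSet.univ (fun ω => ω.2.2) (by fun_prop) int2
    have r2 := restr univ MeasurableSet.univ (fun ω => ω.2.1) (by fun_prop) int1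
    simp only [preimage_univ, Measure.restrict_univ] at r1 r2
    rw [r1, r2]
    simp only [fun w => (hKm w).2, integral_const, probReal_univ, one_smul]
  have mean1 : ∫ ω, ω.2.1 ∂(jointLaw μ κ) = 0 := by
    rw [← hμ0]
    conv_rhs => rw [← law1, hZ1]
    rw [integral_map (by fun_prop) (by fun_prop)]
  refine ⟨hprob, ⟨adapted, ?_⟩, law1, law2⟩
  have diag : ∀ i, Integrable (tripleProcess i) (jointLaw μ κ) →
      (jointLaw μ κ)[tripleProcess i | tripleFiltration i] =ᵐ[jointLaw μ κ] tripleProcess i :=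
    fun i hi => by
      rw [condExp_of_stronglyMeasurable (tripleFiltration.le i) (adapted i) hi]
  have step : (jointLaw μ κ)[tripleProcess 2 | tripleFiltration 1] =ᵐ[jointLaw μ κ]
      tripleProcess 1 := by
    rw [hZ1, hZ2]
    refine (ae_eq_condExp_of_forall_setIntegral_eq (tripleFiltration.le 1) int2
      (fun s _ _ => int1.integrableOn) (fun s hs _ => ?_) sm1.aestronglyMeasurable).symm
    rw [F1] at hs
    obtain ⟨S, hS, rfl⟩ := hs
    rw [restr S hS (fun ω => ω.2.2) (by fun_prop) int2,
      restr S hS (fun ω => ω.2.1) (by fun_prop) int1]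
    simp only [fun w => (hKm w).2, integral_const, probReal_univ, one_smul]
  have start : ∀ i, ∫ ω, tripleProcess i ω ∂(jointLaw μ κ) = 0 →
      (jointLaw μ κ)[tripleProcess i | tripleFiltration 0] =ᵐ[jointLaw μ κ] tripleProcess 0 :=
    fun i hi => by
      rw [F0, condExp_bot, hi, hZ0]
  intro i j hij
  fin_cases i <;> fin_cases j
  · exact start 0 (by rw [hZ0]; simp)
  · exact start 1 (by rw [hZ1]; exact mean1)
  · exact start 2 (by rw [hZ2, mean2]; exact mean1)
  · exact absurd hij (by decide)
  · exact diag 1 (by rw [hZ1]; exact int1)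
  · exact step
  · exact absurd hij (by decide)
  · exact absurd hij (by decide)
  · exact diag 2 (by rw [hZ2]; exact int2)

theorem isExerciseRule_of_measurableSet {τ : ℝ × ℝ × ℝ → WithTop (Fin 3)} {S : Set (ℝ × ℝ)}
    (hS : MeasurableSet S)
    (h1 : ∀ ω, (ω.1, ω.2.1) ∈ S → τ ω = ((1 : Fin 3) : WithTop (Fin 3)))
    (h2 : ∀ ω, (ω.1, ω.2.1) ∉ S → τ ω = ((2 : Fin 3) : WithTop (Fin 3))) :
    IsExerciseRule tripleFiltration τ := by
  refine ⟨fun i => ?_, fun ω => ?_⟩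
  · fin_cases i
    · have he : {ω | τ ω ≤ ((0 : Fin 3) : WithTop (Fin 3))} = ∅ := by
        ext ω
        rw [mem_ofPred_eq, mem_empty_iff_false, iff_false]
        by_cases h : (ω.1, ω.2.1) ∈ S
        · rw [h1 ω h]; decide
        · rw [h2 ω h]; decide
      change MeasurableSet[tripleFiltration 0] {ω | τ ω ≤ ((0 : Fin 3) : WithTop (Fin 3))}
      rw [he]
      exact @MeasurableSet.empty _ (tripleFiltration 0)
    · refine ⟨S, hS, ?_⟩
      ext ω
      simp only [mem_ofPred_eq, mem_preimage]
      by_cases h : (ω.1, ω.2.1) ∈ S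
      · rw [h1 ω h]; simp only [h, true_iff]; decide
      · rw [h2 ω h]; simp only [h, false_iff]; decide
    · have he : {ω | τ ω ≤ ((2 : Fin 3) : WithTop (Fin 3))} = univ := by
        ext ω
        rw [mem_ofPred_eq, eq_true (mem_univ ω), iff_true]
        by_cases h : (ω.1, ω.2.1) ∈ S
        · rw [h1 ω h]; decide
        · rw [h2 ω h]
      change MeasurableSet[tripleFiltration 2] {ω | τ ω ≤ ((2 : Fin 3) : WithTop (Fin 3))}
      rw [he]
      exact @MeasurableSet.univ _ (tripleFiltration 2)
  · by_cases h : (ω.1, ω.2.1) ∈ S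
    · exact Or.inl (h1 ω h)
    · exact Or.inr (h2 ω h)

/-- Optimality of a candidate, from the pointwise complementary slackness of the payoff and the
superhedge generated by `ψ`. -/
theorem optimalWithoutGap_of_slackness {μ ν : Measure ℝ} [IsProbabilityMeasure μ] {a b ψ : ℝ → ℝ}
    (hb0 : ∀ x, 0 ≤ b x) (hba : ∀ x, b x ≤ a x) (ha : ConvexOn ℝ univ a) (hbc : ConvexOn ℝ univ b)
    (hψ : ConvexOn ℝ univ ψ) (hb : ∀ x, b x ≤ ψ x)
    (hμ : Integrable id μ) (hν : Integrable id ν) (hμ0 : ∫ x, x ∂μ = 0)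
    {κ : ℝ → ℝ → Measure ℝ} {τ : ℝ × ℝ × ℝ → WithTop (Fin 3)} {S B : Set (ℝ × ℝ)}
    (hS : MeasurableSet S)
    (hτ1 : ∀ ω, (ω.1, ω.2.1) ∈ S → τ ω = ((1 : Fin 3) : WithTop (Fin 3)))
    (hτ2 : ∀ ω, (ω.1, ω.2.1) ∉ S → τ ω = ((2 : Fin 3) : WithTop (Fin 3)))
    (hB : MeasurableSet B) {s₁ s₂ : ℝ → ℝ} (hs₁ : AEMeasurable s₁ μ) (hs₂ : AEMeasurable s₂ μ)
    (hκ : ∀ᵐ w ∂(randomised μ), (w ∈ B → κ w.1 w.2 = Measure.dirac w.2) ∧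
      (w ∉ B → κ w.1 w.2 = twoPoint w.2 (s₁ w.2) (s₂ w.2) ∧ s₁ w.2 < w.2 ∧ w.2 < s₂ w.2))
    (hlaw : ∀ A, MeasurableSet A → ∫⁻ x, (∫⁻ u in Icc (0 : ℝ) 1, κ u x A) ∂μ = ν A)
    (hexercise : ∀ᵐ w ∂(randomised μ), w ∈ S → ψ w.2 ≤ a w.2 ∧
      ∫⁻ y, ENNReal.ofReal (ψ y) ∂(κ w.1 w.2) = ENNReal.ofReal (ψ w.2))
    (hcont : ∀ᵐ w ∂(randomised μ), w ∉ S → a w.2 ≤ ψ w.2 ∧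
      ∫⁻ y, ENNReal.ofReal (ψ y) ∂(κ w.1 w.2) = ∫⁻ y, ENNReal.ofReal (b y) ∂(κ w.1 w.2)) :
    OptimalWithoutGap.{u} μ ν a b ψ (jointLaw μ κ) τ := by
  classical
  have hsnd : (randomised μ).map Prod.snd = μ := randomised_map_snd μ
  rw [← hsnd] at hs₁ hs₂
  obtain ⟨K, hKM, hK, hKm⟩ := exists_martingale_kernel (κ := fun w => κ w.1 w.2) hB
    (hs₁.comp_measurable measurable_snd) (hs₂.comp_measurable measurable_snd) hκ
  have hM := isModel_jointLaw hK hKm hμ hν hμ0 fun A hA => by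
    have hmeas : AEMeasurable (fun w : ℝ × ℝ => κ w.1 w.2 A) (randomised μ) :=
      ⟨fun w => K w A, K.measurable_coe hA, hK.mono fun w hw => by simp only [hw]⟩
    rw [← hlaw A hA]
    exact lintegral_prod_symm _ hmeas
  refine optimalWithoutGap_of_price_eq hb0 hba ha hM (isExerciseRule_of_measurableSet hS hτ1 hτ2)
    hψ hb ?_
  have mψ : Measurable fun x => ENNReal.ofReal (ψ x) := (convexOn_univ_continuous hψ).measurable.ennreal_ofReal
  have ma : Measurable fun x => ENNReal.ofReal (a x) := (convexOn_univ_continuous ha).measurable.ennreal_ofReal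
  have mb : Measurable fun x => ENNReal.ofReal (b x) := (convexOn_univ_continuous hbc).measurable.ennreal_ofReal
  have mφ : Measurable fun x => ENNReal.ofReal (generatedPhi a ψ x) :=
    (((convexOn_univ_continuous ha).sub (convexOn_univ_continuous hψ)).max continuous_const).measurable.ennreal_ofReal
  have hne : ((2 : Fin 3) : WithTop (Fin 3)) ≠ ((1 : Fin 3) : WithTop (Fin 3)) := by decide
  have hprice : price a b (jointLaw μ κ) tripleProcess τ = ∫⁻ ω, (if (ω.1, ω.2.1) ∈ S then
      ENNReal.ofReal (a ω.2.1) else ENNReal.ofReal (b ω.2.2)) ∂(jointLaw μ κ) := by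
    refine lintegral_congr fun ω => ?_
    rw [tripleProcess_one, tripleProcess_two]
    by_cases h : (ω.1, ω.2.1) ∈ S
    · rw [if_pos (hτ1 ω h), if_pos h]
    · rw [if_neg (by rw [hτ2 ω h]; exact hne), if_neg h]
  have hψν : ∫⁻ x, ENNReal.ofReal (ψ x) ∂ν =
      ∫⁻ w, ∫⁻ y, ENNReal.ofReal (ψ y) ∂(κ w.1 w.2) ∂(randomised μ) := by
    rw [← hM.law_two, lintegral_map mψ (by rw [funext tripleProcess_two]; fun_prop)]
    simp only [tripleProcess_two]
    exact lintegral_jointLaw hK (f := fun ω => ENNReal.ofReal (ψ ω.2.2))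
      (mψ.comp (measurable_snd.comp measurable_snd))
  have hφμ : ∫⁻ x, ENNReal.ofReal (generatedPhi a ψ x) ∂μ =
      ∫⁻ w, ENNReal.ofReal (generatedPhi a ψ w.2) ∂(randomised μ) := by
    conv_lhs => rw [← hsnd]
    rw [lintegral_map mφ measurable_snd]
  have mpay : Measurable fun ω : ℝ × ℝ × ℝ => if (ω.1, ω.2.1) ∈ S then
      ENNReal.ofReal (a ω.2.1) else ENNReal.ofReal (b ω.2.2) :=
    Measurable.ite ((by fun_prop : Measurable fun ω : ℝ × ℝ × ℝ => (ω.1, ω.2.1)) hS)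
      (ma.comp (measurable_fst.comp measurable_snd)) (mb.comp (measurable_snd.comp measurable_snd))
  -- Price and cost are now both integrals over `(u, x)` and are compared pointwise: `a = (a - ψ) +
  -- ψ` where the rule stops, and the integrals of `b` and `ψ` agree where it continues.
  rw [hprice, hψν, hφμ, ← lintegral_add_left (f := fun w : ℝ × ℝ =>
    ENNReal.ofReal (generatedPhi a ψ w.2)) (mφ.comp measurable_snd), lintegral_jointLaw hK mpay]
  refine lintegral_congr_ae ?_
  filter_upwards [hexercise, hcont, hK] with w h1 h2 h3
  by_cases hw : w ∈ S
  · obtain ⟨e1, e2⟩ := h1 hw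
    have hp : 0 ≤ ψ w.2 := (hb0 _).trans (hb _)
    have hw' : (w.1, w.2) ∈ S := hw
    simp only [hw', if_true, lintegral_const]
    rw [e2, h3, measure_univ, mul_one, generatedPhi, max_eq_left (by linarith),
      ← ENNReal.ofReal_add (by linarith) hp]
    congr 1; ring
  · obtain ⟨e1, e2⟩ := h2 hw
    have hw' : (w.1, w.2) ∉ S := hw
    simp only [hw', if_false]
    rw [e2, generatedPhi, max_eq_right (by linarith), ENNReal.ofReal_zero, zero_add]

/-! ### Transport of the pieces of `μ` -/

theorem lintegral_unit_ite {r : ℝ} (h0 : 0 ≤ r) (h1 : r ≤ 1) (m₁ m₂ : ENNReal) :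
    ∫⁻ u in Icc (0 : ℝ) 1, (if u ≤ r then m₁ else m₂) =
      ENNReal.ofReal r * m₁ + ENNReal.ofReal (1 - r) * m₂ := by
  rw [← Icc_union_Ioc_eq_Icc h0 h1, lintegral_union measurableSet_Ioc
    (disjoint_left.2 fun u hu hu' => not_lt.2 hu.2 hu'.1),
    setLIntegral_congr_fun (g := fun _ => m₁) measurableSet_Icc fun u hu => if_pos hu.2,
    setLIntegral_congr_fun (g := fun _ => m₂) measurableSet_Ioc fun u hu => if_neg (not_le.2 hu.1)]
  simp [mul_comm]

theorem setLIntegral_dens {h : ℝ → ℝ} (hm : Measurable h) {J : Set ℝ} (hJ : MeasurableSet J)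
    (f : ℝ → ENNReal) :
    ∫⁻ x in J, f x ∂(dens h) = ∫⁻ x, ENNReal.ofReal (J.indicator h x) * f x := by
  rw [← dens_indicator h hJ, lintegral_dens (hm.indicator hJ)]

theorem dens_add {h k : ℝ → ℝ} (hh : IsDensity h) (hk : IsDensity k) :
    dens (fun x => h x + k x) = dens h + dens k := by
  unfold dens
  rw [← withDensity_add_left (by have := hh.measurable; fun_prop)]
  congr 1
  ext x
  exact ENNReal.ofReal_add (hh.nonneg x) (hk.nonneg x)

theorem IsDensity.add {h k : ℝ → ℝ} (hh : IsDensity h) (hk : IsDensity k) :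
    IsDensity fun x => h x + k x where
  measurable := hh.measurable.add hk.measurable
  nonneg x := add_nonneg (hh.nonneg x) (hk.nonneg x)
  integrable := hh.integrable.add hk.integrable
  integrable₁ := (hh.integrable₁.add hk.integrable₁).congr
    (Filter.Eventually.of_forall fun x => by simp only [Pi.add_apply]; ring)

theorem dens_congr_ae {h k : ℝ → ℝ} (hhk : ∀ᵐ x, h x = k x) : dens h = dens k :=
  withDensity_congr_ae (hhk.mono fun x hx => by simp only [hx])

theorem IsDensity.comp_neg {h : ℝ → ℝ} (hh : IsDensity h) : IsDensity fun x => h (-x) where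
  measurable := hh.measurable.comp measurable_neg
  nonneg x := hh.nonneg _
  integrable := hh.integrable.comp_neg
  integrable₁ := hh.integrable₁.comp_neg.neg.congr
    (Filter.Eventually.of_forall fun x => by simp)

theorem lintegral_dens_comp_neg {h : ℝ → ℝ} (hm : Measurable h) (f : ℝ → ENNReal) :
    ∫⁻ x, f (-x) ∂(dens h) = ∫⁻ x, f x ∂(dens fun x => h (-x)) := by
  rw [lintegral_dens hm, lintegral_dens (h := fun x => h (-x)) (hm.comp measurable_neg),
    ← lintegral_neg_eq_self fun x => ENNReal.ofReal (h x) * f (-x)]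
  simp only [neg_neg]

theorem dens_neg_preimage {h : ℝ → ℝ} (hm : Measurable h) {A : Set ℝ} (hA : MeasurableSet A) :
    dens h (Neg.neg ⁻¹' A) = dens (fun x => h (-x)) A := by
  rw [← lintegral_indicator_one hA, ← lintegral_dens_comp_neg hm,
    ← lintegral_indicator_one (measurable_neg hA)]
  rfl

theorem twoPoint_neg {x p q : ℝ} {A : Set ℝ} (hA : MeasurableSet A) :
    twoPoint (-x) (-q) (-p) A = twoPoint x p q (Neg.neg ⁻¹' A) := by
  rw [twoPoint_apply _ _ _ _ hA, twoPoint_apply _ _ _ _ (measurable_neg hA), add_comm,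
    show (-x - -q) / (-p - -q) = (q - x) / (q - p) by congr 1 <;> ring,
    show (-p - -x) / (-p - -q) = (x - p) / (q - p) by congr 1 <;> ring]
  rfl

theorem lintegral_split {m : Measure ℝ} [NullSingletonClass m] {p q r : ℝ} (hp : 0 < p)
    (hpq : p < q) (hqr : q < r) (F : ℝ → ENNReal) :
    ∫⁻ x, F x ∂m = ∫⁻ x in {x | |x| < p}, F x ∂m + ∫⁻ x in {x | p < |x| ∧ |x| < q}, F x ∂m +
      (∫⁻ x in Ioo q r, F x ∂m + ∫⁻ x in Ioo (-r) (-q), F x ∂m) +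
        ∫⁻ x in {x | r ≤ |x|}, F x ∂m := by
  have m1 : MeasurableSet {x : ℝ | p < |x| ∧ |x| < q} :=
    (measurableSet_lt measurable_const measurable_abs).inter
      (measurableSet_lt measurable_abs measurable_const)
  have m2 : MeasurableSet {x : ℝ | r ≤ |x|} := measurableSet_le measurable_const measurable_abs
  rw [← lintegral_union measurableSet_Ioo, ← lintegral_union m1,
    ← lintegral_union (measurableSet_Ioo.union measurableSet_Ioo), ← lintegral_union m2,
    ← setLIntegral_univ]
  · refine setLIntegral_congr ?_
    have hnull : ∀ᵐ x ∂m, x ∉ ({p, -p, q, -q} : Set ℝ) :=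
      (Set.toFinite ({p, -p, q, -q} : Set ℝ)).measure_zero m |> measure_eq_zero_iff_ae_notMem.1
    filter_upwards [hnull] with x hx
    simp only [mem_insert_iff, mem_singleton_iff, not_or] at hx
    refine propext ⟨fun _ => ?_, fun _ => trivial⟩
    change ((|x| < p ∨ p < |x| ∧ |x| < q) ∨ (q < x ∧ x < r) ∨ -r < x ∧ x < -q) ∨ r ≤ |x|
    rcases le_total 0 x with h0 | h0
    · rw [abs_of_nonneg h0]
      grind
    · rw [abs_of_nonpos h0]
      grind
  · rw [disjoint_left]
    rintro x hx (hx' : r ≤ |x|)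
    change (|x| < p ∨ p < |x| ∧ |x| < q) ∨ (q < x ∧ x < r) ∨ -r < x ∧ x < -q at hx
    rcases le_total 0 x with h0 | h0
    · rw [abs_of_nonneg h0] at *
      grind
    · rw [abs_of_nonpos h0] at *
      grind
  · rw [disjoint_left]
    rintro x hx hx'
    change |x| < p ∨ p < |x| ∧ |x| < q at hx
    change (q < x ∧ x < r) ∨ -r < x ∧ x < -q at hx'
    rcases le_total 0 x with h0 | h0
    · rw [abs_of_nonneg h0] at *
      grind
    · rw [abs_of_nonpos h0] at *
      grind
  · rw [disjoint_left]
    rintro x (hx : |x| < p) (hx' : p < |x| ∧ |x| < q)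
    linarith [hx'.1]
  · rw [disjoint_left]
    rintro x hx hx'
    linarith [hx.1, hx'.2]

namespace SymmetricDispersion

variable {μ ν : Measure ℝ} {ρ η : ℝ → ℝ} {α β : EReal} {e : ℝ}
variable [IsProbabilityMeasure μ] [IsProbabilityMeasure ν]
  (h : SymmetricDispersion μ ν ρ η α β e)

section
include h

omit [IsProbabilityMeasure μ] [IsProbabilityMeasure ν] h in
theorem measurableSet_abs_between (p q : ℝ) : MeasurableSet {x : ℝ | p < |x| ∧ |x| < q} :=
  (measurableSet_lt measurable_const measurable_abs).inter
      (measurableSet_lt measurable_abs measurable_const)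

omit [IsProbabilityMeasure μ] [IsProbabilityMeasure ν] in
/-- The part of `μ` inside the dispersion interval is kept in place as far as `ν` allows, and the
rest is transported by a Hobson-Klimmek coupling. -/
theorem lintegral_mixture {J : Set ℝ} (hJ : MeasurableSet J) (hJe : ∀ x ∈ J, |x| < e)
    {ξ : ℝ → ℝ} {γ s : ℝ} {t : EReal}
    (hk : HKDens (J.indicator fun z => ρ z - η z) ξ γ s t) {A : Set ℝ} (hA : MeasurableSet A) :
    ∫⁻ x in J, (∫⁻ u in Icc (0 : ℝ) 1, if u ≤ η x / ρ x then Measure.dirac x A else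
      hkKernel (J.indicator fun z => ρ z - η z) ξ γ x A) ∂(dens ρ) =
      dens (J.indicator η) A + dens ξ A := by
  rw [setLIntegral_dens h.measurable_rho hJ, ← lintegral_indicator_one (μ := dens (J.indicator η)) hA,
    ← hk.lintegral_hkKernel hA, lintegral_dens (h.measurable_eta.indicator hJ),
    lintegral_dens hk.source.measurable, ← lintegral_add_left]
  · refine lintegral_congr fun x => ?_
    by_cases hx : x ∈ J
    · have hρη := h.inside x (hJe x hx)
      have hη := h.eta_nonneg x
      have hρ : 0 < ρ x := hη.trans_lt hρη
      have r0 : 0 ≤ η x / ρ x := div_nonneg hη hρ.le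
      rw [lintegral_unit_ite r0 ((div_le_one hρ).2 hρη.le), indicator_of_mem hx, indicator_of_mem hx,
        indicator_of_mem hx, mul_add, ← mul_assoc, ← mul_assoc, ← ENNReal.ofReal_mul hρ.le,
        ← ENNReal.ofReal_mul hρ.le, mul_div_cancel₀ _ hρ.ne', mul_sub, mul_one,
        mul_div_cancel₀ _ hρ.ne', Measure.dirac_apply' _ hA]
    · simp [hx]
  · exact ((h.measurable_eta.indicator hJ).ennreal_ofReal).mul (measurable_one.indicator hA)

/-- The left-curtain image is the reflection of the right-curtain image. As `fR c ≥ 0`, the two do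
not overlap and combine to even densities. -/
theorem lintegral_left_add_right {c : ℝ} (hc : 0 < c) (hce : c < e) (hf : 0 ≤ fR ρ η β c)
    {A : Set ℝ} (hA : MeasurableSet A) :
    ∫⁻ t in Ioo c e, twoPoint t (fR ρ η β t) (gR ρ η β t) A ∂(dens ρ) +
      ∫⁻ t in Ioo (-e) (-c), twoPoint t (fL ρ η β t) (gL ρ η β t) A ∂(dens ρ) =
      dens ({z | fR ρ η β c < |z| ∧ |z| < e}.indicator η) A +
      dens ({z | e < |z| ∧ |z| < gR ρ η β c}.indicator fun z => η z - ρ z) A := by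
  have hcp := h.curtainPair hc hce
  have d₁ : IsDensity ((Ioo (fR ρ η β c) e).indicator η) := h.eta.indicator measurableSet_Ioo
  have d₂ : IsDensity ((Ioo e (gR ρ η β c)).indicator fun z => η z - ρ z) := by
    refine h.isDensity_outside measurableSet_Ioo fun z hz => ⟨hz.1.trans_le (le_abs_self z), ?_⟩
    exact (ordConnected_symInterval (β := β)).out h.e_mem hcp.g_mem ⟨hz.1.le, hz.2.le⟩
  have hleft : ∫⁻ t in Ioo (-e) (-c), twoPoint t (fL ρ η β t) (gL ρ η β t) A ∂(dens ρ) =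
      ∫⁻ t in Ioo c e, twoPoint t (fR ρ η β t) (gR ρ η β t) (Neg.neg ⁻¹' A) ∂(dens ρ) := by
    rw [setLIntegral_dens h.measurable_rho measurableSet_Ioo,
      setLIntegral_dens h.measurable_rho measurableSet_Ioo, ← lintegral_neg_eq_self]
    refine lintegral_congr fun t => ?_
    by_cases ht : t ∈ Ioo c e
    · obtain ⟨l1, l2⟩ := h.left_eq (hc.trans ht.1) ht.2
      rw [indicator_of_mem ht, indicator_of_mem (show -t ∈ Ioo (-e) (-c) from
        ⟨by linarith [ht.2], by linarith [ht.1]⟩), h.rho_even, l1, l2, twoPoint_neg hA]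
    · rw [indicator_of_notMem ht, indicator_of_notMem (show -t ∉ Ioo (-e) (-c) from
        fun h' => ht ⟨by linarith [h'.2], by linarith [h'.1]⟩)]
      simp
  have comb : ∀ {k : ℝ → ℝ} (p q : ℝ), 0 ≤ p → (∀ z, k (-z) = k z) →
      IsDensity ((Ioo p q).indicator k) → dens ((Ioo p q).indicator k) A +
        dens ((Ioo p q).indicator k) (Neg.neg ⁻¹' A) = dens ({z | p < |z| ∧ |z| < q}.indicator k) A := by
    intro k p q hp hk hd
    rw [dens_neg_preimage hd.measurable hA, ← Measure.add_apply, ← dens_add hd hd.comp_neg]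
    congr 2
    ext z
    rcases le_or_gt z 0 with hz | hz
    · have n1 : z ∉ Ioo p q := fun h' => by linarith [h'.1]
      by_cases hz' : -z ∈ Ioo p q
      · rw [indicator_of_notMem n1, indicator_of_mem hz', indicator_of_mem (show z ∈ _ by
          change p < |z| ∧ |z| < q
          rw [abs_of_nonpos hz]; exact hz'), zero_add, hk]
      · rw [indicator_of_notMem n1, indicator_of_notMem hz', indicator_of_notMem (show z ∉ _ by
          change ¬ (p < |z| ∧ |z| < q)
          rw [abs_of_nonpos hz]; exact hz'), zero_add]
    · have n1 : -z ∉ Ioo p q := fun h' => by linarith [h'.1]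
      by_cases hz' : z ∈ Ioo p q
      · rw [indicator_of_notMem n1, indicator_of_mem hz', indicator_of_mem (show z ∈ _ by
          change p < |z| ∧ |z| < q
          rw [abs_of_pos hz]; exact hz'), add_zero]
      · rw [indicator_of_notMem n1, indicator_of_notMem hz', indicator_of_notMem (show z ∉ _ by
          change ¬ (p < |z| ∧ |z| < q)
          rw [abs_of_pos hz]; exact hz'), add_zero]
  rw [hleft, h.lintegral_right hc hce hA, h.lintegral_right hc hce (measurable_neg hA),
    ← comb _ _ hf h.eta_even d₁,
    ← comb _ _ h.e_pos.le (fun z => by rw [h.eta_even, h.rho_even]) d₂]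
  ring

omit [IsProbabilityMeasure ν] in
theorem integral_mu : ∫ x, x ∂μ = 0 := by
  have h1 := h.rho.setIntegral_id MeasurableSet.univ
  rw [Measure.restrict_univ, Measure.restrict_univ] at h1
  rw [show μ = dens ρ from h.density_mu, h1]
  have h2 := integral_neg_eq_self (fun z => z * ρ z) volume
  simp only [h.rho_even, neg_mul] at h2
  rw [integral_neg] at h2
  linarith

omit [IsProbabilityMeasure ν] in
-- This absorbs boundary conventions: finitely many boundary points, and the graph `u = η x / ρ x`,
-- on which the kernel stays put (`≤`) while `tau3` does not stop (`<`).
theorem ae_randomised {N : Set ℝ} (hN : N.Finite) :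
    ∀ᵐ w ∂(randomised μ), w.2 ∉ N ∧ w.1 ≠ η w.2 / ρ w.2 := by
  have h1 : ∀ᵐ x ∂μ, x ∉ N := by
    rw [show μ = dens ρ from h.density_mu]
    exact measure_eq_zero_iff_ae_notMem.1 (hN.measure_zero _)
  have h2 : ∀ᵐ w ∂(randomised μ), w.1 ≠ η w.2 / ρ w.2 := by
    have hm : MeasurableSet {w : ℝ × ℝ | w.1 = η w.2 / ρ w.2} :=
      measurableSet_eq_fun measurable_fst ((h.measurable_eta.comp measurable_snd).div
        (h.measurable_rho.comp measurable_snd))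
    refine (measure_eq_zero_iff_ae_notMem (s := {w : ℝ × ℝ | w.1 = η w.2 / ρ w.2})).1 ?_
    rw [randomised, Measure.prod_apply_symm hm]
    refine (lintegral_congr fun y => ?_).trans lintegral_zero
    exact measure_mono_null (t := {η y / ρ y}) (fun u hu => hu) (by simp)
  exact (Measure.quasiMeasurePreserving_snd.ae h1).and h2

end

end SymmetricDispersion

/-! ### The special points and the pieces of the candidate model -/

theorem indicator_even {S : Set ℝ} (hS : ∀ z, -z ∈ S ↔ z ∈ S) {k : ℝ → ℝ}
    (hk : ∀ z, k (-z) = k z) (z : ℝ) : S.indicator k (-z) = S.indicator k z := by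
  by_cases hz : z ∈ S
  · rw [indicator_of_mem hz, indicator_of_mem ((hS z).2 hz), hk]
  · rw [indicator_of_notMem hz, indicator_of_notMem (fun h => hz ((hS z).1 h))]

namespace SymmetricDispersion

variable {μ ν : Measure ℝ} {ρ η : ℝ → ℝ} {α β : EReal} {e : ℝ}
variable [IsProbabilityMeasure μ] [IsProbabilityMeasure ν]
  (h : SymmetricDispersion μ ν ρ η α β e)

section
include h

omit [IsProbabilityMeasure μ] [IsProbabilityMeasure ν] h in
theorem mem_symInterval_iff {x : ℝ} (hx : 0 ≤ x) : x ∈ symInterval β ↔ (x : EReal) < β := by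
  change ((|x| : ℝ) : EReal) < β ↔ _
  rw [abs_of_nonneg hx]

omit [IsProbabilityMeasure μ] [IsProbabilityMeasure ν] h in
theorem lt_beta_of_abs_le {z y : ℝ} (hy : (y : EReal) < β) (hz : |z| ≤ y) :
    ((|z| : ℝ) : EReal) < β :=
  lt_of_le_of_lt (by exact_mod_cast hz) hy

/-- It serves twice: with `f = fR x₃` and `y = x₄` for the centre, and with `f = y = e` when `a(e) =
b(e)`. -/
theorem hkDens_tail {f y : ℝ} (hf : 0 < f) (hfe : f ≤ e) (hey : e ≤ y) (hy : (y : EReal) < β)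
    (hmass : ∫ z in (0 : ℝ)..f, (ρ z - η z) = ∫ z in Ioi y, (η z - ρ z)) :
    HKDens ({z : ℝ | |z| < f}.indicator fun z => ρ z - η z) (tailDensity ρ η β y) f y β where
  source := h.isDensity_inside (measurableSet_lt measurable_abs measurable_const)
    fun z (hz : |z| < f) => hz.trans_le hfe
  target := h.isDensity_outside ((measurableSet_lt measurable_const measurable_abs).inter
    isOpen_symInterval.measurableSet) fun z hz => ⟨hey.trans_lt hz.1, hz.2⟩
  source_even := indicator_even (fun z => by
    change |-z| < f ↔ |z| < f
    rw [abs_neg]) fun z => by rw [h.rho_even, h.eta_even]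
  target_even := indicator_even (fun z => by
    change y < |-z| ∧ ((|-z| : ℝ) : EReal) < β ↔ y < |z| ∧ ((|z| : ℝ) : EReal) < β
    rw [abs_neg]) fun z => by rw [h.rho_even, h.eta_even]
  γ_pos := hf
  γ_le := hfe.trans hey
  a_lt := hy
  source_zero z hz := indicator_of_notMem (s := {z : ℝ | |z| < f})
    (fun h' => absurd h' (not_lt.2 hz)) _
  source_pos := ⟨-f, by linarith, fun z h1 h2 => by
    rw [indicator_of_mem (s := {z : ℝ | |z| < f}) (abs_lt.2 ⟨h1, h2⟩)]
    exact sub_pos.2 (h.inside z ((abs_lt.2 ⟨h1, h2⟩).trans_le hfe))⟩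
  target_zero_low z hz := indicator_of_notMem (fun h' => absurd h'.1 (not_lt.2 hz)) _
  target_zero_high z hz := indicator_of_notMem (fun h' => absurd h'.2 (not_lt.2 hz)) _
  target_pos z h1 h2 := by
    unfold tailDensity
    rw [indicator_of_mem (s := {z : ℝ | y < |z| ∧ ((|z| : ℝ) : EReal) < β}) ⟨h1, h2⟩]
    exact sub_pos.2 (h.outside z (hey.trans_lt h1) h2)
  mass := by
    rw [← setIntegral_Ioo_eq_interval hf.le, setIntegral_congr_fun (g := fun z => ρ z - η z)
      measurableSet_Ioo fun z hz => indicator_of_mem (s := {z : ℝ | |z| < f}) (show |z| < f by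
        rw [abs_of_pos hz.1]; exact hz.2) _, setIntegral_Ioo_eq_interval hf.le, hmass,
      ← integral_indicator measurableSet_Ioi, ← integral_indicator measurableSet_Ioi]
    refine integral_congr_ae ?_
    filter_upwards [h.eta_zero, h.rho_zero] with z h1 h2
    by_cases hz : y < z
    · have hz0 : 0 < z := (h.e_pos.trans_le hey).trans hz
      rw [indicator_of_mem (show z ∈ Ioi y from hz), indicator_of_mem (show z ∈ Ioi f from
        (hfe.trans hey).trans_lt hz)]
      unfold tailDensity
      by_cases hb : ((|z| : ℝ) : EReal) < β
      · rw [indicator_of_mem (s := {z : ℝ | y < |z| ∧ ((|z| : ℝ) : EReal) < β})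
          ⟨by rwa [abs_of_pos hz0], hb⟩]
      · rw [indicator_of_notMem (fun h' => hb h'.2), h1 (not_lt.1 hb), h2 (not_lt.1 hb), sub_zero]
    · rw [indicator_of_notMem (show z ∉ Ioi y from hz)]
      by_cases hzf : z ∈ Ioi f
      · rw [indicator_of_mem hzf]
        refine (indicator_of_notMem (fun h' => hz ?_) _).symm
        have := h'.1
        rwa [abs_of_pos (hf.trans hzf)] at this
      · rw [indicator_of_notMem hzf]

/-- This is the coupling of the ring. Here all of `μ` is moved, not only `μ - ν`, since the curtain
already supplies `ν` on `f < |z| < e`. -/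
theorem hkDens_between {f x g y : ℝ} (hf : 0 < f) (hfx : f < x) (hxe : x < e) (heg : e < g)
    (hgy : g < y) (hy : (y : EReal) < β)
    (hmass : ∫ z in f..x, ρ z = ∫ z in g..y, (η z - ρ z)) :
    HKDens ({z : ℝ | f < |z| ∧ |z| < x}.indicator ρ)
      ({z : ℝ | g < |z| ∧ |z| < y}.indicator fun z => η z - ρ z) x g y where
  source := h.rho.indicator (measurableSet_abs_between _ _)
  target := h.isDensity_outside (measurableSet_abs_between _ _) fun z hz =>
    ⟨heg.trans hz.1, lt_beta_of_abs_le hy hz.2.le⟩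
  source_even := indicator_even (fun z => by
    change f < |-z| ∧ |-z| < x ↔ f < |z| ∧ |z| < x
    rw [abs_neg]) h.rho_even
  target_even := indicator_even (fun z => by
    change g < |-z| ∧ |-z| < y ↔ g < |z| ∧ |z| < y
    rw [abs_neg]) fun z => by rw [h.rho_even, h.eta_even]
  γ_pos := hf.trans hfx
  γ_le := (hxe.trans heg).le
  a_lt := by exact_mod_cast hgy
  source_zero z hz := indicator_of_notMem (fun h' => absurd h'.2 (not_lt.2 hz)) _
  source_pos := ⟨f, hfx, fun z h1 h2 => by
    have hz : |z| = z := abs_of_pos (hf.trans h1)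
    rw [indicator_of_mem (s := {z : ℝ | f < |z| ∧ |z| < x}) ⟨by rwa [hz], by rwa [hz]⟩]
    exact (h.eta_nonneg z).trans_lt (h.inside z (by rw [hz]; exact h2.trans hxe))⟩
  target_zero_low z hz := indicator_of_notMem (fun h' => absurd h'.1 (not_lt.2 hz)) _
  target_zero_high z hz := indicator_of_notMem (fun h' => by
    have h1 : ((|z| : ℝ) : EReal) < y := by exact_mod_cast h'.2
    exact absurd h1 (not_lt.2 hz)) _
  target_pos z h1 h2 := by
    have h3 : |z| < y := by exact_mod_cast h2
    rw [indicator_of_mem (s := {z : ℝ | g < |z| ∧ |z| < y}) ⟨h1, h3⟩]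
    exact sub_pos.2 (h.outside z (heg.trans h1) (lt_beta_of_abs_le hy h3.le))
  mass := by
    have m := measurableSet_abs_between
    have hx0 := hf.trans hfx
    have hg0 := h.e_pos.trans heg
    rw [← setIntegral_Ioo_eq_interval hx0.le, setIntegral_indicator (m f x),
      setIntegral_indicator (m g y)]
    have e1 : Ioo 0 x ∩ {z : ℝ | f < |z| ∧ |z| < x} = Ioo f x := by
      ext z
      constructor
      · rintro ⟨h1, h2⟩
        have hz : |z| = z := abs_of_pos h1.1
        exact ⟨by have := h2.1; rwa [hz] at this, h1.2⟩
      · intro h1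
        have hz : |z| = z := abs_of_pos (hf.trans h1.1)
        exact ⟨⟨hf.trans h1.1, h1.2⟩, by rw [hz]; exact h1.1, by rw [hz]; exact h1.2⟩
    have e2 : Ioi x ∩ {z : ℝ | g < |z| ∧ |z| < y} = Ioo g y := by
      ext z
      constructor
      · rintro ⟨h1, h2⟩
        have hz : |z| = z := abs_of_pos (hx0.trans h1)
        exact ⟨by have := h2.1; rwa [hz] at this, by have := h2.2; rwa [hz] at this⟩
      · intro h1
        have hz : |z| = z := abs_of_pos (hg0.trans h1.1)
        exact ⟨(hxe.trans heg).trans h1.1, by rw [hz]; exact h1.1, by rw [hz]; exact h1.2⟩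
    rw [e1, e2, setIntegral_Ioo_eq_interval hfx.le, setIntegral_Ioo_eq_interval hgy.le, hmass]

theorem fR_pos {x₃ : ℝ} (hx₀ : x₀ ρ η β e < x₃) (hxe : x₃ < e) : 0 < fR ρ η β x₃ := by
  obtain ⟨h1, h2, h3⟩ := h.x₀_spec
  have := h.fR_strictMonoOn ⟨h1, h2⟩ ⟨h1.trans hx₀, hxe⟩ hx₀
  rwa [h3] at this

/-- The mass equation rearranged: beyond `gR x`, the measure `ν - μ` has exactly the room for the
central surplus on `(0, fR x)` and the ring `(fR x, x)`. The point `x₄` divides this room between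
the two. -/
theorem diff_tail_eq {x : ℝ} (h0 : 0 < x) (hxe : x < e) :
    (∫ z in Ioi (gR ρ η β x), (η z - ρ z)) =
      (∫ z in (0 : ℝ)..(fR ρ η β x), (ρ z - η z)) + ∫ z in (fR ρ η β x)..x, ρ z := by
  have hm := (h.curtainPair h0 hxe).mass
  have t := (h.tail_diff (gR ρ η β x)).1
  have d := (h.interval_diff 0 (fR ρ η β x)).2.2.1
  have s := intervalIntegral.integral_interval_sub_left (μ := volume) (f := ρ) (a := 0) (b := x)
    (c := fR ρ η β x) h.rho.integrable.intervalIntegrable h.rho.integrable.intervalIntegrable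
  linarith

theorem x₄_spec {x₃ : ℝ} (hx₀ : x₀ ρ η β e < x₃) (hxe : x₃ < e) :
    gR ρ η β x₃ < x₄ ρ η β x₃ ∧ (x₄ ρ η β x₃ : EReal) < β ∧
      ∫ z in (0 : ℝ)..(fR ρ η β x₃), (ρ z - η z) = ∫ z in Ioi (x₄ ρ η β x₃), (η z - ρ z) := by
  have h0 : 0 < x₃ := h.x₀_spec.1.trans hx₀
  have hcp := h.curtainPair h0 hxe
  have heg := h.e_lt_gR h0 hxe
  have hf := h.fR_pos hx₀ hxe
  have hgβ : (gR ρ η β x₃ : EReal) < β :=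
    (mem_symInterval_iff (h.e_pos.trans heg).le).1 hcp.g_mem
  refine Classical.epsilon_spec (p := fun x => gR ρ η β x₃ < x ∧ (x : EReal) < β ∧
    ∫ z in (0 : ℝ)..(fR ρ η β x₃), (ρ z - η z) = ∫ z in Ioi x, (η z - ρ z)) ?_
  set T : ℝ → ℝ := fun g => ∫ z in Ioi g, (η z - ρ z) with hT
  have hTc : Continuous T := by
    have : T = fun g => (∫ z in (0 : ℝ)..g, ρ z) - ∫ z in (0 : ℝ)..g, η z := by
      ext g; exact (h.tail_diff g).1.symm
    rw [this]
    exact h.curtainFns.contM.sub h.curtainFns.contN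
  have hpos : 0 < ∫ z in (0 : ℝ)..(fR ρ η β x₃), (ρ z - η z) := by
    refine intervalIntegral.intervalIntegral_pos_of_pos_on
      h.integrable_diff'.1.intervalIntegrable (fun z hz => ?_) hf
    exact sub_pos.2 (h.inside z (abs_lt.2 ⟨by linarith [hz.1, h.e_pos],
      hz.2.trans (hcp.f_lt.trans hxe)⟩))
  -- The tail beyond `gR x₃` exceeds the central surplus by the positive mass of the ring, while
  -- tails near `β` are arbitrarily small. The required level is therefore attained strictly in
  -- between.
  have hbig : ∫ z in (0 : ℝ)..(fR ρ η β x₃), (ρ z - η z) < T (gR ρ η β x₃) := by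
    have h1 := h.diff_tail_eq h0 hxe
    have h2 : 0 < ∫ z in (fR ρ η β x₃)..x₃, ρ z := by
      refine intervalIntegral.intervalIntegral_pos_of_pos_on
        h.rho.integrable.intervalIntegrable (fun z hz => ?_) hcp.f_lt
      exact (h.eta_nonneg z).trans_lt (h.inside z (abs_lt.2 ⟨by linarith [hz.1, h.e_pos],
        hz.2.trans hxe⟩))
    simp only [hT]
    linarith
  obtain ⟨x, hx, hxI, hxb⟩ := exists_seq_real_tendsto hgβ
  have hdz : ∀ᵐ z : ℝ, β ≤ z → η z - ρ z = 0 := by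
    filter_upwards [h.eta_zero, h.rho_zero] with z h1 h2 hb
    have hb' := hb.trans (show (z : EReal) ≤ ((|z| : ℝ) : EReal) by exact_mod_cast le_abs_self z)
    rw [h1 hb', h2 hb', sub_zero]
  obtain ⟨n, hn⟩ := ((tendsto_tail_integral hx hxb h.integrable_diff.1 hdz).eventually
    (gt_mem_nhds hpos)).exists
  obtain ⟨y, hy, hyT⟩ := intermediate_value_Ioo' (hxI n).1.le hTc.continuousOn ⟨hn, hbig⟩
  exact ⟨y, hy.1, lt_of_le_of_lt (by exact_mod_cast hy.2.le) (hxI n).2, hyT.symm⟩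

theorem chi4_eq {x₃ : ℝ} (h0 : 0 < x₃) (hxe : x₃ < e) :
    chi4 ρ η β x₃ = {z : ℝ | |z| < fR ρ η β x₃}.indicator fun z => ρ z - η z := by
  unfold chi4
  rw [(h.left_eq h0 hxe).2]
  congr 1
  ext z
  exact abs_lt.symm

theorem chi3_eq {x₃ : ℝ} (hx₀ : x₀ ρ η β e < x₃) (hxe : x₃ < e) :
    chi3 ρ η β x₃ = {z : ℝ | fR ρ η β x₃ < |z| ∧ |z| < x₃}.indicator ρ := by
  have h0 : 0 < x₃ := h.x₀_spec.1.trans hx₀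
  have hf := h.fR_pos hx₀ hxe
  unfold chi3
  rw [(h.left_eq h0 hxe).2]
  congr 1
  ext z
  change (-x₃ < z ∧ z < -fR ρ η β x₃) ∨ (fR ρ η β x₃ < z ∧ z < x₃) ↔ fR ρ η β x₃ < |z| ∧ |z| < x₃
  grind

theorem xi3_eq {x₃ : ℝ} (hx₀ : x₀ ρ η β e < x₃) (hxe : x₃ < e) :
    xi3 ρ η β x₃ = {z : ℝ | gR ρ η β x₃ < |z| ∧ |z| < x₄ ρ η β x₃}.indicator
      fun z => η z - ρ z := by
  have h0 : 0 < x₃ := h.x₀_spec.1.trans hx₀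
  have hg := h.e_pos.trans (h.e_lt_gR h0 hxe)
  unfold xi3
  rw [(h.left_eq h0 hxe).1]
  congr 1
  ext z
  change (-x₄ ρ η β x₃ < z ∧ z < -gR ρ η β x₃) ∨ (gR ρ η β x₃ < z ∧ z < x₄ ρ η β x₃) ↔
    gR ρ η β x₃ < |z| ∧ |z| < x₄ ρ η β x₃
  grind

theorem hkDens_centre {x₃ : ℝ} (hx₀ : x₀ ρ η β e < x₃) (hxe : x₃ < e) :
    HKDens ({z : ℝ | |z| < fR ρ η β x₃}.indicator fun z => ρ z - η z)
      (tailDensity ρ η β (x₄ ρ η β x₃)) (fR ρ η β x₃) (x₄ ρ η β x₃) β := by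
  have h0 : 0 < x₃ := h.x₀_spec.1.trans hx₀
  obtain ⟨h1, h2, h3⟩ := h.x₄_spec hx₀ hxe
  exact h.hkDens_tail (h.fR_pos hx₀ hxe) ((h.curtainPair h0 hxe).f_lt.trans hxe).le
    ((h.e_lt_gR h0 hxe).trans h1).le h2 h3

theorem hkDens_ring {x₃ : ℝ} (hx₀ : x₀ ρ η β e < x₃) (hxe : x₃ < e) :
    HKDens (chi3 ρ η β x₃) (xi3 ρ η β x₃) x₃ (gR ρ η β x₃) (x₄ ρ η β x₃) := by
  have h0 : 0 < x₃ := h.x₀_spec.1.trans hx₀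
  obtain ⟨h1, h2, h3⟩ := h.x₄_spec hx₀ hxe
  rw [h.chi3_eq hx₀ hxe, h.xi3_eq hx₀ hxe]
  refine h.hkDens_between (h.fR_pos hx₀ hxe) (h.curtainPair h0 hxe).f_lt hxe (h.e_lt_gR h0 hxe)
    h1 h2 ?_
  have e1 := intervalIntegral.integral_interval_add_Ioi (a := gR ρ η β x₃) (b := x₄ ρ η β x₃)
    h.integrable_diff.1.integrableOn h.integrable_diff.1.integrableOn
  have e2 := h.diff_tail_eq h0 hxe
  linarith

theorem hkDens_dispersion :
    HKDens ((Ioo (-e) e).indicator fun z => ρ z - η z) (tailDensity ρ η β e) e e β := by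
  have : Ioo (-e) e = {z : ℝ | |z| < e} := by ext z; exact abs_lt.symm
  rw [this]
  refine h.hkDens_tail h.e_pos le_rfl le_rfl h.e_lt_beta ?_
  rw [(h.interval_diff 0 e).2.2.1, (h.tail_diff e).1]

/-- The sign of chord minus `a` at `fR x` is followed from `x₀`, where `fR` is zero and the sign is
negative by hypothesis, to a point near `e`, where it is positive. -/
theorem exists_isCutoff {a b : ℝ → ℝ} (ha : ConvexOn ℝ univ a)
    (hbc : ConvexOn ℝ univ b) (hae : ∀ x, a (-x) = a x)
    (hC3 : chord ρ η a b β (x₀ ρ η β e) 0 < a 0) (hlt : b e < a e) :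
    ∃ x₃ : ℝ, IsCutoff ρ η a b β e x₃ := by
  obtain ⟨h1, h2, h3⟩ := h.x₀_spec
  have hFG : ∀ x, 0 < x → x < e → _ := fun x h0 hx => h.curtainPair (x := x) h0 hx
  have ca := convexOn_univ_continuous ha
  have cb := convexOn_univ_continuous hbc
  obtain ⟨m, hm1, hm2⟩ := exists_between hlt
  obtain ⟨r, hr, hra⟩ := Metric.eventually_nhds_iff.1 (ca.continuousAt.eventually (lt_mem_nhds hm2))
  obtain ⟨s, hs, hsb⟩ := Metric.eventually_nhds_iff.1 (cb.continuousAt.eventually (gt_mem_nhds hm1))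
  -- Beyond `c` the values of `a` exceed `m`. Since `gR` covers `(e, gR c)`, some `x > c` has `gR x`
  -- so close to `e` that `b (gR x) < m`.
  set c := max (x₀ ρ η β e) (e - r) with hc
  have hc0 : 0 < c := h1.trans_le (le_max_left _ _)
  have hce : c < e := max_lt h2 (by linarith)
  obtain ⟨y, hy1, hy2⟩ := exists_between (lt_min (h.e_lt_gR hc0 hce) (show e < e + s by linarith))
  obtain ⟨x, hx, hxy⟩ := h.curtainFns.surjOn_G hFG hc0 hce ⟨hy1, hy2.trans_le (min_le_left _ _)⟩
  have hx0 : x₀ ρ η β e < x := (le_max_left _ _).trans_lt hx.1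
  have hxp : 0 < x := h1.trans hx0
  have hax : m < a x := hra (by
    rw [Real.dist_eq, abs_lt]
    exact ⟨by linarith [hx.1, le_max_right (x₀ ρ η β e) (e - r)], by linarith [hx.2]⟩)
  have hby : b (gR ρ η β x) < m := by
    rw [hxy]
    refine hsb ?_
    rw [Real.dist_eq, abs_lt]
    exact ⟨by linarith, by linarith [hy2.trans_le (min_le_right _ _)]⟩
  have hcp := hFG x hxp hx.2
  have hf := h.fR_pos hx0 hx.2
  set k : ℝ → ℝ := fun x => chord ρ η a b β x (fR ρ η β x) - a (fR ρ η β x) with hk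
  have hk0 : k (x₀ ρ η β e) < 0 := by
    simp only [hk, h3]; linarith
  -- The chord has negative slope, so at `fR x < x` it exceeds `a x`, which is at least `a (fR x)`
  -- because `a` increases on `[0, ∞)`.
  have hk1 : 0 < k x := by
    have mono := even_convexOn_monotoneOn ha hae (show fR ρ η β x ∈ Ici 0 from hf.le)
      (show x ∈ Ici 0 from hxp.le) hcp.f_lt.le
    have hs : 0 < (b (gR ρ η β x) - a x) / (gR ρ η β x - x) * (fR ρ η β x - x) :=
      mul_pos_of_neg_of_neg (div_neg_of_neg_of_pos (by linarith) (by linarith [hcp.lt_g]))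
        (by linarith [hcp.f_lt])
    simp only [hk, chord]
    linarith
  have hsub : Icc (x₀ ρ η β e) x ⊆ Ioo 0 e := fun z hz =>
    ⟨h1.trans_le hz.1, hz.2.trans_lt hx.2⟩
  have cF := (h.curtainFns.continuousOn_F hFG).mono hsub
  have cG := (h.curtainFns.continuousOn_G hFG).mono hsub
  have hkc : ContinuousOn k (Icc (x₀ ρ η β e) x) := by
    have hne : ∀ z ∈ Icc (x₀ ρ η β e) x, gR ρ η β z - z ≠ 0 := fun z hz => by
      have := (hFG z (hsub hz).1 (hsub hz).2).lt_g
      exact (sub_pos.2 this).ne'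
    have c1 : ContinuousOn (fun z => b (gR ρ η β z)) (Icc (x₀ ρ η β e) x) :=
      cb.comp_continuousOn cG
    have c2 : ContinuousOn (fun z => a (fR ρ η β z)) (Icc (x₀ ρ η β e) x) :=
      ca.comp_continuousOn cF
    have c3 : ContinuousOn (fun z : ℝ => z) (Icc (x₀ ρ η β e) x) := continuousOn_id
    exact ((ca.continuousOn.add ((((c1.sub ca.continuousOn).div (cG.sub c3) hne)).mul
      (cF.sub c3))).sub c2)
  obtain ⟨x₃, hx₃, hkx₃⟩ := intermediate_value_Ioo hx0.le hkc ⟨hk0, hk1⟩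
  exact ⟨x₃, hx₃.1, hx₃.2.trans hx.2, by simp only [hk] at hkx₃; linarith⟩

end

end SymmetricDispersion

/-! ### Optimality of the candidate models -/

theorem lineBridge_of_mem {a b : ℝ → ℝ} {A s c f g x : ℝ} (h1 : f ≤ |x|) (h2 : |x| ≤ g) :
    lineBridge a b A s c f g x = A + s * (|x| - c) := by
  unfold lineBridge
  rw [if_neg (not_lt.2 h2), if_neg (not_lt.2 h1)]

theorem abs_regions {p q r x : ℝ} (h1 : x ≠ p) (h2 : x ≠ -p) (h3 : x ≠ q)
    (h4 : x ≠ -q) : |x| < p ∨ (p < |x| ∧ |x| < q) ∨ x ∈ Ioo q r ∨ x ∈ Ioo (-r) (-q) ∨ r ≤ |x| := by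
  change |x| < p ∨ (p < |x| ∧ |x| < q) ∨ (q < x ∧ x < r) ∨ (-r < x ∧ x < -q) ∨ r ≤ |x|
  rcases le_total 0 x with h0 | h0
  · rw [abs_of_nonneg h0]
    grind
  · rw [abs_of_nonpos h0]
    grind

namespace HKDens

variable {χ ξ : ℝ → ℝ} {γ a : ℝ} {b : EReal}

/-- On functions which agree beyond `a`, the kernel of the Hobson-Klimmek coupling acts equally. -/
theorem lintegral_hkKernel_congr (h : HKDens χ ξ γ a b) {x : ℝ} (hx : |x| < γ)
    {F G : ℝ → ENNReal} (hFG : ∀ y, a < |y| → F y = G y) :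
    ∫⁻ y, F y ∂(hkKernel χ ξ γ x) = ∫⁻ y, G y ∂(hkKernel χ ξ γ x) := by
  obtain ⟨m1, m2⟩ := h.epsilon_mem (abs_lt.1 hx).1 (abs_lt.1 hx).2
  unfold hkKernel
  rw [lintegral_twoPoint, lintegral_twoPoint, hFG _ (lt_abs.2 (Or.inr (by linarith))),
    hFG _ (lt_abs.2 (Or.inl m2))]

theorem epsilon_lt (h : HKDens χ ξ γ a b) {x : ℝ} (hx : |x| < γ) :
    (Classical.epsilon (IsHKPair χ ξ γ x)).1 < x ∧ x < (Classical.epsilon (IsHKPair χ ξ γ x)).2 := by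
  obtain ⟨l1, l2⟩ := abs_lt.1 hx
  obtain ⟨m1, m2⟩ := h.epsilon_mem l1 l2
  have := h.γ_le
  exact ⟨by linarith, by linarith⟩

/-- Endpoints are cut off by indicators of disjoint regions, so that their sum is one measurable
endpoint map for the whole kernel. -/
theorem aemeasurable_epsilon (h : HKDens χ ξ γ a b) (m : Measure ℝ) {J : Set ℝ}
    (hJ : MeasurableSet J) (hJγ : ∀ x ∈ J, |x| < γ) :
    AEMeasurable (J.indicator fun x => (Classical.epsilon (IsHKPair χ ξ γ x)).1) m ∧
      AEMeasurable (J.indicator fun x => (Classical.epsilon (IsHKPair χ ξ γ x)).2) m := by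
  have hsub : J ⊆ Ioo (-γ) γ := fun x hx => abs_lt.1 (hJγ x hx)
  rw [aemeasurable_indicator_iff hJ, aemeasurable_indicator_iff hJ]
  exact ⟨aemeasurable_restrict_of_antitoneOn hJ (h.epsilon_antitoneOn.1.mono hsub),
    aemeasurable_restrict_of_antitoneOn hJ (h.epsilon_antitoneOn.2.mono hsub)⟩

end HKDens

namespace SymmetricDispersion

variable {μ ν : Measure ℝ} {ρ η : ℝ → ℝ} {α β : EReal} {e : ℝ}
variable [IsProbabilityMeasure μ] [IsProbabilityMeasure ν]
  (h : SymmetricDispersion μ ν ρ η α β e)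

section
include h

theorem aemeasurable_curtain (m : Measure ℝ) {c : ℝ} (hc : 0 < c) :
    (AEMeasurable ((Ioo c e).indicator (fR ρ η β)) m ∧
      AEMeasurable ((Ioo c e).indicator (gR ρ η β)) m) ∧
    AEMeasurable ((Ioo (-e) (-c)).indicator (fL ρ η β)) m ∧
      AEMeasurable ((Ioo (-e) (-c)).indicator (gL ρ η β)) m := by
  have hsub : Ioo c e ⊆ Ioo 0 e := Ioo_subset_Ioo_left hc.le
  have key : ∀ x ∈ Ioo (-e) (-c), -x ∈ Ioo 0 e ∧ fL ρ η β x = -gR ρ η β (-x) ∧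
      gL ρ η β x = -fR ρ η β (-x) := fun x hx => by
    have h1 : 0 < -x := by linarith [hx.2]
    have h2 : -x < e := by linarith [hx.1]
    have := h.left_eq h1 h2
    rw [neg_neg] at this
    exact ⟨⟨h1, h2⟩, this⟩
  refine ⟨⟨?_, ?_⟩, ?_, ?_⟩ <;> rw [aemeasurable_indicator_iff measurableSet_Ioo]
  · exact aemeasurable_restrict_of_monotoneOn measurableSet_Ioo
      (h.fR_strictMonoOn.mono hsub).monotoneOn
  · exact aemeasurable_restrict_of_antitoneOn measurableSet_Ioo
      (h.gR_strictAntiOn.mono hsub).antitoneOn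
  · refine aemeasurable_restrict_of_antitoneOn measurableSet_Ioo fun x hx y hy hxy => ?_
    rw [(key x hx).2.1, (key y hy).2.1]
    have := h.gR_strictAntiOn.antitoneOn (key y hy).1 (key x hx).1 (neg_le_neg hxy)
    linarith
  · refine aemeasurable_restrict_of_monotoneOn measurableSet_Ioo fun x hx y hy hxy => ?_
    rw [(key x hx).2.2, (key y hy).2.2]
    have := h.fR_strictMonoOn.monotoneOn (key y hy).1 (key x hx).1 (neg_le_neg hxy)
    linarith

omit [IsProbabilityMeasure μ] [IsProbabilityMeasure ν] in
theorem kernel3_outer {x₃ u x : ℝ} (h0 : 0 < x₃) (h3 : x₃ < e) (hx : e ≤ |x|) :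
    kernel3 ρ η β e x₃ u x = Measure.dirac x := by
  have := h.e_pos
  unfold kernel3
  rcases le_abs.1 hx with hx | hx
  · by_cases hx3 : x ≤ -x₃
    · rw [if_pos hx3, leftKernel, if_pos]
      linarith
    · rw [if_neg hx3, if_pos (by linarith), rightKernel, if_pos hx]
  · rw [if_pos (by linarith), leftKernel, if_pos (by linarith)]

omit [IsProbabilityMeasure μ] [IsProbabilityMeasure ν] h in
theorem kernel3_right {x₃ u x : ℝ} (h0 : 0 < x₃) (hx : x ∈ Ioo x₃ e) :
    kernel3 ρ η β e x₃ u x = twoPoint x (fR ρ η β x) (gR ρ η β x) := by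
  unfold kernel3
  rw [if_neg (by linarith [hx.1]), if_pos hx.1.le, rightKernel, if_neg (not_le.2 hx.2)]

omit [IsProbabilityMeasure μ] [IsProbabilityMeasure ν] h in
theorem kernel3_left {x₃ u x : ℝ} (hx : x ∈ Ioo (-e) (-x₃)) :
    kernel3 ρ η β e x₃ u x = twoPoint x (fL ρ η β x) (gL ρ η β x) := by
  unfold kernel3
  rw [if_pos hx.2.le, leftKernel, if_neg (not_le.2 hx.1)]

theorem kernel3_ring {x₃ u x : ℝ} (h0 : 0 < x₃) (h3 : x₃ < e)
    (hx : fR ρ η β x₃ < |x| ∧ |x| < x₃) :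
    kernel3 ρ η β e x₃ u x = hkKernel (chi3 ρ η β x₃) (xi3 ρ η β x₃) x₃ x := by
  obtain ⟨l1, l2⟩ := abs_lt.1 hx.2
  unfold kernel3
  rw [if_neg (by linarith), if_neg (by linarith), if_neg]
  rw [(h.left_eq h0 h3).2]
  exact fun h' => absurd (abs_lt.2 h') (not_lt.2 hx.1.le)

theorem kernel3_centre {x₃ u x : ℝ} (h0 : 0 < x₃) (h3 : x₃ < e) (hx : |x| < fR ρ η β x₃) :
    kernel3 ρ η β e x₃ u x = if u ≤ η x / ρ x then Measure.dirac x else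
      hkKernel ({z : ℝ | |z| < fR ρ η β x₃}.indicator fun z => ρ z - η z)
        (tailDensity ρ η β (x₄ ρ η β x₃)) (fR ρ η β x₃) x := by
  obtain ⟨l1, l2⟩ := abs_lt.1 hx
  have := (h.curtainPair h0 h3).f_lt
  unfold kernel3
  rw [if_neg (by linarith), if_neg (by linarith), if_pos, h.chi4_eq h0 h3]
  rw [(h.left_eq h0 h3).2]
  exact ⟨l1, l2⟩

omit [IsProbabilityMeasure μ] [IsProbabilityMeasure ν] h in
theorem setLIntegral_dirac {J A : Set ℝ} (hJ : MeasurableSet J) (hA : MeasurableSet A) :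
    ∫⁻ x in J, Measure.dirac x A ∂(dens ρ) = dens (J.indicator ρ) A := by
  rw [dens_indicator ρ hJ, ← lintegral_indicator_one hA]
  exact lintegral_congr fun x => Measure.dirac_apply' _ hA

/-- Bookkeeping of densities: the centre yields `η` on `|z| < f` and `η - ρ` beyond `x₄`; the ring
yields `η - ρ` on `g < |z| < x₄`; the two curtains yield `η` on `f < |z| < e` and `η - ρ` on `e <
|z| < g`; and `ρ` stays on `|z| ≥ e`. The sum is `η`. -/
theorem lintegral_kernel3 {x₃ : ℝ} (hx₀ : x₀ ρ η β e < x₃) (h3 : x₃ < e) {A : Set ℝ}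
    (hA : MeasurableSet A) :
    ∫⁻ x, (∫⁻ u in Icc (0 : ℝ) 1, kernel3 ρ η β e x₃ u x A) ∂μ = ν A := by
  have h0 : 0 < x₃ := h.x₀_spec.1.trans hx₀
  have hf := h.fR_pos hx₀ h3
  have hfx := (h.curtainPair h0 h3).f_lt
  have heg := h.e_lt_gR h0 h3
  obtain ⟨hgx, hxβ, -⟩ := h.x₄_spec hx₀ h3
  have hkc := h.hkDens_centre hx₀ h3
  have hkr := h.hkDens_ring hx₀ h3
  have mC : MeasurableSet {x : ℝ | |x| < fR ρ η β x₃} :=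
    measurableSet_lt measurable_abs measurable_const
  have mO : MeasurableSet {x : ℝ | e ≤ |x|} := measurableSet_le measurable_const measurable_abs
  have mB := measurableSet_abs_between
  have unit : ∀ m : ENNReal, ∫⁻ _ in Icc (0 : ℝ) 1, m = m := fun m => by simp
  have pC : ∫⁻ x in {x : ℝ | |x| < fR ρ η β x₃},
      (∫⁻ u in Icc (0 : ℝ) 1, kernel3 ρ η β e x₃ u x A) ∂(dens ρ) =
      dens ({x : ℝ | |x| < fR ρ η β x₃}.indicator η) A +
        dens (tailDensity ρ η β (x₄ ρ η β x₃)) A := by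
    rw [← h.lintegral_mixture mC (fun x (hx : |x| < _) => hx.trans (hfx.trans h3)) hkc hA]
    refine setLIntegral_congr_fun mC fun x hx => lintegral_congr fun u => ?_
    rw [h.kernel3_centre h0 h3 hx]
    split_ifs <;> rfl
  have pR : ∫⁻ x in {x : ℝ | fR ρ η β x₃ < |x| ∧ |x| < x₃},
      (∫⁻ u in Icc (0 : ℝ) 1, kernel3 ρ η β e x₃ u x A) ∂(dens ρ) = dens (xi3 ρ η β x₃) A := by
    rw [← hkr.lintegral_hkKernel hA, h.chi3_eq hx₀ h3, dens_indicator ρ (mB _ _),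
      ← h.chi3_eq hx₀ h3]
    refine setLIntegral_congr_fun (mB _ _) fun x hx => ?_
    simp only [h.kernel3_ring h0 h3 hx, unit]
  have p1 : ∫⁻ x in Ioo x₃ e,
      (∫⁻ u in Icc (0 : ℝ) 1, kernel3 ρ η β e x₃ u x A) ∂(dens ρ) =
      ∫⁻ x in Ioo x₃ e, twoPoint x (fR ρ η β x) (gR ρ η β x) A ∂(dens ρ) :=
    setLIntegral_congr_fun measurableSet_Ioo fun x hx => by
      simp only [kernel3_right h0 hx, unit]
  have p2 : ∫⁻ x in Ioo (-e) (-x₃),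
      (∫⁻ u in Icc (0 : ℝ) 1, kernel3 ρ η β e x₃ u x A) ∂(dens ρ) =
      ∫⁻ x in Ioo (-e) (-x₃), twoPoint x (fL ρ η β x) (gL ρ η β x) A ∂(dens ρ) :=
    setLIntegral_congr_fun measurableSet_Ioo fun x hx => by
      simp only [kernel3_left hx, unit]
  have pO : ∫⁻ x in {x : ℝ | e ≤ |x|},
      (∫⁻ u in Icc (0 : ℝ) 1, kernel3 ρ η β e x₃ u x A) ∂(dens ρ) =
      dens ({x : ℝ | e ≤ |x|}.indicator ρ) A := by
    rw [← setLIntegral_dirac mO hA]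
    refine setLIntegral_congr_fun mO fun x hx => ?_
    simp only [h.kernel3_outer h0 h3 hx, unit]
  have d1 : IsDensity ({x : ℝ | |x| < fR ρ η β x₃}.indicator η) := h.eta.indicator mC
  have d2 := hkc.target
  have d3 := hkr.target
  have d4 : IsDensity ({z : ℝ | fR ρ η β x₃ < |z| ∧ |z| < e}.indicator η) :=
    h.eta.indicator (mB _ _)
  have d5 : IsDensity ({z : ℝ | e < |z| ∧ |z| < gR ρ η β x₃}.indicator fun z => η z - ρ z) :=
    h.isDensity_outside (mB _ _) fun z hz =>
      ⟨hz.1, lt_beta_of_abs_le hxβ (hz.2.trans hgx).le⟩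
  have d6 : IsDensity ({x : ℝ | e ≤ |x|}.indicator ρ) := h.rho.indicator mO
  rw [show μ = dens ρ from h.density_mu, show ν = dens η from h.density_nu,
    lintegral_split hf hfx h3, pC, pR, p1, p2, pO, h.lintegral_left_add_right h0 h3 hf.le hA]
  simp only [← Measure.add_apply]
  rw [← dens_add d1 d2, ← dens_add (d1.add d2) d3, ← dens_add d4 d5,
    ← dens_add ((d1.add d2).add d3) (d4.add d5),
    ← dens_add (((d1.add d2).add d3).add (d4.add d5)) d6]
  congr 1
  -- The sum of the six densities is compared with `η` region by region, off the boundary points;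
  -- outside `(-β, β)` everything vanishes almost everywhere.
  refine dens_congr_ae ?_
  have hnull : ∀ᵐ z : ℝ, |z| ≠ fR ρ η β x₃ ∧ |z| ≠ e ∧ |z| ≠ gR ρ η β x₃ ∧
      |z| ≠ x₄ ρ η β x₃ := by
    have : ∀ r : ℝ, ∀ᵐ z : ℝ, |z| ≠ r := fun r => by
      refine measure_mono_null (t := {r, -r}) (fun z hz => ?_) ((Set.toFinite _).measure_zero _)
      have hz' : |z| = r := not_not.1 hz
      exact eq_or_eq_neg_of_abs_eq hz'
    exact ((this _).and ((this _).and ((this _).and (this _))))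
  filter_upwards [h.eta_zero, h.rho_zero, hnull] with z e1 e2 hz
  have hin : |z| < x₄ ρ η β x₃ → ((|z| : ℝ) : EReal) < β := fun h' =>
    lt_beta_of_abs_le hxβ h'.le
  rw [h.xi3_eq hx₀ h3]
  unfold tailDensity
  simp only [indicator_apply, mem_ofPred_eq]
  rw [← not_lt] at e1 e2
  by_cases hb : ((|z| : ℝ) : EReal) < β
  · simp only [hb, and_true]
    clear * - hf hfx h3 heg hgx hz
    grind
  · have hx : ¬ |z| < x₄ ρ η β x₃ := fun h' => hb (hin h')
    simp only [e1 hb, e2 hb, sub_zero, ite_self, add_zero]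

theorem optimal_kernel3 {a b : ℝ → ℝ} (hab : SymmetricPayoffs a b β) {x₃ : ℝ}
    (hcut : IsCutoff ρ η a b β e x₃) :
    OptimalWithoutGap.{u} μ ν a b (psi3 ρ η a b β x₃) (jointLaw μ (kernel3 ρ η β e x₃))
      (tau3 ρ η β x₃) := by
  obtain ⟨hx₀, h3, haf⟩ := hcut
  have h0 : 0 < x₃ := h.x₀_spec.1.trans hx₀
  have hf := h.fR_pos hx₀ h3
  have hp := h.curtainPair h0 h3
  have hfx := hp.f_lt
  have hxg := hp.lt_g
  have heg := h.e_lt_gR h0 h3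
  have hgx := (h.x₄_spec hx₀ h3).1
  have hkc := h.hkDens_centre hx₀ h3
  have hkr := h.hkDens_ring hx₀ h3
  have hFm := h.fR_strictMonoOn
  have hGm := h.gR_strictAntiOn
  have hleft := h.left_eq h0 h3
  unfold chord at haf
  rw [psi3_eq_lineBridge]
  have hax : a x₃ = a x₃ + (b (gR ρ η β x₃) - a x₃) / (gR ρ η β x₃ - x₃) * (x₃ - x₃) := by simp
  have hbg : b (gR ρ η β x₃) =
      a x₃ + (b (gR ρ η β x₃) - a x₃) / (gR ρ η β x₃ - x₃) * (gR ρ η β x₃ - x₃) := by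
    rw [div_mul_cancel₀ _ (sub_pos.2 hxg).ne']; ring
  -- From here on the slope enters only through the three incidences `haf`, `hax`, `hbg` of the line
  -- with `a` and `b`.
  generalize (b (gR ρ η β x₃) - a x₃) / (gR ρ η β x₃ - x₃) = s at *
  set ψ := lineBridge a b (a x₃) s x₃ (fR ρ η β x₃) (gR ρ η β x₃) with hψ
  have hbψ : ∀ x, b x ≤ ψ x := le_lineBridge hab.convex_b hab.le hab.even_b haf hbg
  have hψ0 : ∀ x, 0 ≤ ψ x := fun x => (hab.nonneg x).trans (hbψ x)
  have hψb : ∀ x, gR ρ η β x₃ < |x| → ψ x = b x := fun x hx => by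
    simp only [hψ, lineBridge, if_pos hx]
  have hψa : ∀ x, |x| ≤ fR ρ η β x₃ ∨ x₃ ≤ |x| → ψ x ≤ a x := fun x hx =>
    lineBridge_le hab.convex_a hab.le hab.even_a hfx haf hax hx
  have haψ : ∀ x, |x| ≤ x₃ → a x ≤ ψ x := fun x hx =>
    le_lineBridge_of_abs_le hab.convex_a hab.even_a hxg haf hax hx
  have hright : ∀ x ∈ Ioo x₃ e, fR ρ η β x < x ∧ x < gR ρ η β x ∧ fR ρ η β x₃ < fR ρ η β x ∧
      gR ρ η β x < gR ρ η β x₃ := fun x hx => by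
    have hx0 := h0.trans hx.1
    have := h.curtainPair hx0 hx.2
    exact ⟨this.f_lt, this.lt_g, hFm ⟨h0, h3⟩ ⟨hx0, hx.2⟩ hx.1, hGm ⟨h0, h3⟩ ⟨hx0, hx.2⟩ hx.1⟩
  have hlefteq : ∀ x ∈ Ioo (-e) (-x₃), -x ∈ Ioo x₃ e ∧ fL ρ η β x = -gR ρ η β (-x) ∧
      gL ρ η β x = -fR ρ η β (-x) := fun x hx => by
    have h1 : x₃ < -x := by linarith [hx.2]
    have h2 : -x < e := by linarith [hx.1]
    have := h.left_eq (h0.trans h1) h2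
    rw [neg_neg] at this
    exact ⟨⟨h1, h2⟩, this⟩
  have mC : MeasurableSet {x : ℝ | |x| < fR ρ η β x₃} :=
    measurableSet_lt measurable_abs measurable_const
  have mB := measurableSet_abs_between (fR ρ η β x₃) x₃
  have mr : Measurable fun w : ℝ × ℝ => η w.2 / ρ w.2 :=
    (h.measurable_eta.comp measurable_snd).div (h.measurable_rho.comp measurable_snd)
  have mBset : MeasurableSet {w : ℝ × ℝ | e ≤ |w.2| ∨ (|w.2| < fR ρ η β x₃ ∧
      w.1 ≤ η w.2 / ρ w.2)} :=
    (measurableSet_le measurable_const measurable_snd.abs).union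
      ((measurableSet_lt measurable_snd.abs measurable_const).inter
        (measurableSet_le measurable_fst mr))
  have mS : MeasurableSet {w : ℝ × ℝ | w.2 ∉ Ioo (-x₃) x₃ ∨
      (w.2 ∈ Ioo (gL ρ η β (-x₃)) (fR ρ η β x₃) ∧ w.1 < η w.2 / ρ w.2)} :=
    (measurable_snd measurableSet_Ioo).compl.union
      ((measurable_snd measurableSet_Ioo).inter (measurableSet_lt measurable_fst mr))
  have hmemS : ∀ w : ℝ × ℝ, (w.2 ∉ Ioo (-x₃) x₃ ∨ (w.2 ∈ Ioo (gL ρ η β (-x₃)) (fR ρ η β x₃) ∧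
      w.1 < η w.2 / ρ w.2)) ↔ x₃ ≤ |w.2| ∨ (|w.2| < fR ρ η β x₃ ∧ w.1 < η w.2 / ρ w.2) := by
    intro w
    rw [hleft.2]
    simp only [mem_Ioo, ← abs_lt, not_lt]
  obtain ⟨⟨c1, c2⟩, c3, c4⟩ := h.aemeasurable_curtain μ h0
  obtain ⟨c5, c6⟩ := hkr.aemeasurable_epsilon μ mB fun x hx => hx.2
  obtain ⟨c7, c8⟩ := hkc.aemeasurable_epsilon μ mC fun x hx => hx
  have hae := h.ae_randomised (N := {fR ρ η β x₃, -fR ρ η β x₃, x₃, -x₃}) (Set.toFinite _)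
  have hregion : ∀ w : ℝ × ℝ, w.2 ∉ ({fR ρ η β x₃, -fR ρ η β x₃, x₃, -x₃} : Set ℝ) →
      |w.2| < fR ρ η β x₃ ∨ (fR ρ η β x₃ < |w.2| ∧ |w.2| < x₃) ∨ w.2 ∈ Ioo x₃ e ∨
        w.2 ∈ Ioo (-e) (-x₃) ∨ e ≤ |w.2| := by
    intro w hw
    simp only [mem_insert_iff, mem_singleton_iff, not_or] at hw
    exact abs_regions hw.1 hw.2.1 hw.2.2.1 hw.2.2.2
  -- `S` is the stopping region and `B` the part where the kernel is Dirac. For `x₃ < |x| < e` the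
  -- rule stops although the price still moves. Each endpoint map is a sum over the four regions
  -- with a two-point kernel.
  refine optimalWithoutGap_of_slackness (S := {w | w.2 ∉ Ioo (-x₃) x₃ ∨
      (w.2 ∈ Ioo (gL ρ η β (-x₃)) (fR ρ η β x₃) ∧ w.1 < η w.2 / ρ w.2)})
    (B := {w | e ≤ |w.2| ∨ (|w.2| < fR ρ η β x₃ ∧ w.1 ≤ η w.2 / ρ w.2)})
    hab.nonneg hab.le hab.convex_a hab.convex_b
    (convexOn_lineBridge hab.convex_a hab.convex_b hab.le hab.even_a hab.even_b hf hfx hxg haf hax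
      hbg) hbψ h.convexOrder.1 h.convexOrder.2.1 h.integral_mu mS
    (fun ω hω => if_pos hω) (fun ω hω => if_neg hω) mBset
    (((c3.add c1).add c5).add c7) (((c4.add c2).add c6).add c8) ?_
    (fun A hA => h.lintegral_kernel3 hx₀ h3 hA) ?_ ?_
  · filter_upwards [hae] with w hw
    constructor
    · rintro (hw' | ⟨hw1, hw2⟩)
      · exact h.kernel3_outer h0 h3 hw'
      · rw [h.kernel3_centre h0 h3 hw1, if_pos hw2]
    · intro hwB
      have hwB' : ¬ (e ≤ |w.2|) ∧ ¬ (|w.2| < fR ρ η β x₃ ∧ w.1 ≤ η w.2 / ρ w.2) := not_or.1 hwB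
      simp only [Pi.add_apply]
      rcases hregion w hw.1 with hr | hr | hr | hr | hr
      · rw [h.kernel3_centre h0 h3 hr, if_neg fun h' => hwB'.2 ⟨hr, h'⟩,
          indicator_of_notMem (s := Ioo (-e) (-x₃)), indicator_of_notMem (s := Ioo x₃ e),
          indicator_of_notMem (s := {z : ℝ | fR ρ η β x₃ < |z| ∧ |z| < x₃}),
          indicator_of_notMem (s := Ioo (-e) (-x₃)), indicator_of_notMem (s := Ioo x₃ e),
          indicator_of_notMem (s := {z : ℝ | fR ρ η β x₃ < |z| ∧ |z| < x₃}),
          indicator_of_mem (s := {z : ℝ | |z| < fR ρ η β x₃}) hr,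
          indicator_of_mem (s := {z : ℝ | |z| < fR ρ η β x₃}) hr]
        · simp only [zero_add]
          exact ⟨rfl, hkc.epsilon_lt hr⟩
        all_goals simp only [mem_Ioo, mem_ofPred_eq]; grind
      · rw [h.kernel3_ring h0 h3 hr,
          indicator_of_notMem (s := Ioo (-e) (-x₃)), indicator_of_notMem (s := Ioo x₃ e),
          indicator_of_notMem (s := {z : ℝ | |z| < fR ρ η β x₃}),
          indicator_of_notMem (s := Ioo (-e) (-x₃)), indicator_of_notMem (s := Ioo x₃ e),
          indicator_of_notMem (s := {z : ℝ | |z| < fR ρ η β x₃}),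
          indicator_of_mem (s := {z : ℝ | fR ρ η β x₃ < |z| ∧ |z| < x₃}) hr,
          indicator_of_mem (s := {z : ℝ | fR ρ η β x₃ < |z| ∧ |z| < x₃}) hr]
        · simp only [zero_add, add_zero]
          exact ⟨rfl, hkr.epsilon_lt hr.2⟩
        all_goals simp only [mem_Ioo, mem_ofPred_eq]; grind
      · obtain ⟨r1, r2, -, -⟩ := hright _ hr
        rw [kernel3_right h0 hr,
          indicator_of_notMem (s := Ioo (-e) (-x₃)), indicator_of_mem (s := Ioo x₃ e) hr,
          indicator_of_notMem (s := {z : ℝ | |z| < fR ρ η β x₃}),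
          indicator_of_notMem (s := {z : ℝ | fR ρ η β x₃ < |z| ∧ |z| < x₃}),
          indicator_of_notMem (s := Ioo (-e) (-x₃)), indicator_of_mem (s := Ioo x₃ e) hr,
          indicator_of_notMem (s := {z : ℝ | |z| < fR ρ η β x₃}),
          indicator_of_notMem (s := {z : ℝ | fR ρ η β x₃ < |z| ∧ |z| < x₃})]
        · simp only [zero_add, add_zero, true_and]
          exact ⟨r1, r2⟩
        all_goals simp only [mem_Ioo, mem_ofPred_eq] at *; grind
      · obtain ⟨l0, l1, l2⟩ := hlefteq _ hr
        obtain ⟨r1, r2, -, -⟩ := hright _ l0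
        rw [kernel3_left hr,
          indicator_of_mem (s := Ioo (-e) (-x₃)) hr, indicator_of_notMem (s := Ioo x₃ e),
          indicator_of_notMem (s := {z : ℝ | |z| < fR ρ η β x₃}),
          indicator_of_notMem (s := {z : ℝ | fR ρ η β x₃ < |z| ∧ |z| < x₃}),
          indicator_of_mem (s := Ioo (-e) (-x₃)) hr, indicator_of_notMem (s := Ioo x₃ e),
          indicator_of_notMem (s := {z : ℝ | |z| < fR ρ η β x₃}),
          indicator_of_notMem (s := {z : ℝ | fR ρ η β x₃ < |z| ∧ |z| < x₃})]
        · simp only [add_zero, true_and]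
          exact ⟨by linarith, by linarith⟩
        all_goals simp only [mem_Ioo, mem_ofPred_eq] at *; grind
      · exact absurd hr hwB'.1
  · filter_upwards [hae] with w hw hwS
    have hwS' := (hmemS w).1 hwS
    rcases hregion w hw.1 with hr | hr | hr | hr | hr
    · have hu : w.1 < η w.2 / ρ w.2 := by
        rcases hwS' with h' | h'
        · linarith
        · exact h'.2
      refine ⟨hψa _ (Or.inl hr.le), ?_⟩
      rw [h.kernel3_centre h0 h3 hr, if_pos hu.le, lintegral_dirac]
    · rcases hwS' with h' | h'
      · linarith [hr.2]
      · linarith [hr.1, h'.1]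
    · obtain ⟨r1, r2, r3, r4⟩ := hright _ hr
      have hw0 := h0.trans hr.1
      -- By monotonicity of `fR` and `gR`, the point and both its endpoints lie strictly between `fR
      -- x₃` and `gR x₃`, where `ψ` is one affine function, so a martingale step leaves its mean
      -- unchanged.
      have aff : ∀ y, fR ρ η β x₃ < y → y < gR ρ η β x₃ → ψ y = a x₃ + s * (y - x₃) := by
        intro y y1 y2
        have hy : |y| = y := abs_of_pos (hf.trans y1)
        have := lineBridge_of_mem (a := a) (b := b) (A := a x₃) (s := s) (c := x₃) (x := y)
          (f := fR ρ η β x₃) (g := gR ρ η β x₃) (by rw [hy]; exact y1.le) (by rw [hy]; exact y2.le)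
        rwa [hy] at this
      refine ⟨hψa _ (Or.inr (by rw [abs_of_pos hw0]; exact hr.1.le)), ?_⟩
      rw [kernel3_right h0 hr]
      exact lintegral_twoPoint_of_affine r1 r2 hψ0 (aff _ (r3.trans r1) (r2.trans r4))
        (aff _ r3 (r1.trans (r2.trans r4))) (aff _ (r3.trans (r1.trans r2)) r4)
    · obtain ⟨l0, l1, l2⟩ := hlefteq _ hr
      obtain ⟨r1, r2, r3, r4⟩ := hright _ l0
      have aff : ∀ y, fR ρ η β x₃ < -y → -y < gR ρ η β x₃ → ψ y = a x₃ + -s * (y - -x₃) := by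
        intro y y1 y2
        have hy : |y| = -y := abs_of_neg (by linarith)
        have := lineBridge_of_mem (a := a) (b := b) (A := a x₃) (s := s) (c := x₃) (x := y)
          (f := fR ρ η β x₃) (g := gR ρ η β x₃) (by rw [hy]; exact y1.le) (by rw [hy]; exact y2.le)
        rw [hy] at this
        rw [show a x₃ + -s * (y - -x₃) = a x₃ + s * (-y - x₃) by ring]
        exact this
      refine ⟨hψa _ (Or.inr (le_abs.2 (Or.inr l0.1.le))), ?_⟩
      rw [kernel3_left hr]
      exact lintegral_twoPoint_of_affine (by linarith) (by linarith) hψ0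
        (aff _ (by linarith) (by linarith)) (aff _ (by linarith) (by linarith))
        (aff _ (by linarith) (by linarith))
    · refine ⟨hψa _ (Or.inr (h3.le.trans hr)), ?_⟩
      rw [h.kernel3_outer h0 h3 hr, lintegral_dirac]
  -- In the continuation region only the centre and the ring remain. Their kernels charge points
  -- beyond `x₄` and beyond `gR x₃` in absolute value, where `ψ = b`.
  · filter_upwards [hae] with w hw hwS
    have hwS' := not_or.1 (fun h' => hwS ((hmemS w).2 h'))
    have hlt := not_le.1 hwS'.1
    refine ⟨haψ _ hlt.le, ?_⟩
    rcases hregion w hw.1 with hr | hr | hr | hr | hr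
    · have hu : ¬ w.1 ≤ η w.2 / ρ w.2 := fun h' =>
        hwS'.2 ⟨hr, lt_of_le_of_ne h' hw.2⟩
      rw [h.kernel3_centre h0 h3 hr, if_neg hu]
      exact hkc.lintegral_hkKernel_congr hr fun y hy =>
        congrArg ENNReal.ofReal (hψb y (hgx.trans hy))
    · rw [h.kernel3_ring h0 h3 hr]
      exact hkr.lintegral_hkKernel_congr hr.2 fun y hy =>
        congrArg ENNReal.ofReal (hψb y hy)
    · have := le_abs_self w.2
      linarith [hr.1]
    · have := neg_le_abs w.2
      linarith [hr.2]
    · linarith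

/-! ### The case `a(e) = b(e)` -/

omit [IsProbabilityMeasure μ] [IsProbabilityMeasure ν] h in
theorem kernel3'_centre {u x : ℝ} (hx : |x| < e) :
    kernel3' ρ η β e u x = if u ≤ η x / ρ x then Measure.dirac x else
      hkKernel ((Ioo (-e) e).indicator fun z => ρ z - η z) (tailDensity ρ η β e) e x := by
  unfold kernel3'
  by_cases hu : u ≤ η x / ρ x
  · rw [if_neg fun h' => absurd h'.2 (not_lt.2 hu), if_pos hu]
  · rw [if_pos ⟨hx, not_le.1 hu⟩, if_neg hu]

omit [IsProbabilityMeasure μ] [IsProbabilityMeasure ν] h in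
theorem kernel3'_outer {u x : ℝ} (hx : e ≤ |x|) : kernel3' ρ η β e u x = Measure.dirac x := by
  unfold kernel3'
  rw [if_neg fun h' => absurd h'.1 (not_lt.2 hx)]

theorem lintegral_kernel3' {A : Set ℝ} (hA : MeasurableSet A) :
    ∫⁻ x, (∫⁻ u in Icc (0 : ℝ) 1, kernel3' ρ η β e u x A) ∂μ = ν A := by
  have hk := h.hkDens_dispersion
  have mC : MeasurableSet (Ioo (-e) e) := measurableSet_Ioo
  have unit : ∀ m : ENNReal, ∫⁻ _ in Icc (0 : ℝ) 1, m = m := fun m => by simp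
  have pC : ∫⁻ x in Ioo (-e) e, (∫⁻ u in Icc (0 : ℝ) 1, kernel3' ρ η β e u x A) ∂(dens ρ) =
      dens ((Ioo (-e) e).indicator η) A + dens (tailDensity ρ η β e) A := by
    rw [← h.lintegral_mixture mC (fun x hx => abs_lt.2 hx) hk hA]
    refine setLIntegral_congr_fun mC fun x hx => lintegral_congr fun u => ?_
    rw [kernel3'_centre (abs_lt.2 hx)]
    split_ifs <;> rfl
  have pO : ∫⁻ x in (Ioo (-e) e)ᶜ, (∫⁻ u in Icc (0 : ℝ) 1, kernel3' ρ η β e u x A) ∂(dens ρ) =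
      dens ((Ioo (-e) e)ᶜ.indicator ρ) A := by
    rw [← setLIntegral_dirac mC.compl hA]
    refine setLIntegral_congr_fun mC.compl fun x hx => ?_
    simp only [kernel3'_outer (not_lt.1 fun h' => hx (abs_lt.1 h')), unit]
  have d1 : IsDensity ((Ioo (-e) e).indicator η) := h.eta.indicator mC
  have d3 : IsDensity ((Ioo (-e) e)ᶜ.indicator ρ) := h.rho.indicator mC.compl
  rw [show μ = dens ρ from h.density_mu, show ν = dens η from h.density_nu,
    ← lintegral_add_compl _ mC, pC, pO]
  simp only [← Measure.add_apply]
  rw [← dens_add d1 hk.target, ← dens_add (d1.add hk.target) d3]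
  congr 1
  refine dens_congr_ae ?_
  have hnull : ∀ᵐ z : ℝ, |z| ≠ e := by
    refine measure_mono_null (t := {e, -e}) (fun z hz => ?_) ((Set.toFinite _).measure_zero _)
    have hz' : |z| = e := not_not.1 hz
    exact eq_or_eq_neg_of_abs_eq hz'
  filter_upwards [h.eta_zero, h.rho_zero, hnull] with z e1 e2 hz
  unfold tailDensity
  simp only [indicator_apply, mem_ofPred_eq, mem_compl_iff, mem_Ioo, ← abs_lt]
  rw [← not_lt] at e1 e2
  by_cases hb : ((|z| : ℝ) : EReal) < β
  · simp only [hb, and_true]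
    clear * - hz
    grind
  · simp only [e1 hb, e2 hb, sub_zero, ite_self, add_zero]

/-- Slackness is immediate here: mass that stays put preserves `ψ`, mass that moves starts where `ψ
= a` and ends beyond `e`, where `ψ = b`. The equality at `e` is needed only for the convexity of
`ψ`. -/
theorem optimal_kernel3' {a b : ℝ → ℝ} (hab : SymmetricPayoffs a b β) (hab_e : a e = b e) :
    OptimalWithoutGap.{u} μ ν a b (psi3' a b e) (jointLaw μ (kernel3' ρ η β e))
      (tau3' ρ η e) := by
  have hk := h.hkDens_dispersion
  have mC : MeasurableSet (Ioo (-e) e) := measurableSet_Ioo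
  have mr : Measurable fun w : ℝ × ℝ => η w.2 / ρ w.2 :=
    (h.measurable_eta.comp measurable_snd).div (h.measurable_rho.comp measurable_snd)
  have hψb : ∀ x, e < |x| → psi3' a b e x = b x := fun x hx => by rw [psi3', if_pos hx]
  have hψa : ∀ x, |x| < e → psi3' a b e x = a x := fun x hx => by rw [psi3', if_neg (not_lt.2 hx.le)]
  have hbψ : ∀ x, b x ≤ psi3' a b e x := fun x => by
    unfold psi3'
    split_ifs
    · exact le_rfl
    · exact hab.le x
  have mB : MeasurableSet {w : ℝ × ℝ | e ≤ |w.2| ∨ w.1 ≤ η w.2 / ρ w.2} :=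
    (measurableSet_le measurable_const measurable_snd.abs).union (measurableSet_le measurable_fst mr)
  have mS : MeasurableSet {w : ℝ × ℝ | e < |w.2| ∨ (|w.2| < e ∧ w.1 ≤ η w.2 / ρ w.2)} :=
    (measurableSet_lt measurable_const measurable_snd.abs).union
      ((measurableSet_lt measurable_snd.abs measurable_const).inter
        (measurableSet_le measurable_fst mr))
  obtain ⟨c1, c2⟩ := hk.aemeasurable_epsilon μ mC fun x hx => abs_lt.2 hx
  have hae := h.ae_randomised (N := {e, -e}) (Set.toFinite _)
  have hne : ∀ w : ℝ × ℝ, w.2 ∉ ({e, -e} : Set ℝ) → |w.2| ≠ e := fun w hw h' =>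
    hw (eq_or_eq_neg_of_abs_eq h')
  refine optimalWithoutGap_of_slackness
    (S := {w | e < |w.2| ∨ (|w.2| < e ∧ w.1 ≤ η w.2 / ρ w.2)})
    (B := {w | e ≤ |w.2| ∨ w.1 ≤ η w.2 / ρ w.2})
    hab.nonneg hab.le hab.convex_a hab.convex_b
    (convexOn_psi3' hab.convex_a hab.convex_b hab.le hab.even_a hab.even_b h.e_pos hab_e) hbψ
    h.convexOrder.1 h.convexOrder.2.1 h.integral_mu mS
    (fun ω hω => if_pos hω) (fun ω hω => if_neg hω) mB c1 c2 ?_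
    (fun A hA => h.lintegral_kernel3' hA) ?_ ?_
  · filter_upwards with w
    constructor
    · intro hw
      rcases le_or_gt e |w.2| with h' | h'
      · exact kernel3'_outer h'
      · rw [kernel3'_centre h', if_pos (hw.resolve_left (not_le.2 h'))]
    · intro hw
      have hw' := not_or.1 hw
      have hlt := not_le.1 hw'.1
      rw [kernel3'_centre hlt, if_neg hw'.2, indicator_of_mem (s := Ioo (-e) e) (abs_lt.1 hlt),
        indicator_of_mem (s := Ioo (-e) e) (abs_lt.1 hlt)]
      exact ⟨rfl, hk.epsilon_lt hlt⟩
  · filter_upwards with w hw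
    rcases hw with hw | hw
    · rw [kernel3'_outer hw.le, lintegral_dirac, hψb _ hw]
      exact ⟨hab.le _, rfl⟩
    · rw [kernel3'_centre hw.1, if_pos hw.2, lintegral_dirac, hψa _ hw.1]
      exact ⟨le_rfl, rfl⟩
  · filter_upwards [hae] with w hw hwS
    have hwS' := not_or.1 hwS
    have hlt := lt_of_le_of_ne (not_lt.1 hwS'.1) (hne w hw.1)
    rw [kernel3'_centre hlt, if_neg fun h' => hwS'.2 ⟨hlt, h'⟩, hψa _ hlt]
    exact ⟨le_rfl, hk.lintegral_hkKernel_congr hlt fun y hy => by rw [hψb y hy]⟩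

end

end SymmetricDispersion

end Bermudan

theorem theorem4 (μ ν : Measure ℝ) [IsProbabilityMeasure μ] [IsProbabilityMeasure ν]
    (ρ η : ℝ → ℝ) (α β : EReal) (e : ℝ) (a b : ℝ → ℝ)
    (hμν : Bermudan.SymmetricDispersion μ ν ρ η α β e)
    (hab : Bermudan.SymmetricPayoffs a b β)
    (hC3 : Bermudan.chord ρ η a b β (Bermudan.x₀ ρ η β e) 0 < a 0) :
    (b e < a e →
      (∃ x₃ : ℝ, Bermudan.IsCutoff ρ η a b β e x₃) ∧
      ∀ x₃ : ℝ, Bermudan.IsCutoff ρ η a b β e x₃ →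
        Bermudan.OptimalWithoutGap.{u} μ ν a b (Bermudan.psi3 ρ η a b β x₃)
          (Bermudan.jointLaw μ (Bermudan.kernel3 ρ η β e x₃)) (Bermudan.tau3 ρ η β x₃)) ∧
    (a e = b e →
      Bermudan.OptimalWithoutGap.{u} μ ν a b (Bermudan.psi3' a b e)
        (Bermudan.jointLaw μ (Bermudan.kernel3' ρ η β e)) (Bermudan.tau3' ρ η e)) := by
  refine ⟨fun hlt => ⟨hμν.exists_isCutoff hab.convex_a hab.convex_b hab.even_a hC3 hlt,
    fun x₃ hx₃ => hμν.optimal_kernel3 hab hx₃⟩, fun heq => hμν.optimal_kernel3' hab heq⟩
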